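/- Let $G$ be a (real, finite-dimensional) Lie group with Lie algebra $\mathfrak g$, let $K\subset G$ be a closed connected subgroup with Lie algebra $\mathfrak k$, and let $\pi:G\to G/K$ be the projection, where $G/K$ carries the smooth structure for which $\pi$ is a submersion. Put $\mathfrak g_{\mathbb C}=\mathfrak g\otimes\mathbb C$, $\mathfrak k_{\mathbb C}=\mathfrak k\otimes\mathbb C$. For a manifold $M$, let $(\mathcal V_M)_{\mathbb C}=(TM\oplus T^*M)\otimes\mathbb C$, with the complex bilinear extensions of the pairing $\langle X+\xi,Y+\eta\rangle=\xi(Y)+\eta(X)$ and of the Courant bracket $$[X+\xi,Y+\eta]=[X,Y]+\iota_Xd\eta+\tfrac12 d(\iota_X\eta)-\iota_Yd\xi-\tfrac12 d(\iota_Y\xi).$$ An almost Dirac structure on $M$ is a smooth complex subbundle $\mathcal D\subset(\mathcal V_M)_{\mathbb C}$ all of whose fibres are maximal isotropic. It is a Dirac structure if its smooth sections are closed under the Courant bracket. Let $\mathfrak g_{\mathbb C}^*\rtimes\mathfrak g_{\mathbb C}$ be the semidirect product Lie algebra for the coadjoint action (with $\mathfrak g_{\mathbb C}^*$ abelian), with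 the pairing $\langle X+\xi,Y+\eta\rangle=\xi(Y)+\eta(X)$. For a subspace $E\subset\mathfrak g_{\mathbb C}$ and $\varepsilon\in\wedge^2E^*$ put $$L(E,\varepsilon)=\{X+\xi \mid X\in E,\ \xi|_E=\varepsilon(X,\cdot)\}.$$ For an almost Dirac structure $\mathcal D$ on $G/K$ put $$(\pi^\star\mathcal D)_e=\{X+(d\pi_e)^*\xi \mid d\pi_eX+\xi\in\mathcal D_{\pi(e)}\}\subset\mathfrak g_{\mathbb C}^*\rtimes\mathfrak g_{\mathbb C}.$$ 1. The map $\mathcal D\mapsto(\pi^\star\mathcal D)_e$ is a bijection from the $G$-invariant almost Dirac structures on $G/K$ onto the maximal isotropic subspaces $L$ of $\mathfrak g_{\mathbb C}^*\rtimes\mathfrak g_{\mathbb C}$ with $\mathfrak k_{\mathbb C}\subset L$ and $[\mathfrak k_{\mathbb C},L]\subset L$. 2. The same map is a bijection from the $G$-invariant Dirac structures on $G/K$ onto the maximal isotropic Lie subalgebras $L$ of $\mathfrak g_{\mathbb C}^*\rtimes\mathfrak g_{\mathbb C}$ with $\mathfrak k_{\mathbb C}\subset L$. 3. Every maximal isotropic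 Lie subalgebra of $\mathfrak g_{\mathbb C}^*\rtimes\mathfrak g_{\mathbb C}$ is of the form $L(E,\varepsilon)$ with $E$ a Lie subalgebra of $\mathfrak g_{\mathbb C}$ and $\varepsilon\in\wedge^2E^*$. The map $(E,\varepsilon)\mapsto L(E,\varepsilon)$ is a bijection from the pairs consisting of a Lie subalgebra $E\subset\mathfrak g_{\mathbb C}$ containing $\mathfrak k_{\mathbb C}$ and $\varepsilon\in\wedge^2E^*$ such that $$d_E\varepsilon(X,Y,Z)=\varepsilon(X,[Y,Z])+\varepsilon(Y,[Z,X])+\varepsilon(Z,[X,Y])=0\qquad(X,Y,Z\in E)$$ and $\varepsilon_\sharp:X\mapsto\varepsilon(X,\cdot)$ vanishes on $\mathfrak k$, onto the Lie subalgebras $L$ of part 2. Hence the $G$-invariant Dirac structures on $G/K$ correspond bijectively to these pairs, through $(\pi^\star\mathcal D)_e=L(E,\varepsilon)$. -/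

import Mathlib

open scoped Manifold ContDiff TensorProduct Topology

noncomputable section

/-! ## Linear algebra on `W ⊕ W^*` for a complex vector space `W` -/

section Linear

variable {W W' : Type*} [AddCommGroup W] [Module ℂ W] [AddCommGroup W'] [Module ℂ W']

/-- The space `W ⊕ W^*`; the pair `(X, ξ)` stands for `X + ξ`. -/
abbrev GenSpace (W : Type*) [AddCommGroup W] [Module ℂ W] : Type _ := W × Module.Dual ℂ W

/-- The natural symmetric pairing `⟨X + ξ, Y + η⟩ = η(X) + ξ(Y)`. -/
def genPairing (a b : GenSpace W) : ℂ := b.2 a.1 + a.2 b.1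

/-- A subspace on which the natural pairing vanishes identically. -/
def IsIsotropic (L : Submodule ℂ (GenSpace W)) : Prop :=
  ∀ a ∈ L, ∀ b ∈ L, genPairing a b = 0

/-- A maximal isotropic subspace of `W ⊕ W^*` (a linear almost Dirac structure). -/
def IsMaxIsotropic (L : Submodule ℂ (GenSpace W)) : Prop :=
  Maximal IsIsotropic L

/-- For a linear map `F : W → W'` and `D ⊆ W' ⊕ W'^*`, the pullback
`F^⋆ D = {X + F^* ξ | F X + ξ ∈ D}`. -/
def genPullback (F : W →ₗ[ℂ] W') (D : Submodule ℂ (GenSpace W')) : Submodule ℂ (GenSpace W) :=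
  (D.comap (F.prodMap LinearMap.id)).map (LinearMap.id.prodMap F.dualMap)

/-- For a subspace `E` of `W` and `ε ∈ ∧² E^*`, the subspace
`L(E, ε) = {X + ξ | X ∈ E and ξ restricted to E is ι_X ε}`. -/
def genGraph (E : Submodule ℂ W) (ε : E [⋀^Fin 2]→ₗ[ℂ] ℂ) : Submodule ℂ (GenSpace W) where
  carrier := {a | ∃ h : a.1 ∈ E, ∀ Y : E, a.2 Y = ε ![⟨a.1, h⟩, Y]}
  zero_mem' := ⟨E.zero_mem, fun Y => by
    have : ε ![0, Y] = 0 := ε.map_coord_zero (m := ![(0 : E), Y]) 0 rfl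
    exact this.symm⟩
  add_mem' := by
    rintro a b ⟨ha, ha'⟩ ⟨hb, hb'⟩
    refine ⟨E.add_mem ha hb, fun Y => ?_⟩
    have := ε.map_vecCons_add (m := ![Y]) ⟨a.1, ha⟩ ⟨b.1, hb⟩
    simpa [ha', hb'] using this.symm
  smul_mem' := by
    rintro c a ⟨ha, ha'⟩
    refine ⟨E.smul_mem c ha, fun Y => ?_⟩
    have := ε.map_vecCons_smul (m := ![Y]) c ⟨a.1, ha⟩
    simpa [ha'] using this.symm

end Linear

/-! ## The semidirect product of a Lie algebra with its dual -/

section Semidirect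

variable (𝔩 : Type*) [LieRing 𝔩] [LieAlgebra ℂ 𝔩]

/-- The dual of `𝔩`, regarded as an abelian Lie algebra. -/
def AbelianDual : Type _ := Module.Dual ℂ 𝔩

instance : AddCommGroup (AbelianDual 𝔩) := inferInstanceAs (AddCommGroup (Module.Dual ℂ 𝔩))

instance : Module ℂ (AbelianDual 𝔩) := inferInstanceAs (Module ℂ (Module.Dual ℂ 𝔩))

instance : LieRing (AbelianDual 𝔩) where
  bracket _ _ := 0
  add_lie _ _ _ := (add_zero _).symm
  lie_add _ _ _ := (add_zero _).symm
  lie_self _ := rfl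
  leibniz_lie _ _ _ := (add_zero _).symm

instance : LieAlgebra ℂ (AbelianDual 𝔩) where
  lie_smul c _ _ := (smul_zero c).symm

/-- The identification of `AbelianDual 𝔩` with the dual space. -/
def AbelianDual.equiv : AbelianDual 𝔩 ≃ₗ[ℂ] Module.Dual ℂ 𝔩 := LinearEquiv.refl ℂ _

/-- The coadjoint representation, `(X · ξ)(Y) = -ξ([X, Y])`, as an action by derivations. -/
def coadjoint : 𝔩 →ₗ⁅ℂ⁆ LieDerivation ℂ (AbelianDual 𝔩) (AbelianDual 𝔩) where
  toFun X :=
    { toFun ξ := (AbelianDual.equiv 𝔩).symm ⁅X, AbelianDual.equiv 𝔩 ξ⁆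
      map_add' := fun ξ η => by simp
      map_smul' := fun c ξ => by simp
      leibniz' := fun ξ η => by
        change (AbelianDual.equiv 𝔩).symm ⁅X, AbelianDual.equiv 𝔩 0⁆ = 0 - 0
        simp }
  map_add' X Y := by ext ξ; simp
  map_smul' c X := by ext ξ; simp
  map_lie' {X Y} := by
    ext ξ
    simp [lie_lie]

/-- The semidirect product Lie algebra `𝔩^* ⋊ 𝔩`. -/
abbrev DualSemidirect : Type _ :=
  LieAlgebra.SemiDirectSum (AbelianDual 𝔩) 𝔩 (coadjoint 𝔩)

/-- The identification of `𝔩^* ⋊ 𝔩` with `𝔩 ⊕ 𝔩^*` as a vector space. -/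
def DualSemidirect.toGen : DualSemidirect 𝔩 ≃ₗ[ℂ] GenSpace 𝔩 :=
  (LieAlgebra.SemiDirectSum.toProdl (coadjoint 𝔩)).trans
    ((LinearEquiv.prodComm ℂ _ _).trans
      (LinearEquiv.prodCongr (LinearEquiv.refl ℂ 𝔩) (AbelianDual.equiv 𝔩)))

variable {𝔩}

/-- The Lie algebra differential of `ε ∈ ∧² E^*`,
`d_E ε (X, Y, Z) = ε(X, [Y, Z]) + ε(Y, [Z, X]) + ε(Z, [X, Y])`. -/
def lieDifferential (E : LieSubalgebra ℂ 𝔩) (ε : E.toSubmodule [⋀^Fin 2]→ₗ[ℂ] ℂ)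
    (X Y Z : E.toSubmodule) : ℂ :=
  ε ![X, ⟨⁅(Y : 𝔩), (Z : 𝔩)⁆, E.lie_mem Y.2 Z.2⟩]
    + ε ![Y, ⟨⁅(Z : 𝔩), (X : 𝔩)⁆, E.lie_mem Z.2 X.2⟩]
    + ε ![Z, ⟨⁅(X : 𝔩), (Y : 𝔩)⁆, E.lie_mem X.2 Y.2⟩]

/-- The subspace `L(E, ε)` of `𝔩^* ⋊ 𝔩`. -/
def linearGraph (E : Submodule ℂ 𝔩) (ε : E [⋀^Fin 2]→ₗ[ℂ] ℂ) : Submodule ℂ (DualSemidirect 𝔩) :=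
  (genGraph E ε).comap (DualSemidirect.toGen 𝔩).toLinearMap

/-- A linear almost Dirac structure: a maximal isotropic subspace of `𝔩^* ⋊ 𝔩`. -/
def IsLinearAlmostDirac (L : Submodule ℂ (DualSemidirect 𝔩)) : Prop :=
  IsMaxIsotropic (L.map (DualSemidirect.toGen 𝔩).toLinearMap)

/-- A Dirac Lie subalgebra: a maximal isotropic subspace that is a Lie subalgebra of `𝔩^* ⋊ 𝔩`. -/
def IsLinearDirac (L : Submodule ℂ (DualSemidirect 𝔩)) : Prop :=
  IsLinearAlmostDirac L ∧ ∀ a ∈ L, ∀ b ∈ L, ⁅a, b⁆ ∈ L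

/-- `L` contains the subspace `𝔨` of `𝔩`. -/
def ContainsSubalgebra (𝔨 : Submodule ℂ 𝔩) (L : Submodule ℂ (DualSemidirect 𝔩)) : Prop :=
  ∀ X ∈ 𝔨, LieAlgebra.SemiDirectSum.inr (coadjoint 𝔩) X ∈ L

/-- `L` is stable under the action of `𝔨`, that is `[𝔨, L] ⊆ L`. -/
def IsStableUnder (𝔨 : Submodule ℂ 𝔩) (L : Submodule ℂ (DualSemidirect 𝔩)) : Prop :=
  ∀ X ∈ 𝔨, ∀ a ∈ L, ⁅LieAlgebra.SemiDirectSum.inr (coadjoint 𝔩) X, a⁆ ∈ L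

variable (𝔩) in
/-- Pairs of a Lie subalgebra `E` of `𝔩` and an element `ε` of `∧² E^*`. -/
abbrev PrePair : Type _ :=
  Σ E : LieSubalgebra ℂ 𝔩, E.toSubmodule [⋀^Fin 2]→ₗ[ℂ] ℂ

/-- A Dirac pair `(E, ε)` relative to `𝔨`: the Lie subalgebra `E` contains `𝔨`, `d_E ε = 0`, and
`ε_♯ : X ↦ ε(X, ·)` vanishes on `𝔨`. -/
def IsDiracPair (𝔨 : Submodule ℂ 𝔩) (q : PrePair 𝔩) : Prop :=
  𝔨 ≤ q.1.toSubmodule ∧ (∀ X Y Z, lieDifferential q.1 q.2 X Y Z = 0) ∧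
    ∀ X Y : q.1.toSubmodule, (X : 𝔩) ∈ 𝔨 → q.2 ![X, Y] = 0

end Semidirect

/-! ## Complex Dirac structures on a manifold -/

section Manifold

variable {E : Type*} [NormedAddCommGroup E] [NormedSpace ℝ E]
  {M : Type*} [TopologicalSpace M] [ChartedSpace E M]

variable (E) in
/-- Sections (not necessarily smooth) of `TM ⊕ T^*M`. -/
abbrev RealSection (M : Type*) [TopologicalSpace M] [ChartedSpace E M] : Type _ :=
  ∀ p : M, TangentSpace 𝓘(ℝ, E) p × (TangentSpace 𝓘(ℝ, E) p →L[ℝ] ℝ)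

/-- Smoothness of a section of `TM ⊕ T^*M` on a set. -/
def RealSection.SmoothOn [IsManifold 𝓘(ℝ, E) ∞ M] (s : RealSection E M) (U : Set M) : Prop :=
  ContMDiffOn 𝓘(ℝ, E) (𝓘(ℝ, E).prod 𝓘(ℝ, E)) ∞
      (fun p => Bundle.TotalSpace.mk' E (E := (TangentSpace 𝓘(ℝ, E) : M → Type _)) p (s p).1) U ∧
    ContMDiffOn 𝓘(ℝ, E) (𝓘(ℝ, E).prod 𝓘(ℝ, E →L[ℝ] ℝ)) ∞
      (fun p => Bundle.TotalSpace.mk' (E →L[ℝ] ℝ)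
        (E := fun p : M => TangentSpace 𝓘(ℝ, E) p →L[ℝ] Bundle.Trivial M ℝ p) p (s p).2) U

/-- A one-form `η` read in the preferred chart around `p`. -/
def oneFormInChart (η : ∀ q : M, TangentSpace 𝓘(ℝ, E) q →L[ℝ] ℝ) (p : M) (z : E) : E →L[ℝ] ℝ :=
  (η ((extChartAt 𝓘(ℝ, E) p).symm z)).comp
    (mfderiv 𝓘(ℝ, E) 𝓘(ℝ, E) (extChartAt 𝓘(ℝ, E) p).symm z)

/-- The contraction `ι_X dη` at `p` of the exterior derivative of the one-form `η` with the tangent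
vector `X`; in the chart, `dη (v, w) = (D_v η)(w) - (D_w η)(v)`. -/
def contractExtDeriv (η : ∀ q : M, TangentSpace 𝓘(ℝ, E) q →L[ℝ] ℝ) (p : M)
    (X : TangentSpace 𝓘(ℝ, E) p) : TangentSpace 𝓘(ℝ, E) p →L[ℝ] ℝ :=
  let φ' : TangentSpace 𝓘(ℝ, E) p →L[ℝ] E := mfderiv 𝓘(ℝ, E) 𝓘(ℝ, E) (extChartAt 𝓘(ℝ, E) p) p
  let A : E →L[ℝ] E →L[ℝ] ℝ := fderiv ℝ (oneFormInChart η p) (extChartAt 𝓘(ℝ, E) p p)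
  (A (φ' X) - A.flip (φ' X)).comp φ'

/-- The differential at `p` of the function `ι_X η`. -/
def diffContract (X : ∀ q : M, TangentSpace 𝓘(ℝ, E) q)
    (η : ∀ q : M, TangentSpace 𝓘(ℝ, E) q →L[ℝ] ℝ) (p : M) : TangentSpace 𝓘(ℝ, E) p →L[ℝ] ℝ :=
  mfderiv 𝓘(ℝ, E) 𝓘(ℝ, ℝ) (fun q => η q (X q)) p

/-- The Courant bracket
`[X + ξ, Y + η] = [X, Y] + ι_X dη + 1/2 d(ι_X η) - ι_Y dξ - 1/2 d(ι_Y ξ)`. -/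
def courantBracket (s t : RealSection E M) : RealSection E M := fun p =>
  (VectorField.mlieBracket 𝓘(ℝ, E) (fun q => (s q).1) (fun q => (t q).1) p,
    contractExtDeriv (fun q => (t q).2) p (s p).1
      + (1 / 2 : ℝ) • diffContract (fun q => (s q).1) (fun q => (t q).2) p
      - contractExtDeriv (fun q => (s q).2) p (t p).1
      - (1 / 2 : ℝ) • diffContract (fun q => (t q).1) (fun q => (s q).2) p)

/-- The complexification of a tangent space. -/
abbrev ComplexTangent (E : Type*) [NormedAddCommGroup E] [NormedSpace ℝ E]
    {M : Type*} [TopologicalSpace M] [ChartedSpace E M] (p : M) : Type _ :=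
  ℂ ⊗[ℝ] TangentSpace 𝓘(ℝ, E) p

/-- The complexification of the derivative of a map. -/
def complexDeriv {E' : Type*} [NormedAddCommGroup E'] [NormedSpace ℝ E']
    {N : Type*} [TopologicalSpace N] [ChartedSpace E' N] (f : M → N) (p : M) :
    ComplexTangent E p →ₗ[ℂ] ComplexTangent E' (f p) :=
  (mfderiv 𝓘(ℝ, E) 𝓘(ℝ, E') f p).toLinearMap.baseChange ℂ

/-- The inclusion of `T_pM ⊕ T_p^*M` in its complexification. -/
def toComplex {p : M} (v : TangentSpace 𝓘(ℝ, E) p × (TangentSpace 𝓘(ℝ, E) p →L[ℝ] ℝ)) :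
    GenSpace (ComplexTangent E p) :=
  ((1 : ℂ) ⊗ₜ[ℝ] v.1, Module.Dual.baseChange ℂ v.2.toLinearMap)

variable (E) in
/-- Sections of `(TM ⊕ T^*M) ⊗ ℂ`, given by their real and imaginary parts. -/
structure ComplexSection (M : Type*) [TopologicalSpace M] [ChartedSpace E M] where
  re : RealSection E M
  im : RealSection E M

namespace ComplexSection

/-- The value `re + i im` of a complex section at a point. -/
def val (s : ComplexSection E M) (p : M) : GenSpace (ComplexTangent E p) :=
  toComplex (s.re p) + Complex.I • toComplex (s.im p)

/-- Smoothness of a complex section on a set. -/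
def SmoothOn [IsManifold 𝓘(ℝ, E) ∞ M] (s : ComplexSection E M) (U : Set M) : Prop :=
  s.re.SmoothOn U ∧ s.im.SmoothOn U

/-- The complex bilinear extension of the Courant bracket. -/
def courant (s t : ComplexSection E M) : ComplexSection E M where
  re := courantBracket s.re t.re - courantBracket s.im t.im
  im := courantBracket s.re t.im + courantBracket s.im t.re

end ComplexSection

variable (E) in
/-- Families of complex subspaces of the fibres of `(TM ⊕ T^*M) ⊗ ℂ`. -/
abbrev SubspaceFamily (M : Type*) [TopologicalSpace M] [ChartedSpace E M] : Type _ :=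
  ∀ p : M, Submodule ℂ (GenSpace (ComplexTangent E p))

namespace SubspaceFamily

/-- A smooth complex subbundle: locally the span of a smooth frame. -/
def IsSubbundle [IsManifold 𝓘(ℝ, E) ∞ M] (D : SubspaceFamily E M) : Prop :=
  ∀ p : M, ∃ U : Set M, IsOpen U ∧ p ∈ U ∧ ∃ (r : ℕ) (s : Fin r → ComplexSection E M),
    (∀ i, (s i).SmoothOn U) ∧
      ∀ q ∈ U, LinearIndependent ℂ (fun i => (s i).val q) ∧
        D q = Submodule.span ℂ (Set.range fun i => (s i).val q)

/-- A complex almost Dirac structure: a maximal isotropic subbundle. -/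
def IsAlmostDirac [IsManifold 𝓘(ℝ, E) ∞ M] (D : SubspaceFamily E M) : Prop :=
  D.IsSubbundle ∧ ∀ p, IsMaxIsotropic (D p)

/-- Integrability: the (local) smooth sections of `D` are closed under the Courant bracket. -/
def IsIntegrable [IsManifold 𝓘(ℝ, E) ∞ M] (D : SubspaceFamily E M) : Prop :=
  ∀ U : Set M, IsOpen U → ∀ s t : ComplexSection E M, s.SmoothOn U → t.SmoothOn U →
    (∀ p ∈ U, s.val p ∈ D p) → (∀ p ∈ U, t.val p ∈ D p) → ∀ p ∈ U, (s.courant t).val p ∈ D p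

/-- Invariance under a group action: `D` agrees with its pullback under every translation. -/
def IsInvariant (G : Type*) [SMul G M] (D : SubspaceFamily E M) : Prop :=
  ∀ (g : G) (p : M), genPullback (complexDeriv (fun q : M => g • q) p) (D (g • p)) = D p

end SubspaceFamily

end Manifold

/-! ## Homogeneous spaces -/

section Homogeneous

instance leInftyMinSmoothness : ENat.LEInfty (minSmoothness ℝ 3) :=
  ⟨by rw [minSmoothness_of_isRCLikeNormedField]; exact ENat.LEInfty.out⟩

variable (E : Type*) [NormedAddCommGroup E] [NormedSpace ℝ E]
  {G : Type*} [TopologicalSpace G] [ChartedSpace E G] [Group G]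

/-- The Lie algebra of a closed subgroup `K`: the vectors `X` whose one-parameter subgroup
`t ↦ exp (t X)`, the integral curve through `1` of the left-invariant field of `X`, lies in `K`. -/
def subgroupLieAlgebra (K : Subgroup G) : Set (GroupLieAlgebra 𝓘(ℝ, E) G) :=
  {X | ∃ γ : ℝ → G, IsMIntegralCurve (I := 𝓘(ℝ, E)) γ (mulInvariantVectorField X) ∧ γ 0 = 1 ∧
    ∀ t, γ t ∈ K}

variable (G) in
/-- The complexified Lie algebra of a Lie group. -/
abbrev ComplexLieAlgebra : Type _ := ℂ ⊗[ℝ] GroupLieAlgebra 𝓘(ℝ, E) G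

/-- The complexification of the Lie algebra of a closed subgroup. -/
def complexSubgroupLieAlgebra (K : Subgroup G) : Submodule ℂ (ComplexLieAlgebra E G) :=
  Submodule.span ℂ
    ((fun X : GroupLieAlgebra 𝓘(ℝ, E) G => (1 : ℂ) ⊗ₜ[ℝ] X) '' subgroupLieAlgebra E K)

variable [CompleteSpace E] [LieGroup 𝓘(ℝ, E) ∞ G]

/-- The subspace `(π^⋆ D)_e` of `𝔤_ℂ^* ⋊ 𝔤_ℂ` given by `D` on `G ⧸ K`, with `π` the projection. -/
def pullbackAtOne (K : Subgroup G) {E' : Type*} [NormedAddCommGroup E'] [NormedSpace ℝ E']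
    [ChartedSpace E' (G ⧸ K)] (D : SubspaceFamily E' (G ⧸ K)) :
    Submodule ℂ (DualSemidirect (ComplexLieAlgebra E G)) :=
  (genPullback (complexDeriv (E := E) (E' := E') (QuotientGroup.mk : G → G ⧸ K) 1)
    (D (QuotientGroup.mk 1))).comap (DualSemidirect.toGen (ComplexLieAlgebra E G)).toLinearMap

end Homogeneous

end

/-! A subspace of `W ⊕ W^*` is maximal isotropic exactly when it equals its own orthogonal
(`isMaxIsotropic_iff`), and it is then a graph `L(E, ε)` (`IsMaxIsotropic.exists_eq_genGraph`).
Membership can therefore be tested by pairing, and every condition on brackets becomes the vanishing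
of the trilinear form `⟨[a, b], c⟩`. On `L(E, ε)` with `E` a subalgebra this form is `d_E ε`, which
settles the correspondence with pairs by pure algebra (`bijOn_linearGraph`).

An invariant family on `G ⧸ K` is determined by its fibre at the base point, and a subspace there
extends to an invariant family once the isotropy representation of `K` fixes it. The derivative of
the projection at the identity is onto with kernel `𝔨` (`subgroupLieAlgebra_eq`), so pulling back
identifies the maximal isotropic fibres with the maximal isotropic `L` containing `𝔨_ℂ`
(`exists_genPullback_eq`, `genPullback_injective`) and turns isotropy invariance into invariance
under the adjoint action of `K` (`conjGen_mem_iff`). Differentiating along curves in `K` gives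
`[𝔨_ℂ, L] ⊆ L` (`lieForm_eq_zero_of_conjGen`). Conversely, the pairings of a moved element with a
basis of `L` solve a homogeneous linear differential equation with zero initial value, and
connectedness of `K` carries the conclusion from a neighbourhood of `1` to all of `K`
(`conjGen_mem`). Smoothness of the family is automatic: a basis of one fibre is translated along a
local section of the projection (`isSubbundle_of_invariant`).

For integrability, take a local section `σ` and its Maurer-Cartan form `Θ = σ⁻¹ dσ`. It lifts
sections `s`, `t` of the family to `L`-valued functions `ℓ`, `m`. By the Maurer-Cartan equation, the
Courant bracket of `s` and `t` paired with `a` is `⟨[ℓ, m], ã⟩`, with `ã` the lift of `a`, plus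
terms that pair a derivative of `ℓ` or `m` with an element of `L` (`realPairing_courantBracket`).
Derivatives of `L`-valued functions stay in `L`, so isotropy kills these terms
(`genPairing_courant`). Lifts of values of sections together with `𝔨_ℂ` exhaust `L`
(`exists_section_lift`), and stability makes the form vanish as soon as one entry lies in `𝔨_ℂ`.
Hence the family is integrable exactly when `L` is a Lie subalgebra (`isIntegrable_iff`). -/

open scoped Manifold ContDiff TensorProduct Topology

noncomputable section

/-! ### Linear algebra of isotropic subspaces: graphs, self-orthogonality, pullbacks. -/

section GenSpaceAlgebra

variable {W W' W'' : Type*} [AddCommGroup W] [Module ℂ W] [AddCommGroup W'] [Module ℂ W']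
  [AddCommGroup W''] [Module ℂ W'']

lemma genPairing_comm (a b : GenSpace W) : genPairing a b = genPairing b a := by
  simp only [genPairing]; ring

lemma genPairing_add_left (a b c : GenSpace W) :
    genPairing (a + b) c = genPairing a c + genPairing b c := by
  simp only [genPairing, Prod.fst_add, Prod.snd_add, map_add, LinearMap.add_apply]; ring

lemma genPairing_add_right (a b c : GenSpace W) :
    genPairing a (b + c) = genPairing a b + genPairing a c := by
  rw [genPairing_comm, genPairing_add_left, genPairing_comm b, genPairing_comm c]

lemma genPairing_smul_left (r : ℂ) (a b : GenSpace W) :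
    genPairing (r • a) b = r * genPairing a b := by
  simp only [genPairing, Prod.smul_fst, Prod.smul_snd, map_smul, LinearMap.smul_apply,
    smul_eq_mul]; ring

lemma genPairing_smul_right (r : ℂ) (a b : GenSpace W) :
    genPairing a (r • b) = r * genPairing a b := by
  rw [genPairing_comm, genPairing_smul_left, genPairing_comm]

lemma genPairing_sum_right {ι : Type*} (s : Finset ι) (a : GenSpace W) (b : ι → GenSpace W) :
    genPairing a (∑ i ∈ s, b i) = ∑ i ∈ s, genPairing a (b i) :=
  map_sum (AddMonoidHom.mk' (genPairing a) (genPairing_add_right a)) b s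

lemma alternating_swap {E : Submodule ℂ W} (ε : E [⋀^Fin 2]→ₗ[ℂ] ℂ) (X Y : E) :
    ε ![X, Y] = -ε ![Y, X] := by
  have := ε.map_swap ![Y, X] (i := 0) (j := 1) (by simp)
  rw [← this]
  congr 1
  ext i; fin_cases i <;> simp

lemma exists_functional_extending {E : Submodule ℂ W} (f : E →ₗ[ℂ] ℂ) :
    ∃ g : Module.Dual ℂ W, ∀ Y : E, g Y = f Y := by
  obtain ⟨g, hg⟩ := f.exists_extend
  exact ⟨g, fun Y => by rw [← hg]; rfl⟩

/-- The functional `ε(X, ·)` on `E` extends to all of `W`, so the graph projects onto `E`. -/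
lemma exists_mem_genGraph {E : Submodule ℂ W} (ε : E [⋀^Fin 2]→ₗ[ℂ] ℂ) (X : E) :
    ∃ ξ : Module.Dual ℂ W, ((X : W), ξ) ∈ genGraph E ε := by
  obtain ⟨g, hg⟩ := exists_functional_extending (E := E)
    { toFun := fun Y => ε ![X, Y]
      map_add' := fun Y Z => by
        rw [alternating_swap ε X (Y + Z), alternating_swap ε X Y, alternating_swap ε X Z,
          ← neg_add]
        exact congrArg _ (ε.map_vecCons_add (m := ![X]) Y Z)
      map_smul' := fun c Y => by
        rw [alternating_swap ε X (c • Y), alternating_swap ε X Y]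
        have := ε.map_vecCons_smul (m := ![X]) c Y
        simp only [RingHom.id_apply, smul_neg]
        exact congrArg _ this }
  exact ⟨g, X.2, fun Y => hg Y⟩

lemma isIsotropic_genGraph (E : Submodule ℂ W) (ε : E [⋀^Fin 2]→ₗ[ℂ] ℂ) :
    IsIsotropic (genGraph E ε) := by
  rintro a ⟨ha, ha'⟩ b ⟨hb, hb'⟩
  have h1 := ha' ⟨b.1, hb⟩
  have h2 := hb' ⟨a.1, ha⟩
  simp only at h1 h2
  rw [genPairing, h1, h2, alternating_swap]
  simp

/-- The graph contains `(0, f)` for every `f` killing `E`; if the vector part of `a` were outside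
`E`, some such `f` would pair nontrivially with it. Pairing with elements over each `Y ∈ E` then
reads off the covector part on `E`. -/
lemma genGraph_selfOrthogonal (E : Submodule ℂ W) (ε : E [⋀^Fin 2]→ₗ[ℂ] ℂ) (a : GenSpace W)
    (h : ∀ b ∈ genGraph E ε, genPairing a b = 0) : a ∈ genGraph E ε := by
  have hE : a.1 ∈ E := by
    by_contra hn
    obtain ⟨f, hf, hf'⟩ := Submodule.exists_le_ker_of_notMem hn
    have hm : ((0 : W), f) ∈ genGraph E ε := by
      refine ⟨E.zero_mem, fun Y => ?_⟩
      have h0 : ε ![0, Y] = 0 := ε.map_coord_zero (m := ![(0 : E), Y]) 0 rfl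
      have h1 : f Y = 0 := hf' Y.2
      rw [h1]; exact h0.symm
    have := h _ hm
    simp only [genPairing, map_zero, add_zero] at this
    exact hf this
  refine ⟨hE, fun Y => ?_⟩
  obtain ⟨η, hη⟩ := exists_mem_genGraph ε Y
  have h1 := h _ hη
  obtain ⟨_, h2⟩ := hη
  have h3 := h2 ⟨a.1, hE⟩
  simp only [genPairing] at h1 h3
  rw [h3] at h1
  rw [alternating_swap]
  linear_combination h1

/-- Two covectors of `L` over the same vector agree on the projection of `L`, because both pair to
zero with everything in `L`. So `ε(X, Y) = ξ_X(Y)` is well defined and bilinear, and isotropy of a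
single element makes it alternating since `2 ≠ 0`. -/
lemma exists_genGraph_of_isIsotropic {L : Submodule ℂ (GenSpace W)} (hL : IsIsotropic L) :
    ∃ ε : (L.map (LinearMap.fst ℂ W (Module.Dual ℂ W))) [⋀^Fin 2]→ₗ[ℂ] ℂ,
      L ≤ genGraph (L.map (LinearMap.fst ℂ W (Module.Dual ℂ W))) ε := by
  set E := L.map (LinearMap.fst ℂ W (Module.Dual ℂ W)) with hE
  have hex : ∀ X : E, ∃ ξ : Module.Dual ℂ W, ((X : W), ξ) ∈ L := by
    rintro ⟨X, a, ha, rfl⟩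
    exact ⟨a.2, ha⟩
  choose ξ hξ using hex
  have huniq : ∀ (X : E) (η : Module.Dual ℂ W), ((X : W), η) ∈ L → ∀ Y : E, η Y = ξ X Y := by
    intro X η hη Y
    have h1 := hL _ hη _ (hξ Y)
    have h2 := hL _ (hξ X) _ (hξ Y)
    simp only [genPairing] at h1 h2
    linear_combination h1 - h2
  let B : E →ₗ[ℂ] E →ₗ[ℂ] ℂ := LinearMap.mk₂ ℂ (fun X Y => ξ X Y)
    (fun X X' Y => by
      have := huniq (X + X') (ξ X + ξ X') (by simpa using L.add_mem (hξ X) (hξ X')) Y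
      rw [← this]; rfl)
    (fun c X Y => by
      have := huniq (c • X) (c • ξ X) (by simpa using L.smul_mem c (hξ X)) Y
      rw [← this]; rfl)
    (fun X Y Y' => by simp)
    (fun c X Y => by simp)
  have hBalt : ∀ X : E, B X X = 0 := by
    intro X
    have := hL _ (hξ X) _ (hξ X)
    simp only [genPairing] at this
    have h2 : (2 : ℂ) * ξ X X = 0 := by linear_combination this
    exact (mul_eq_zero.1 h2).resolve_left two_ne_zero
  let ε : E [⋀^Fin 2]→ₗ[ℂ] ℂ :=
    { toFun := fun v => B (v 0) (v 1)
      map_update_add' := by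
        intro _ v i x y
        fin_cases i <;> simp
      map_update_smul' := by
        intro _ v i c x
        fin_cases i <;> simp
      map_eq_zero_of_eq' := by
        intro v i j hij hne
        have : v 0 = v 1 := by
          fin_cases i <;> fin_cases j <;> simp_all
        change B (v 0) (v 1) = 0
        rw [this]; exact hBalt _ }
  refine ⟨ε, ?_⟩
  intro a ha
  refine ⟨⟨a, ha, rfl⟩, fun Y => ?_⟩
  exact huniq ⟨a.1, ⟨a, ha, rfl⟩⟩ a.2 ha Y

lemma IsMaxIsotropic.exists_eq_genGraph {L : Submodule ℂ (GenSpace W)} (hL : IsMaxIsotropic L) :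
    ∃ ε : (L.map (LinearMap.fst ℂ W (Module.Dual ℂ W))) [⋀^Fin 2]→ₗ[ℂ] ℂ,
      L = genGraph (L.map (LinearMap.fst ℂ W (Module.Dual ℂ W))) ε := by
  obtain ⟨ε, hε⟩ := exists_genGraph_of_isIsotropic hL.1
  exact ⟨ε, le_antisymm hε (hL.2 (isIsotropic_genGraph _ _) hε)⟩

lemma isMaxIsotropic_of_selfOrthogonal {L : Submodule ℂ (GenSpace W)}
    (h : ∀ a, a ∈ L ↔ ∀ b ∈ L, genPairing a b = 0) : IsMaxIsotropic L :=
  ⟨fun a ha b hb => (h a).1 ha b hb, fun _ hM hLM a ha =>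
    (h a).2 fun _ hb => hM a ha _ (hLM hb)⟩

/-- Maximal isotropic subspaces are exactly the subspaces equal to their own orthogonal. -/
lemma isMaxIsotropic_iff {L : Submodule ℂ (GenSpace W)} :
    IsMaxIsotropic L ↔ ∀ a, a ∈ L ↔ ∀ b ∈ L, genPairing a b = 0 := by
  refine ⟨fun hL a => ⟨fun ha b hb => hL.1 a ha b hb, fun h => ?_⟩,
    isMaxIsotropic_of_selfOrthogonal⟩
  obtain ⟨ε, hε⟩ := hL.exists_eq_genGraph
  rw [hε] at h ⊢
  exact genGraph_selfOrthogonal _ _ _ h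

lemma isMaxIsotropic_genGraph (E : Submodule ℂ W) (ε : E [⋀^Fin 2]→ₗ[ℂ] ℂ) :
    IsMaxIsotropic (genGraph E ε) :=
  isMaxIsotropic_iff.2 fun a => ⟨fun ha b hb => isIsotropic_genGraph E ε a ha b hb,
    genGraph_selfOrthogonal E ε a⟩

lemma mem_genPullback {F : W →ₗ[ℂ] W'} {D : Submodule ℂ (GenSpace W')} {a : GenSpace W} :
    a ∈ genPullback F D ↔ ∃ ξ, (F a.1, ξ) ∈ D ∧ a.2 = ξ ∘ₗ F := by
  constructor
  · rintro ⟨⟨X, ξ⟩, h, rfl⟩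
    exact ⟨ξ, h, rfl⟩
  · rintro ⟨ξ, h, h'⟩
    exact ⟨(a.1, ξ), h, Prod.ext rfl h'.symm⟩

lemma genPullback_comp (F : W →ₗ[ℂ] W') (F' : W' →ₗ[ℂ] W'') (D : Submodule ℂ (GenSpace W'')) :
    genPullback (F' ∘ₗ F) D = genPullback F (genPullback F' D) := by
  ext a
  simp only [mem_genPullback]
  constructor
  · rintro ⟨ξ, h, h'⟩
    exact ⟨ξ ∘ₗ F', ⟨ξ, h, rfl⟩, h'⟩
  · rintro ⟨_, ⟨ξ, h, rfl⟩, h'⟩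
    exact ⟨ξ, h, h'⟩

lemma genPullback_id (D : Submodule ℂ (GenSpace W)) : genPullback LinearMap.id D = D := by
  ext a
  simp only [mem_genPullback]
  constructor
  · rintro ⟨ξ, h, h'⟩
    obtain ⟨x, η⟩ := a
    simp only at h'
    subst h'
    exact h
  · intro h
    exact ⟨a.2, h, rfl⟩

lemma exists_factor_of_ker_le {F : W →ₗ[ℂ] W'} {η : Module.Dual ℂ W}
    (h : LinearMap.ker F ≤ LinearMap.ker η) (hF : Function.Surjective F) :
    ∃ ξ : Module.Dual ℂ W', ξ ∘ₗ F = η := by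
  obtain ⟨s, hs⟩ := F.exists_rightInverse_of_surjective (LinearMap.range_eq_top.2 hF)
  refine ⟨η ∘ₗ s, LinearMap.ext fun x => ?_⟩
  have h1 : F (s (F x) - x) = 0 := by
    rw [map_sub, sub_eq_zero]
    exact LinearMap.congr_fun hs (F x)
  have h2 : η (s (F x) - x) = 0 := h h1
  rw [map_sub, sub_eq_zero] at h2
  exact h2

/-- The pullback contains `(x, 0)` for `x ∈ ker F`, so an element orthogonal to it has a covector
that descends along `F`. The descended element is orthogonal to `D`, hence in `D`. No dimension
count is involved. -/
lemma isMaxIsotropic_genPullback {F : W →ₗ[ℂ] W'} (hF : Function.Surjective F)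
    {D : Submodule ℂ (GenSpace W')} (hD : IsMaxIsotropic D) : IsMaxIsotropic (genPullback F D) := by
  rw [isMaxIsotropic_iff] at hD ⊢
  refine fun a => ⟨?_, fun h => ?_⟩
  · simp only [mem_genPullback]
    rintro ⟨ξ, h, h'⟩ b ⟨η, hη, hη'⟩
    have := (hD _).1 h _ hη
    simpa [genPairing, h', hη'] using this
  · have hker : LinearMap.ker F ≤ LinearMap.ker a.2 := by
      intro x hx
      have hx0 : F x = 0 := hx
      have := h (x, 0) (mem_genPullback.2 ⟨0, by rw [show F (x, (0 : Module.Dual ℂ W)).1 = 0 from hx0]; exact D.zero_mem, by simp⟩)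
      simpa [genPairing] using this
    obtain ⟨ξ, hξ⟩ := exists_factor_of_ker_le hker hF
    refine mem_genPullback.2 ⟨ξ, ?_, hξ.symm⟩
    rw [hD]
    rintro ⟨Y, η⟩ hY
    obtain ⟨y, rfl⟩ := hF Y
    have := h (y, η ∘ₗ F) (mem_genPullback.2 ⟨η, hY, rfl⟩)
    simp only [genPairing] at this ⊢
    rw [← hξ] at this
    exact this

lemma genPullback_injective {F : W →ₗ[ℂ] W'} (hF : Function.Surjective F) :
    Function.Injective (genPullback F) := by
  have key : ∀ D D' : Submodule ℂ (GenSpace W'), genPullback F D = genPullback F D' → D ≤ D' := by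
    rintro D D' h ⟨Y, ξ⟩ hY
    obtain ⟨y, rfl⟩ := hF Y
    have : (y, ξ ∘ₗ F) ∈ genPullback F D' := h ▸ mem_genPullback.2 ⟨ξ, hY, rfl⟩
    obtain ⟨η, hη, h'⟩ := mem_genPullback.1 this
    have : ξ = η := by
      ext z
      obtain ⟨z, rfl⟩ := hF z
      exact LinearMap.congr_fun h' z
    rwa [this]
  exact fun D D' h => le_antisymm (key _ _ h) (key _ _ h.symm)

/-- A maximal isotropic subspace containing the kernel of a surjection is a pullback. -/
lemma exists_genPullback_eq {F : W →ₗ[ℂ] W'} (hF : Function.Surjective F)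
    {L : Submodule ℂ (GenSpace W)} (hL : IsMaxIsotropic L)
    (hker : ∀ x, F x = 0 → (x, 0) ∈ L) :
    ∃ D : Submodule ℂ (GenSpace W'), IsMaxIsotropic D ∧ genPullback F D = L := by
  have hL' := isMaxIsotropic_iff.1 hL
  -- This is the pushforward of `L`. Because `L` contains the kernel of `F`, membership of `(F X,
  -- ξ)` does not depend on the chosen preimage `X`, which is the content of `hmem`.
  let D : Submodule ℂ (GenSpace W') :=
    (L.comap (LinearMap.id.prodMap F.dualMap)).map (F.prodMap LinearMap.id)
  have hmem : ∀ X ξ, (F X, ξ) ∈ D ↔ (X, ξ ∘ₗ F) ∈ L := by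
    intro X ξ
    constructor
    · rintro ⟨⟨Y, η⟩, h, h'⟩
      obtain ⟨h1, rfl⟩ := Prod.ext_iff.1 h'
      have h2 : F (X - Y) = 0 := by
        rw [map_sub, sub_eq_zero]; exact h1.symm
      have := L.add_mem (hker _ h2) h
      simpa using! this
    · intro h
      exact ⟨(X, ξ), h, rfl⟩
  have hpull : genPullback F D = L := by
    ext a
    rw [mem_genPullback]
    constructor
    · rintro ⟨ξ, h, h'⟩
      rw [hmem, ← h'] at h
      exact h
    · intro ha
      have hk : LinearMap.ker F ≤ LinearMap.ker a.2 := by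
        intro x hx
        have := (hL' a).1 ha _ (hker x hx)
        simpa [genPairing] using this
      obtain ⟨ξ, hξ⟩ := exists_factor_of_ker_le hk hF
      refine ⟨ξ, ?_, hξ.symm⟩
      rw [hmem, hξ]
      exact ha
  refine ⟨D, isMaxIsotropic_iff.2 fun a => ⟨fun ha b hb => ?_, fun h => ?_⟩, hpull⟩
  · obtain ⟨X, hX⟩ := hF a.1
    obtain ⟨Y, hY⟩ := hF b.1
    have h1 : (F X, a.2) ∈ D := by rw [hX]; exact ha
    have h2 : (F Y, b.2) ∈ D := by rw [hY]; exact hb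
    rw [hmem] at h1 h2
    have := (hL' _).1 h1 _ h2
    simpa [genPairing, hX, hY] using this
  · obtain ⟨X, hX⟩ := hF a.1
    have : (F X, a.2) ∈ D := by
      rw [hmem, hL']
      rw [← hpull]
      intro b hb
      obtain ⟨η, hη, hη'⟩ := mem_genPullback.1 hb
      have := h _ hη
      simpa [genPairing, hη', hX] using this
    rw [hX] at this
    exact this

end GenSpaceAlgebra

/-! ### The semidirect product, its trilinear form, and the pairs `(E, ε)`. -/

section DualSemidirectAlgebra

variable {𝔩 : Type*} [LieRing 𝔩] [LieAlgebra ℂ 𝔩]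

lemma toGen_lie (a b : DualSemidirect 𝔩) :
    DualSemidirect.toGen 𝔩 ⁅a, b⁆ =
      (⁅(DualSemidirect.toGen 𝔩 a).1, (DualSemidirect.toGen 𝔩 b).1⁆,
        ⁅(DualSemidirect.toGen 𝔩 a).1, (DualSemidirect.toGen 𝔩 b).2⁆
          - ⁅(DualSemidirect.toGen 𝔩 b).1, (DualSemidirect.toGen 𝔩 a).2⁆) := by
  refine Prod.ext rfl ?_
  change (AbelianDual.equiv 𝔩) ((0 : AbelianDual 𝔩) + _ - _) = _
  rw [zero_add]
  rfl

lemma toGen_inr (X : 𝔩) :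
    DualSemidirect.toGen 𝔩 (LieAlgebra.SemiDirectSum.inr (coadjoint 𝔩) X) = (X, 0) := rfl

/-- The bracket of `𝔩^* ⋊ 𝔩` on `𝔩 ⊕ 𝔩^*`. -/
def genBracket (a b : GenSpace 𝔩) : GenSpace 𝔩 := (⁅a.1, b.1⁆, ⁅a.1, b.2⁆ - ⁅b.1, a.2⁆)

lemma genBracket_add_left (X Y : 𝔩) (b : GenSpace 𝔩) :
    genBracket (X, 0) b + genBracket (Y, 0) b = genBracket (X + Y, 0) b := by
  refine Prod.ext ?_ ?_ <;> simp [genBracket]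

lemma genBracket_smul_left (r : ℂ) (X : 𝔩) (b : GenSpace 𝔩) :
    r • genBracket (X, 0) b = genBracket (r • X, 0) b := by
  refine Prod.ext ?_ ?_ <;> simp [genBracket]

/-- The trilinear form `⟨[a, b], c⟩` on `𝔩 ⊕ 𝔩^*`. -/
def bracketForm (a b c : GenSpace 𝔩) : ℂ := c.2 ⁅a.1, b.1⁆ + a.2 ⁅b.1, c.1⁆ + b.2 ⁅c.1, a.1⁆

/-- The coadjoint sign turns the pairing into a cyclic sum, so the three arguments can be rotated
freely in later arguments. -/
lemma genPairing_genBracket (a b c : GenSpace 𝔩) :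
    genPairing (genBracket a b) c = bracketForm a b c := by
  simp only [genPairing, genBracket, bracketForm, LinearMap.sub_apply, Module.Dual.lie_apply]
  rw [← lie_skew a.1 c.1, map_neg]
  ring

lemma bracketForm_add_left (a a' b c : GenSpace 𝔩) :
    bracketForm (a + a') b c = bracketForm a b c + bracketForm a' b c := by
  simp [bracketForm]; ring

lemma bracketForm_cyclic (a b c : GenSpace 𝔩) : bracketForm a b c = bracketForm b c a := by
  simp only [bracketForm]; ring

lemma bracketForm_add_middle (a b b' c : GenSpace 𝔩) :
    bracketForm a (b + b') c = bracketForm a b c + bracketForm a b' c := by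
  simp [bracketForm]; ring

lemma bracketForm_add_right (a b c c' : GenSpace 𝔩) :
    bracketForm a b (c + c') = bracketForm a b c + bracketForm a b c' := by
  simp [bracketForm]; ring

lemma bracketForm_smul_left (r : ℂ) (a b c : GenSpace 𝔩) :
    bracketForm (r • a) b c = r * bracketForm a b c := by
  simp [bracketForm]; ring

lemma bracketForm_smul_middle (r : ℂ) (a b c : GenSpace 𝔩) :
    bracketForm a (r • b) c = r * bracketForm a b c := by
  rw [bracketForm_cyclic, bracketForm_smul_left, ← bracketForm_cyclic]

lemma bracketForm_smul_right (r : ℂ) (a b c : GenSpace 𝔩) :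
    bracketForm a b (r • c) = r * bracketForm a b c := by
  rw [bracketForm_cyclic, bracketForm_smul_middle, ← bracketForm_cyclic]

/-- The image of a subspace of `𝔩^* ⋊ 𝔩` in `𝔩 ⊕ 𝔩^*`. -/
abbrev genImage (L : Submodule ℂ (DualSemidirect 𝔩)) : Submodule ℂ (GenSpace 𝔩) :=
  L.map (DualSemidirect.toGen 𝔩).toLinearMap

lemma mem_genImage {L : Submodule ℂ (DualSemidirect 𝔩)} {a : DualSemidirect 𝔩} :
    DualSemidirect.toGen 𝔩 a ∈ genImage L ↔ a ∈ L := by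
  constructor
  · rintro ⟨b, hb, h⟩
    rwa [← (DualSemidirect.toGen 𝔩).injective h]
  · intro h
    exact ⟨a, h, rfl⟩

lemma genImage_comap (L : Submodule ℂ (GenSpace 𝔩)) :
    genImage (L.comap (DualSemidirect.toGen 𝔩).toLinearMap) = L :=
  Submodule.map_comap_eq_of_surjective (DualSemidirect.toGen 𝔩).surjective L

lemma comap_genImage (L : Submodule ℂ (DualSemidirect 𝔩)) :
    (genImage L).comap (DualSemidirect.toGen 𝔩).toLinearMap = L :=
  Submodule.comap_map_eq_of_injective (DualSemidirect.toGen 𝔩).injective L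

/-- Since `L` is its own orthogonal, `[a, b] ∈ L` means that `[a, b]` pairs to zero with all of `L`.
-/
lemma isLinearDirac_iff {L : Submodule ℂ (DualSemidirect 𝔩)} :
    IsLinearDirac L ↔ IsMaxIsotropic (genImage L) ∧
      ∀ a ∈ genImage L, ∀ b ∈ genImage L, ∀ c ∈ genImage L, bracketForm a b c = 0 := by
  refine and_congr_right fun hL => ?_
  have hL' := isMaxIsotropic_iff.1 hL
  constructor
  · rintro h _ ⟨a, ha, rfl⟩ _ ⟨b, hb, rfl⟩ c hc
    rw [← genPairing_genBracket]
    refine (hL' _).1 ?_ c hc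
    have := mem_genImage.2 (h a ha b hb)
    rwa [toGen_lie] at this
  · intro h a ha b hb
    rw [← mem_genImage, toGen_lie]
    refine (hL' _).2 fun c hc => ?_
    have := h _ (mem_genImage.2 ha) _ (mem_genImage.2 hb) c hc
    rwa [← genPairing_genBracket] at this

lemma containsSubalgebra_iff {𝔨 : Submodule ℂ 𝔩} {L : Submodule ℂ (DualSemidirect 𝔩)} :
    ContainsSubalgebra 𝔨 L ↔ ∀ X ∈ 𝔨, (X, 0) ∈ genImage L := by
  simp only [ContainsSubalgebra, ← toGen_inr, mem_genImage]

lemma isStableUnder_iff {𝔨 : Submodule ℂ 𝔩} {L : Submodule ℂ (DualSemidirect 𝔩)}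
    (hL : IsLinearAlmostDirac L) :
    IsStableUnder 𝔨 L ↔
      ∀ X ∈ 𝔨, ∀ a ∈ genImage L, ∀ b ∈ genImage L, bracketForm (X, 0) a b = 0 := by
  have hL' := isMaxIsotropic_iff.1 hL
  constructor
  · rintro h X hX _ ⟨a, ha, rfl⟩ b hb
    rw [← genPairing_genBracket]
    refine (hL' _).1 ?_ b hb
    have := mem_genImage.2 (h X hX a ha)
    rwa [toGen_lie] at this
  · intro h X hX a ha
    rw [← mem_genImage, toGen_lie, toGen_inr]
    refine (hL' _).2 fun b hb => ?_
    have := h X hX _ (mem_genImage.2 ha) b hb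
    rwa [← genPairing_genBracket] at this

lemma IsLinearDirac.isStableUnder {𝔨 : Submodule ℂ 𝔩} {L : Submodule ℂ (DualSemidirect 𝔩)}
    (hL : IsLinearDirac L) (hk : ContainsSubalgebra 𝔨 L) : IsStableUnder 𝔨 L :=
  fun X hX a ha => hL.2 _ (hk X hX) a ha

lemma genImage_linearGraph (E : Submodule ℂ 𝔩) (ε : E [⋀^Fin 2]→ₗ[ℂ] ℂ) :
    genImage (linearGraph E ε) = genGraph E ε := genImage_comap _

/-- All brackets stay in `E`, where each covector is given by `ε`; the cyclic sum becomes the Lie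
algebra differential term by term. -/
lemma bracketForm_genGraph (E : LieSubalgebra ℂ 𝔩) (ε : E.toSubmodule [⋀^Fin 2]→ₗ[ℂ] ℂ)
    {a b c : GenSpace 𝔩} (ha : a ∈ genGraph E.toSubmodule ε) (hb : b ∈ genGraph E.toSubmodule ε)
    (hc : c ∈ genGraph E.toSubmodule ε) :
    bracketForm a b c = lieDifferential E ε ⟨a.1, ha.1⟩ ⟨b.1, hb.1⟩ ⟨c.1, hc.1⟩ := by
  obtain ⟨ha, ha'⟩ := ha
  obtain ⟨hb, hb'⟩ := hb
  obtain ⟨hc, hc'⟩ := hc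
  have h1 := ha' ⟨⁅b.1, c.1⁆, E.lie_mem hb hc⟩
  have h2 := hb' ⟨⁅c.1, a.1⁆, E.lie_mem hc ha⟩
  have h3 := hc' ⟨⁅a.1, b.1⁆, E.lie_mem ha hb⟩
  simp only at h1 h2 h3
  simp only [bracketForm, lieDifferential, h1, h2, h3]
  ring

lemma isLinearDirac_linearGraph_iff (E : LieSubalgebra ℂ 𝔩)
    (ε : E.toSubmodule [⋀^Fin 2]→ₗ[ℂ] ℂ) :
    IsLinearDirac (linearGraph E.toSubmodule ε) ↔ ∀ X Y Z, lieDifferential E ε X Y Z = 0 := by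
  rw [isLinearDirac_iff, genImage_linearGraph]
  constructor
  · rintro ⟨-, h⟩ X Y Z
    obtain ⟨ξ, hξ⟩ := exists_mem_genGraph ε X
    obtain ⟨η, hη⟩ := exists_mem_genGraph ε Y
    obtain ⟨ζ, hζ⟩ := exists_mem_genGraph ε Z
    rw [← h _ hξ _ hη _ hζ, bracketForm_genGraph E ε hξ hη hζ]
  · intro h
    exact ⟨isMaxIsotropic_genGraph _ _, fun a ha b hb c hc => by
      rw [bracketForm_genGraph E ε ha hb hc, h]⟩

lemma containsSubalgebra_linearGraph_iff (𝔨 E : Submodule ℂ 𝔩) (ε : E [⋀^Fin 2]→ₗ[ℂ] ℂ) :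
    ContainsSubalgebra 𝔨 (linearGraph E ε) ↔
      𝔨 ≤ E ∧ ∀ X Y : E, (X : 𝔩) ∈ 𝔨 → ε ![X, Y] = 0 := by
  rw [containsSubalgebra_iff, genImage_linearGraph]
  constructor
  · intro h
    refine ⟨fun X hX => (h X hX).1, fun X Y hX => ?_⟩
    obtain ⟨_, h'⟩ := h X hX
    exact (h' Y).symm
  · rintro ⟨h, h'⟩ X hX
    exact ⟨h hX, fun Y => (h' ⟨X, h hX⟩ Y hX).symm⟩

/-- Every Dirac Lie subalgebra is the graph of a two-form on a Lie subalgebra. -/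
lemma IsLinearDirac.exists_eq_linearGraph {L : Submodule ℂ (DualSemidirect 𝔩)}
    (hL : IsLinearDirac L) :
    ∃ (P : LieSubalgebra ℂ 𝔩) (ε : P.toSubmodule [⋀^Fin 2]→ₗ[ℂ] ℂ),
      L = linearGraph P.toSubmodule ε := by
  obtain ⟨ε, hε⟩ := IsMaxIsotropic.exists_eq_genGraph (L := genImage L) hL.1
  -- The projection of the semidirect product onto `𝔩` is a Lie homomorphism, so the image of `L` is
  -- a subalgebra.
  let P : LieSubalgebra ℂ 𝔩 :=
    { (genImage L).map (LinearMap.fst ℂ 𝔩 (Module.Dual ℂ 𝔩)) with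
      lie_mem' := by
        rintro _ _ ⟨_, ⟨a, ha, rfl⟩, rfl⟩ ⟨_, ⟨b, hb, rfl⟩, rfl⟩
        exact ⟨_, ⟨⁅a, b⁆, hL.2 a ha b hb, rfl⟩, rfl⟩ }
  refine ⟨P, ε, ?_⟩
  rw [← comap_genImage L]
  exact congrArg _ hε

lemma genGraph_fst_le {E : Submodule ℂ 𝔩} {ε : E [⋀^Fin 2]→ₗ[ℂ] ℂ} {E' : Submodule ℂ 𝔩}
    {ε' : E' [⋀^Fin 2]→ₗ[ℂ] ℂ} (h : genGraph E ε = genGraph E' ε') : E ≤ E' := by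
  intro X hX
  obtain ⟨ξ, hξ⟩ := exists_mem_genGraph ε ⟨X, hX⟩
  rw [h] at hξ
  exact hξ.1

/-- The subalgebra is recovered as the projection of the graph, and `ε(X, ·)` as the restriction to
it of any covector over `X`. -/
lemma linearGraph_injective :
    Function.Injective (fun q : PrePair 𝔩 => linearGraph q.1.toSubmodule q.2) := by
  rintro ⟨E, ε⟩ ⟨E', ε'⟩ h
  have h' : genGraph E.toSubmodule ε = genGraph E'.toSubmodule ε' := by
    rw [← genImage_linearGraph, ← genImage_linearGraph]
    exact congrArg genImage h
  have hE : E = E' := by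
    rw [← LieSubalgebra.toSubmodule_inj]
    exact le_antisymm (genGraph_fst_le h') (genGraph_fst_le h'.symm)
  subst hE
  congr 1
  ext v
  obtain ⟨ξ, hξ⟩ := exists_mem_genGraph ε (v 0)
  obtain ⟨_, h2⟩ := h' ▸ hξ
  obtain ⟨_, h1⟩ := hξ
  have hv : v = ![v 0, v 1] := by ext i; fin_cases i <;> rfl
  rw [hv]
  exact (h1 (v 1)).symm.trans (h2 (v 1))

lemma bijOn_linearGraph (𝔨 : Submodule ℂ 𝔩) :
    Set.BijOn (fun q : PrePair 𝔩 => linearGraph q.1.toSubmodule q.2)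
      {q | IsDiracPair 𝔨 q} {L | IsLinearDirac L ∧ ContainsSubalgebra 𝔨 L} := by
  refine ⟨?_, linearGraph_injective.injOn, ?_⟩
  · rintro ⟨E, ε⟩ ⟨h1, h2, h3⟩
    exact ⟨(isLinearDirac_linearGraph_iff E ε).2 h2,
      (containsSubalgebra_linearGraph_iff _ _ _).2 ⟨h1, h3⟩⟩
  · rintro L ⟨hL, hk⟩
    obtain ⟨E, ε, rfl⟩ := hL.exists_eq_linearGraph
    obtain ⟨h1, h3⟩ := (containsSubalgebra_linearGraph_iff _ _ _).1 hk
    exact ⟨⟨E, ε⟩, ⟨h1, (isLinearDirac_linearGraph_iff E ε).1 hL, h3⟩, rfl⟩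

end DualSemidirectAlgebra

/-! ### Complexification of vectors, covectors and linear maps. -/

section Complexification

variable {V V' : Type*} [NormedAddCommGroup V] [NormedSpace ℝ V] [NormedAddCommGroup V']
  [NormedSpace ℝ V']

/-- The inclusion of `V ⊕ V^*` in its complexification. -/
def realToGen (a : V × (V →L[ℝ] ℝ)) : GenSpace (ℂ ⊗[ℝ] V) :=
  ((1 : ℂ) ⊗ₜ[ℝ] a.1, Module.Dual.baseChange ℂ a.2.toLinearMap)

/-- The element `a + i b` of the complexification of `V ⊕ V^*`. -/
def complexGen (a b : V × (V →L[ℝ] ℝ)) : GenSpace (ℂ ⊗[ℝ] V) :=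
  realToGen a + Complex.I • realToGen b

/-- The complexification of a continuous linear map. -/
abbrev complexMap (F : V →L[ℝ] V') : ℂ ⊗[ℝ] V →ₗ[ℂ] ℂ ⊗[ℝ] V' := F.toLinearMap.baseChange ℂ

lemma complexMap_comp {V'' : Type*} [NormedAddCommGroup V''] [NormedSpace ℝ V'']
    (F : V →L[ℝ] V') (F' : V' →L[ℝ] V'') :
    complexMap (F'.comp F) = complexMap F' ∘ₗ complexMap F :=
  LinearMap.baseChange_comp (A := ℂ) (f := F.toLinearMap) F'.toLinearMap

lemma complexMap_id : complexMap (ContinuousLinearMap.id ℝ V) = LinearMap.id :=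
  LinearMap.baseChange_id

lemma realToGen_fst (a : V × (V →L[ℝ] ℝ)) : (realToGen a).1 = (1 : ℂ) ⊗ₜ[ℝ] a.1 := rfl

lemma realToGen_snd_tmul (a : V × (V →L[ℝ] ℝ)) (c : ℂ) (v : V) :
    (realToGen a).2 (c ⊗ₜ[ℝ] v) = c * (a.2 v : ℂ) := by
  simp [realToGen, mul_comm]

lemma realToGen_add (a b : V × (V →L[ℝ] ℝ)) : realToGen (a + b) = realToGen a + realToGen b := by
  refine Prod.ext (TensorProduct.tmul_add _ _ _) ?_
  ext v
  simp [realToGen]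

lemma realToGen_smul (r : ℝ) (a : V × (V →L[ℝ] ℝ)) : realToGen (r • a) = (r : ℂ) • realToGen a := by
  refine Prod.ext ?_ ?_
  · change (1 : ℂ) ⊗ₜ[ℝ] (r • a.1) = (r : ℂ) • ((1 : ℂ) ⊗ₜ[ℝ] a.1)
    rw [TensorProduct.tmul_smul]; rfl
  · ext v
    simp [realToGen]

lemma genPairing_realToGen (a b : V × (V →L[ℝ] ℝ)) :
    genPairing (realToGen a) (realToGen b) = ((b.2 a.1 + a.2 b.1 : ℝ) : ℂ) := by
  rw [genPairing, realToGen_fst, realToGen_fst, realToGen_snd_tmul, realToGen_snd_tmul]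
  push_cast; ring

lemma exists_eq_tmul_add (x : ℂ ⊗[ℝ] V) :
    ∃ u v : V, x = (1 : ℂ) ⊗ₜ[ℝ] u + Complex.I • ((1 : ℂ) ⊗ₜ[ℝ] v) := by
  induction x using TensorProduct.induction_on with
  | zero => exact ⟨0, 0, by simp⟩
  | tmul c w =>
    refine ⟨c.re • w, c.im • w, ?_⟩
    rw [← TensorProduct.smul_tmul, ← TensorProduct.smul_tmul, TensorProduct.smul_tmul',
      ← TensorProduct.add_tmul]
    congr 1
    conv_lhs => rw [← Complex.re_add_im c]
    simp [mul_comm]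
  | add x y hx hy =>
    obtain ⟨u, v, rfl⟩ := hx
    obtain ⟨u', v', rfl⟩ := hy
    refine ⟨u + u', v + v', ?_⟩
    rw [TensorProduct.tmul_add, TensorProduct.tmul_add, smul_add]
    abel

/-- The real and imaginary parts of a complex functional are real functionals on `V`; finite
dimension makes them continuous. -/
lemma exists_eq_complexGen [FiniteDimensional ℝ V] (x : GenSpace (ℂ ⊗[ℝ] V)) :
    ∃ a b, x = complexGen a b := by
  obtain ⟨x, ξ⟩ := x
  obtain ⟨u, v, rfl⟩ := exists_eq_tmul_add x
  let α : V →ₗ[ℝ] ℝ :=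
    { toFun := fun w => (ξ ((1 : ℂ) ⊗ₜ[ℝ] w)).re
      map_add' := fun w w' => by simp [TensorProduct.tmul_add]
      map_smul' := fun r w => by
        rw [TensorProduct.tmul_smul, LinearMap.map_smul_of_tower]; simp }
  let β : V →ₗ[ℝ] ℝ :=
    { toFun := fun w => (ξ ((1 : ℂ) ⊗ₜ[ℝ] w)).im
      map_add' := fun w w' => by simp [TensorProduct.tmul_add]
      map_smul' := fun r w => by
        rw [TensorProduct.tmul_smul, LinearMap.map_smul_of_tower]; simp }
  refine ⟨(u, α.toContinuousLinearMap), (v, β.toContinuousLinearMap), Prod.ext rfl ?_⟩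
  ext w
  change ξ ((1 : ℂ) ⊗ₜ[ℝ] w) = (realToGen (u, α.toContinuousLinearMap)).2 ((1 : ℂ) ⊗ₜ[ℝ] w)
    + Complex.I * (realToGen (v, β.toContinuousLinearMap)).2 ((1 : ℂ) ⊗ₜ[ℝ] w)
  rw [realToGen_snd_tmul, realToGen_snd_tmul, one_mul, one_mul, mul_comm]
  exact (Complex.re_add_im _).symm

lemma complexGen_fst (a b : V × (V →L[ℝ] ℝ)) :
    (complexGen a b).1 = (1 : ℂ) ⊗ₜ[ℝ] a.1 + Complex.I • ((1 : ℂ) ⊗ₜ[ℝ] b.1) := rfl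

lemma tmul_add_eq_iff (u v u' v' : V) :
    (1 : ℂ) ⊗ₜ[ℝ] u + Complex.I • ((1 : ℂ) ⊗ₜ[ℝ] v) =
      (1 : ℂ) ⊗ₜ[ℝ] u' + Complex.I • ((1 : ℂ) ⊗ₜ[ℝ] v') ↔ u = u' ∧ v = v' := by
  refine ⟨fun h => ?_, fun ⟨h, h'⟩ => by rw [h, h']⟩
  let reV : ℂ ⊗[ℝ] V →ₗ[ℝ] V :=
    (TensorProduct.lid ℝ V).toLinearMap ∘ₗ Complex.reLm.rTensor V
  let imV : ℂ ⊗[ℝ] V →ₗ[ℝ] V :=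
    (TensorProduct.lid ℝ V).toLinearMap ∘ₗ Complex.imLm.rTensor V
  rw [TensorProduct.smul_tmul', TensorProduct.smul_tmul'] at h
  have h1 := congrArg reV h
  have h2 := congrArg imV h
  simp [reV, imV] at h1 h2
  exact ⟨h1, h2⟩

lemma complexMap_tmul_add (F : V →L[ℝ] V') (u v : V) :
    complexMap F ((1 : ℂ) ⊗ₜ[ℝ] u + Complex.I • ((1 : ℂ) ⊗ₜ[ℝ] v)) =
      (1 : ℂ) ⊗ₜ[ℝ] F u + Complex.I • ((1 : ℂ) ⊗ₜ[ℝ] F v) := by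
  simp

lemma complexMap_surjective {F : V →L[ℝ] V'} (hF : Function.Surjective F) :
    Function.Surjective (complexMap F) := by
  intro y
  obtain ⟨u, v, rfl⟩ := exists_eq_tmul_add y
  obtain ⟨u, rfl⟩ := hF u
  obtain ⟨v, rfl⟩ := hF v
  exact ⟨_, complexMap_tmul_add F u v⟩

/-- The complexification of the kernel is the kernel of the complexification. -/
lemma ker_complexMap (F : V →L[ℝ] V') :
    LinearMap.ker (complexMap F) =
      Submodule.span ℂ ((fun u : V => (1 : ℂ) ⊗ₜ[ℝ] u) '' {u | F u = 0}) := by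
  apply le_antisymm
  · intro x hx
    obtain ⟨u, v, rfl⟩ := exists_eq_tmul_add x
    rw [LinearMap.mem_ker, complexMap_tmul_add] at hx
    have : (1 : ℂ) ⊗ₜ[ℝ] F u + Complex.I • ((1 : ℂ) ⊗ₜ[ℝ] F v) =
      (1 : ℂ) ⊗ₜ[ℝ] (0 : V') + Complex.I • ((1 : ℂ) ⊗ₜ[ℝ] (0 : V')) := by simpa using hx
    obtain ⟨hu, hv⟩ := (tmul_add_eq_iff _ _ _ _).1 this
    exact Submodule.add_mem _ (Submodule.subset_span ⟨u, hu, rfl⟩)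
      (Submodule.smul_mem _ _ (Submodule.subset_span ⟨v, hv, rfl⟩))
  · rw [Submodule.span_le]
    rintro _ ⟨u, hu, rfl⟩
    have hu' : F u = 0 := hu
    simp [hu']

/-- The transport `(X, ξ) ↦ (F X, ξ ∘ F')` of a generalized vector. -/
def transport (F : V →L[ℝ] V') (F' : V' →L[ℝ] V) (a : V × (V →L[ℝ] ℝ)) : V' × (V' →L[ℝ] ℝ) :=
  (F a.1, a.2.comp F')

lemma realToGen_transport_fst (F : V →L[ℝ] V') (F' : V' →L[ℝ] V) (a : V × (V →L[ℝ] ℝ)) :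
    (realToGen (transport F F' a)).1 = complexMap F (realToGen a).1 := by
  simp [realToGen, transport]

lemma realToGen_transport_snd (F : V →L[ℝ] V') (F' : V' →L[ℝ] V) (a : V × (V →L[ℝ] ℝ)) :
    (realToGen (transport F F' a)).2 = (realToGen a).2 ∘ₗ complexMap F' := by
  ext v
  simp [realToGen, transport]

lemma complexGen_transport (F : V →L[ℝ] V') (F' : V' →L[ℝ] V) (a b : V × (V →L[ℝ] ℝ)) :
    complexGen (transport F F' a) (transport F F' b) =
      (complexMap F (complexGen a b).1, (complexGen a b).2 ∘ₗ complexMap F') := by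
  refine Prod.ext ?_ ?_
  · simp only [complexGen, Prod.fst_add, Prod.smul_fst, realToGen_transport_fst, map_add, map_smul]
  · simp only [complexGen, Prod.snd_add, Prod.smul_snd, realToGen_transport_snd]
    rfl

end Complexification

/-! ### Derivatives on manifolds and smoothness of fields read in charts. -/

section TangentDerivative

variable {E : Type*} [NormedAddCommGroup E] [NormedSpace ℝ E]
  {M : Type*} [TopologicalSpace M] [ChartedSpace E M]
  {E' : Type*} [NormedAddCommGroup E'] [NormedSpace ℝ E']
  {N : Type*} [TopologicalSpace N] [ChartedSpace E' N]
  {E'' : Type*} [NormedAddCommGroup E''] [NormedSpace ℝ E'']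
  {N' : Type*} [TopologicalSpace N'] [ChartedSpace E'' N']

variable (E E') in
/-- The derivative of a map between manifolds, as a map between the model spaces. -/
def tderiv (f : M → N) (p : M) : E →L[ℝ] E' := mfderiv 𝓘(ℝ, E) 𝓘(ℝ, E') f p

lemma tderiv_comp {g : N → N'} {f : M → N} {p : M}
    (hg : MDifferentiableAt 𝓘(ℝ, E') 𝓘(ℝ, E'') g (f p))
    (hf : MDifferentiableAt 𝓘(ℝ, E) 𝓘(ℝ, E') f p) :
    tderiv E E'' (g ∘ f) p = (tderiv E' E'' g (f p)).comp (tderiv E E' f p) :=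
  mfderiv_comp p hg hf

lemma tderiv_congr {f g : M → N} {p : M} (h : f =ᶠ[𝓝 p] g) :
    tderiv E E' f p = tderiv E E' g p := h.mfderiv_eq

lemma tderiv_id (p : M) : tderiv E E (id : M → M) p = ContinuousLinearMap.id ℝ E := mfderiv_id

lemma tderiv_const (p : M) (y : N) : tderiv E E' (fun _ : M => y) p = 0 := mfderiv_const

lemma tderiv_eq_fderiv (f : E → E') (z : E) : tderiv E E' f z = fderiv ℝ f z := mfderiv_eq_fderiv

lemma ContMDiffAt.mdiff {f : M → N} {p : M} (h : ContMDiffAt 𝓘(ℝ, E) 𝓘(ℝ, E') ∞ f p) :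
    MDifferentiableAt 𝓘(ℝ, E) 𝓘(ℝ, E') f p := h.mdifferentiableAt (by simp)

lemma chart_mem_target {p q : M} (hq : q ∈ (chartAt E p).source) :
    extChartAt 𝓘(ℝ, E) p q ∈ (extChartAt 𝓘(ℝ, E) p).target :=
  (extChartAt 𝓘(ℝ, E) p).map_source (by simpa using hq)

lemma mem_chartAt_source_of_target {p : M} {z : E} (hz : z ∈ (extChartAt 𝓘(ℝ, E) p).target) :
    (extChartAt 𝓘(ℝ, E) p).symm z ∈ (chartAt E p).source := by
  simpa using (extChartAt 𝓘(ℝ, E) p).map_target hz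

lemma chart_symm_chart {p q : M} (hq : q ∈ (chartAt E p).source) :
    (extChartAt 𝓘(ℝ, E) p).symm (extChartAt 𝓘(ℝ, E) p q) = q :=
  (extChartAt 𝓘(ℝ, E) p).left_inv (by simpa using hq)

variable [IsManifold 𝓘(ℝ, E) ∞ M]

lemma contMDiffAt_chart {p q : M} (hq : q ∈ (chartAt E p).source) :
    ContMDiffAt 𝓘(ℝ, E) 𝓘(ℝ, E) ∞ (extChartAt 𝓘(ℝ, E) p) q :=
  contMDiffAt_extChartAt' hq

lemma contMDiffAt_chart_symm {p : M} {z : E} (hz : z ∈ (extChartAt 𝓘(ℝ, E) p).target) :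
    ContMDiffAt 𝓘(ℝ, E) 𝓘(ℝ, E) ∞ (extChartAt 𝓘(ℝ, E) p).symm z :=
  (contMDiffOn_extChartAt_symm p).contMDiffAt ((isOpen_extChartAt_target p).mem_nhds hz)

lemma tderiv_chart_comp_symm {p : M} {z : E} (hz : z ∈ (extChartAt 𝓘(ℝ, E) p).target) :
    (tderiv E E (extChartAt 𝓘(ℝ, E) p) ((extChartAt 𝓘(ℝ, E) p).symm z)).comp
      (tderiv E E (extChartAt 𝓘(ℝ, E) p).symm z) = ContinuousLinearMap.id ℝ E := by
  rw [← tderiv_comp (contMDiffAt_chart (mem_chartAt_source_of_target hz)).mdiff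
    (contMDiffAt_chart_symm hz).mdiff, ← tderiv_id z]
  refine tderiv_congr ?_
  filter_upwards [(isOpen_extChartAt_target p).mem_nhds hz] with w hw
  exact (extChartAt 𝓘(ℝ, E) p).right_inv hw

lemma tderiv_chart_symm_comp {p : M} {z : E} (hz : z ∈ (extChartAt 𝓘(ℝ, E) p).target) :
    (tderiv E E (extChartAt 𝓘(ℝ, E) p).symm z).comp
      (tderiv E E (extChartAt 𝓘(ℝ, E) p) ((extChartAt 𝓘(ℝ, E) p).symm z)) =
        ContinuousLinearMap.id ℝ E := by
  have hs := mem_chartAt_source_of_target hz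
  have h1 : extChartAt 𝓘(ℝ, E) p ((extChartAt 𝓘(ℝ, E) p).symm z) = z :=
    (extChartAt 𝓘(ℝ, E) p).right_inv hz
  have h2 : MDifferentiableAt 𝓘(ℝ, E) 𝓘(ℝ, E) (extChartAt 𝓘(ℝ, E) p).symm
      (extChartAt 𝓘(ℝ, E) p ((extChartAt 𝓘(ℝ, E) p).symm z)) := by
    rw [h1]; exact (contMDiffAt_chart_symm hz).mdiff
  have := tderiv_comp h2 (contMDiffAt_chart hs).mdiff
  rw [h1] at this
  rw [← this, ← tderiv_id ((extChartAt 𝓘(ℝ, E) p).symm z)]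
  refine tderiv_congr ?_
  filter_upwards [(chartAt E p).open_source.mem_nhds hs] with w hw
  exact chart_symm_chart hw

lemma tderiv_chart_self (p : M) :
    tderiv E E (extChartAt 𝓘(ℝ, E) p) p = ContinuousLinearMap.id ℝ E := by
  have : IsManifold 𝓘(ℝ, E) 1 M := IsManifold.of_le (n := ∞) (by simp)
  exact mfderiv_extChartAt_self

lemma tderiv_chart_symm_self (p : M) :
    tderiv E E (extChartAt 𝓘(ℝ, E) p).symm (extChartAt 𝓘(ℝ, E) p p) =
      ContinuousLinearMap.id ℝ E := by
  have := tderiv_chart_symm_comp (chart_mem_target (mem_chart_source E p))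
  rw [chart_symm_chart (mem_chart_source E p), tderiv_chart_self,
    ContinuousLinearMap.comp_id] at this
  exact this

/-- A vector field read in the preferred chart around `p`. -/
def fieldInChart (V : M → E) (p : M) (z : E) : E :=
  tderiv E E (extChartAt 𝓘(ℝ, E) p) ((extChartAt 𝓘(ℝ, E) p).symm z)
    (V ((extChartAt 𝓘(ℝ, E) p).symm z))

/-- A covector field read in the preferred chart around `p`. -/
def coFieldInChart (η : M → E →L[ℝ] ℝ) (p : M) (z : E) : E →L[ℝ] ℝ :=
  (η ((extChartAt 𝓘(ℝ, E) p).symm z)).comp (tderiv E E (extChartAt 𝓘(ℝ, E) p).symm z)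

lemma contMDiffAt_comp_chart_iff {X : Type*} [NormedAddCommGroup X] [NormedSpace ℝ X]
    {f : M → X} {p q : M} (hq : q ∈ (chartAt E p).source) :
    ContMDiffAt 𝓘(ℝ, E) 𝓘(ℝ, X) ∞ f q ↔
      ContDiffAt ℝ ∞ (fun z => f ((extChartAt 𝓘(ℝ, E) p).symm z)) (extChartAt 𝓘(ℝ, E) p q) := by
  have hz := chart_mem_target hq
  rw [← contMDiffAt_iff_contDiffAt]
  constructor
  · intro h
    refine ContMDiffAt.comp _ ?_ (contMDiffAt_chart_symm hz)
    rwa [chart_symm_chart hq]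
  · intro h
    have := ContMDiffAt.comp q h (contMDiffAt_chart hq)
    refine this.congr_of_eventuallyEq ?_
    filter_upwards [(chartAt E p).open_source.mem_nhds hq] with w hw
    exact congrArg f (chart_symm_chart hw).symm

/-- Smoothness of a vector field, tested in a chart. -/
lemma smooth_field_iff (V : ∀ q : M, TangentSpace 𝓘(ℝ, E) q) {p q : M}
    (hq : q ∈ (chartAt E p).source) :
    ContMDiffAt 𝓘(ℝ, E) (𝓘(ℝ, E).prod 𝓘(ℝ, E)) ∞
      (fun p => Bundle.TotalSpace.mk' E (E := (TangentSpace 𝓘(ℝ, E) : M → Type _)) p (V p)) q ↔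
    ContDiffAt ℝ ∞ (fieldInChart (M := M) V p) (extChartAt 𝓘(ℝ, E) p q) := by
  have : IsManifold 𝓘(ℝ, E) 1 M := IsManifold.of_le (n := ∞) (by simp)
  have : ContMDiffVectorBundle ∞ E (TangentSpace 𝓘(ℝ, E) : M → Type _) 𝓘(ℝ, E) :=
    by
    -- The tangent bundle costs one derivative, which is free at `∞`.
    have : IsManifold 𝓘(ℝ, E) (∞ + 1) M := inferInstanceAs (IsManifold 𝓘(ℝ, E) ∞ M)
    exact TangentBundle.contMDiffVectorBundle (n := ∞)
  rw [(trivializationAt E (TangentSpace 𝓘(ℝ, E)) p).contMDiffAt_section_iff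
    (by simpa using hq)]
  have : (fun x => (trivializationAt E (TangentSpace 𝓘(ℝ, E)) p ⟨x, V x⟩).2) =ᶠ[𝓝 q]
      fun x => tderiv E E (extChartAt 𝓘(ℝ, E) p) x (V x) := by
    filter_upwards [(chartAt E p).open_source.mem_nhds hq] with x hx
    have h1 := TangentBundle.continuousLinearMapAt_trivializationAt (I := 𝓘(ℝ, E)) hx
    have h2 := congrArg (fun F => F (V x)) h1
    refine Eq.trans ?_ h2
    rw [Bundle.Trivialization.continuousLinearMapAt_apply,
      Bundle.Trivialization.coe_linearMapAt_of_mem _ (by simpa using hx)]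
  exact this.contMDiffAt_iff.trans (contMDiffAt_comp_chart_iff (f := fun x =>
    tderiv E E (extChartAt 𝓘(ℝ, E) p) x (V x)) hq)

/-- Near `q` the trivialization of the cotangent bundle at `p` is precomposition with the derivative
of the inverse chart, which is how `coFieldInChart` is built. -/
lemma smooth_coField_iff (η : ∀ q : M, TangentSpace 𝓘(ℝ, E) q →L[ℝ] ℝ) {p q : M}
    (hq : q ∈ (chartAt E p).source) :
    ContMDiffAt 𝓘(ℝ, E) (𝓘(ℝ, E).prod 𝓘(ℝ, E →L[ℝ] ℝ)) ∞
      (fun p => Bundle.TotalSpace.mk' (E →L[ℝ] ℝ)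
        (E := fun p : M => TangentSpace 𝓘(ℝ, E) p →L[ℝ] Bundle.Trivial M ℝ p) p (η p)) q ↔
    ContDiffAt ℝ ∞ (coFieldInChart (M := M) η p) (extChartAt 𝓘(ℝ, E) p q) := by
  have : IsManifold 𝓘(ℝ, E) 1 M := IsManifold.of_le (n := ∞) (by simp)
  have : ContMDiffVectorBundle ∞ E (TangentSpace 𝓘(ℝ, E) : M → Type _) 𝓘(ℝ, E) :=
    by
    have : IsManifold 𝓘(ℝ, E) (∞ + 1) M := inferInstanceAs (IsManifold 𝓘(ℝ, E) ∞ M)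
    exact TangentBundle.contMDiffVectorBundle (n := ∞)
  rw [(trivializationAt (E →L[ℝ] ℝ) (fun p : M => TangentSpace 𝓘(ℝ, E) p →L[ℝ]
    Bundle.Trivial M ℝ p) p).contMDiffAt_section_iff (by simpa using hq)]
  have : (fun x => (trivializationAt (E →L[ℝ] ℝ) (fun p : M => TangentSpace 𝓘(ℝ, E) p →L[ℝ]
      Bundle.Trivial M ℝ p) p ⟨x, η x⟩).2) =ᶠ[𝓝 q]
      fun x => (η x).comp (tderiv E E (extChartAt 𝓘(ℝ, E) p).symm (extChartAt 𝓘(ℝ, E) p x)) := by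
    filter_upwards [(chartAt E p).open_source.mem_nhds hq] with x hx
    have h1 := TangentBundle.symmL_trivializationAt (I := 𝓘(ℝ, E)) hx
    rw [hom_trivializationAt_apply]
    ext v
    have h2 := congrArg (fun F => η x (F v)) h1
    simp only [mfderivWithin_univ, modelWithCornersSelf_coe, Set.range_id] at h2
    refine Eq.trans ?_ h2
    simp [ContinuousLinearMap.inCoordinates]
  refine this.contMDiffAt_iff.trans ((contMDiffAt_comp_chart_iff (f := fun x =>
    (η x : E →L[ℝ] ℝ).comp
      (tderiv E E (extChartAt 𝓘(ℝ, E) p).symm (extChartAt 𝓘(ℝ, E) p x))) hq).trans ?_)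
  have h : (fun z => (η ((extChartAt 𝓘(ℝ, E) p).symm z) : E →L[ℝ] ℝ).comp
      (tderiv E E (extChartAt 𝓘(ℝ, E) p).symm
        (extChartAt 𝓘(ℝ, E) p ((extChartAt 𝓘(ℝ, E) p).symm z)))) =ᶠ[𝓝 (extChartAt 𝓘(ℝ, E) p q)]
      coFieldInChart (M := M) η p := by
    filter_upwards [(isOpen_extChartAt_target p).mem_nhds (chart_mem_target hq)] with w hw
    rw [(extChartAt 𝓘(ℝ, E) p).right_inv hw]
    rfl
  exact ⟨fun h' => h'.congr_of_eventuallyEq h.symm, fun h' => h'.congr_of_eventuallyEq h⟩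

end TangentDerivative

/-! ### The Courant bracket at a point, computed in the preferred chart. -/

section CourantInChart

variable {E : Type*} [NormedAddCommGroup E] [NormedSpace ℝ E]
  {M : Type*} [TopologicalSpace M] [ChartedSpace E M] [IsManifold 𝓘(ℝ, E) ∞ M]

lemma fieldInChart_self (V : M → E) (p : M) :
    fieldInChart V p (extChartAt 𝓘(ℝ, E) p p) = V p := by
  rw [fieldInChart, chart_symm_chart (mem_chart_source E p), tderiv_chart_self]
  rfl

lemma coFieldInChart_self (η : M → E →L[ℝ] ℝ) (p : M) :
    coFieldInChart η p (extChartAt 𝓘(ℝ, E) p p) = η p := by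
  rw [coFieldInChart, chart_symm_chart (mem_chart_source E p), tderiv_chart_symm_self]
  rfl

lemma coFieldInChart_apply_fieldInChart (V : M → E) (η : M → E →L[ℝ] ℝ) (p : M) {z : E}
    (hz : z ∈ (extChartAt 𝓘(ℝ, E) p).target) :
    coFieldInChart η p z (fieldInChart V p z) =
      η ((extChartAt 𝓘(ℝ, E) p).symm z) (V ((extChartAt 𝓘(ℝ, E) p).symm z)) := by
  have := congrArg (fun F => η ((extChartAt 𝓘(ℝ, E) p).symm z)
    (F (V ((extChartAt 𝓘(ℝ, E) p).symm z)))) (tderiv_chart_symm_comp hz)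
  exact this

lemma mpullbackWithin_eq_fieldInChart (V : ∀ q : M, TangentSpace 𝓘(ℝ, E) q) (p : M) {z : E}
    (hz : z ∈ (extChartAt 𝓘(ℝ, E) p).target) :
    VectorField.mpullbackWithin 𝓘(ℝ, E) 𝓘(ℝ, E) (extChartAt 𝓘(ℝ, E) p).symm V
      (Set.range 𝓘(ℝ, E)) z = fieldInChart (M := M) V p z := by
  rw [VectorField.mpullbackWithin_apply]
  have h : (mfderivWithin 𝓘(ℝ, E) 𝓘(ℝ, E) (extChartAt 𝓘(ℝ, E) p).symm (Set.range 𝓘(ℝ, E)) z) =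
      mfderiv 𝓘(ℝ, E) 𝓘(ℝ, E) (extChartAt 𝓘(ℝ, E) p).symm z := by
    rw [modelWithCornersSelf_coe, Set.range_id, mfderivWithin_univ]
  rw [h]
  have h2 := ContinuousLinearMap.inverse_eq (tderiv_chart_symm_comp hz) (tderiv_chart_comp_symm hz)
  exact congrArg (fun F => F (V ((extChartAt 𝓘(ℝ, E) p).symm z))) h2

/-- The Lie bracket of vector fields is computed in the preferred chart. -/
lemma mlieBracket_eq_chart (V W : ∀ q : M, TangentSpace 𝓘(ℝ, E) q) (p : M) :
    VectorField.mlieBracket 𝓘(ℝ, E) V W p =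
      fderiv ℝ (fieldInChart (M := M) W p) (extChartAt 𝓘(ℝ, E) p p) (V p) -
        fderiv ℝ (fieldInChart (M := M) V p) (extChartAt 𝓘(ℝ, E) p p) (W p) := by
  have hz := chart_mem_target (mem_chart_source E p)
  have hn := (isOpen_extChartAt_target (I := 𝓘(ℝ, E)) p).mem_nhds hz
  rw [← VectorField.mlieBracketWithin_univ, VectorField.mlieBracketWithin_apply]
  have hset : (extChartAt 𝓘(ℝ, E) p).symm ⁻¹' Set.univ ∩ Set.range 𝓘(ℝ, E) = Set.univ := by simp
  rw [hset]
  let V₁ : E → E := VectorField.mpullbackWithin 𝓘(ℝ, E) 𝓘(ℝ, E) (extChartAt 𝓘(ℝ, E) p).symm V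
      (Set.range 𝓘(ℝ, E))
  let W₁ : E → E := VectorField.mpullbackWithin 𝓘(ℝ, E) 𝓘(ℝ, E) (extChartAt 𝓘(ℝ, E) p).symm W
      (Set.range 𝓘(ℝ, E))
  -- The preferred chart at `p` has identity derivative at `p`, so no transition factor appears when
  -- values at `p` are read in it.
  have hinv : (tderiv E E (extChartAt 𝓘(ℝ, E) p) p).inverse = ContinuousLinearMap.id ℝ E := by
    rw [tderiv_chart_self]
    exact ContinuousLinearMap.inverse_id
  refine (congrArg (fun F : E →L[ℝ] E => F (VectorField.lieBracketWithin ℝ V₁ W₁ Set.univ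
    (extChartAt 𝓘(ℝ, E) p p))) hinv).trans ?_
  rw [VectorField.lieBracketWithin_univ, ContinuousLinearMap.id_apply]
  have hV : V₁ =ᶠ[𝓝 (extChartAt 𝓘(ℝ, E) p p)] fieldInChart (M := M) V p := by
    filter_upwards [hn] with z hz using mpullbackWithin_eq_fieldInChart V p hz
  have hW : W₁ =ᶠ[𝓝 (extChartAt 𝓘(ℝ, E) p p)] fieldInChart (M := M) W p := by
    filter_upwards [hn] with z hz using mpullbackWithin_eq_fieldInChart W p hz
  rw [hV.lieBracket_vectorField_eq hW, VectorField.lieBracket]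
  exact congrArg₂ (· - ·) (congrArg _ (fieldInChart_self (M := M) V p))
    (congrArg _ (fieldInChart_self (M := M) W p))

lemma diffContract_eq_chart (V : M → E)
    (η : M → E →L[ℝ] ℝ) (p : M)
    {V' : E →L[ℝ] E} {η' : E →L[ℝ] E →L[ℝ] ℝ}
    (hV : HasFDerivAt (fieldInChart V p) V' (extChartAt 𝓘(ℝ, E) p p))
    (hη : HasFDerivAt (coFieldInChart η p) η' (extChartAt 𝓘(ℝ, E) p p)) (u : E) :
    (diffContract V η p : E →L[ℝ] ℝ) u = η' u (V p) + η p (V' u) := by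
  have hsrc := mem_chart_source E p
  have hd := hη.clm_apply hV
  have h1 : (fun q => η q (V q)) =ᶠ[𝓝 p] (fun z => coFieldInChart η p z
      (fieldInChart V p z)) ∘ extChartAt 𝓘(ℝ, E) p := by
    filter_upwards [(chartAt E p).open_source.mem_nhds hsrc] with q hq
    rw [Function.comp_apply, coFieldInChart_apply_fieldInChart V η p (chart_mem_target hq),
      chart_symm_chart hq]
  have h2 : diffContract V η p = tderiv E ℝ (fun q => η q (V q)) p := rfl
  rw [h2, tderiv_congr h1, tderiv_comp hd.differentiableAt.mdifferentiableAt
    (contMDiffAt_chart hsrc).mdiff, tderiv_chart_self, tderiv_eq_fderiv, hd.fderiv,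
    fieldInChart_self, coFieldInChart_self]
  exact add_comm _ _

lemma contractExtDeriv_eq_chart (η : M → E →L[ℝ] ℝ) (p : M)
    {η' : E →L[ℝ] E →L[ℝ] ℝ}
    (hη : HasFDerivAt (coFieldInChart η p) η' (extChartAt 𝓘(ℝ, E) p p)) (X u : E) :
    (contractExtDeriv η p X : E →L[ℝ] ℝ) u = η' X u - η' u X := by
  have h : (contractExtDeriv η p X : E →L[ℝ] ℝ) =
      (fderiv ℝ (coFieldInChart η p) (extChartAt 𝓘(ℝ, E) p p)
        (tderiv E E (extChartAt 𝓘(ℝ, E) p) p X) -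
      (fderiv ℝ (coFieldInChart η p) (extChartAt 𝓘(ℝ, E) p p)).flip
        (tderiv E E (extChartAt 𝓘(ℝ, E) p) p X)).comp (tderiv E E (extChartAt 𝓘(ℝ, E) p) p) := rfl
  rw [h, hη.fderiv, tderiv_chart_self]
  rfl

lemma courantBracket_fst_eq_chart (s t : RealSection E M) (p : M) {V' W' : E →L[ℝ] E}
    (hV : HasFDerivAt (fieldInChart (M := M) (fun q => (s q).1) p) V' (extChartAt 𝓘(ℝ, E) p p))
    (hW : HasFDerivAt (fieldInChart (M := M) (fun q => (t q).1) p) W' (extChartAt 𝓘(ℝ, E) p p)) :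
    ((courantBracket s t p).1 : E) = W' (s p).1 - V' (t p).1 := by
  have := mlieBracket_eq_chart (fun q => (s q).1) (fun q => (t q).1) p
  rw [hV.fderiv, hW.fderiv] at this
  exact this

/-- This reduces the bracket at `p` to values and first derivatives of the components in a single
chart, the form in which it can be compared with the bracket of lifts. -/
lemma courantBracket_snd_eq_chart (s t : RealSection E M) (p : M) {V' W' : E →L[ℝ] E}
    {ξ' η' : E →L[ℝ] E →L[ℝ] ℝ}
    (hV : HasFDerivAt (fieldInChart (M := M) (fun q => (s q).1) p) V' (extChartAt 𝓘(ℝ, E) p p))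
    (hW : HasFDerivAt (fieldInChart (M := M) (fun q => (t q).1) p) W' (extChartAt 𝓘(ℝ, E) p p))
    (hξ : HasFDerivAt (coFieldInChart (M := M) (fun q => (s q).2) p) ξ' (extChartAt 𝓘(ℝ, E) p p))
    (hη : HasFDerivAt (coFieldInChart (M := M) (fun q => (t q).2) p) η' (extChartAt 𝓘(ℝ, E) p p))
    (u : E) :
    ((courantBracket s t p).2 : E →L[ℝ] ℝ) u =
      (η' (s p).1 u - η' u (s p).1)
        + (1 / 2 : ℝ) * (η' u (s p).1 + ((t p).2 : E →L[ℝ] ℝ) (V' u))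
        - (ξ' (t p).1 u - ξ' u (t p).1)
        - (1 / 2 : ℝ) * (ξ' u (t p).1 + ((s p).2 : E →L[ℝ] ℝ) (W' u)) := by
  have h1 := contractExtDeriv_eq_chart (fun q => (t q).2) p hη (s p).1 u
  have h2 := contractExtDeriv_eq_chart (fun q => (s q).2) p hξ (t p).1 u
  have h3 := diffContract_eq_chart (fun q => (s q).1) (fun q => (t q).2) p hV hη u
  have h4 := diffContract_eq_chart (fun q => (t q).1) (fun q => (s q).2) p hW hξ u
  exact (congrArg₂ (· - ·) (congrArg₂ (· - ·) (congrArg₂ (· + ·) h1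
    (congrArg ((1 / 2 : ℝ) * ·) h3)) h2) (congrArg ((1 / 2 : ℝ) * ·) h4))

end CourantInChart

/-! ### Left invariant frames and the Maurer-Cartan form of a map into the group. -/

lemma eventually_contMDiffAt {E F G : Type*} [NormedAddCommGroup E] [NormedSpace ℝ E]
    [TopologicalSpace G] [ChartedSpace E G] [NormedAddCommGroup F] [NormedSpace ℝ F] {σ : F → G} {z₀ : F} {U : Set F} (hU : IsOpen U) (hz : z₀ ∈ U)
    (hσ : ContMDiffOn 𝓘(ℝ, F) 𝓘(ℝ, E) ∞ σ U) :
    ∀ᶠ z in 𝓝 z₀, z ∈ U ∧ σ z ∈ (chartAt E (σ z₀)).source := by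
  have h1 : ContinuousAt σ z₀ := (hσ.contMDiffAt (hU.mem_nhds hz)).continuousAt
  have h2 : ∀ᶠ z in 𝓝 z₀, z ∈ U := hU.mem_nhds hz
  exact h2.and
    (h1.eventually ((chartAt E (σ z₀)).open_source.mem_nhds (mem_chart_source E (σ z₀))))

section MaurerCartan

variable {E : Type*} [NormedAddCommGroup E] [NormedSpace ℝ E]
  {G : Type*} [TopologicalSpace G] [ChartedSpace E G] [Group G] [LieGroup 𝓘(ℝ, E) ∞ G]

/-- Left invariant vector fields are smooth. -/
lemma contMDiff_mulInvariantVectorField_infty (v : GroupLieAlgebra 𝓘(ℝ, E) G) :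
    ContMDiff 𝓘(ℝ, E) 𝓘(ℝ, E).tangent ∞
      (fun g : G => (mulInvariantVectorField v g : TangentBundle 𝓘(ℝ, E) G)) := by
  have : IsManifold 𝓘(ℝ, E) (∞ + 1) G := inferInstanceAs (IsManifold 𝓘(ℝ, E) ∞ G)
  have : IsManifold 𝓘(ℝ, E) 1 G := IsManifold.of_le (n := ∞) (by simp)
  -- The left invariant field is the tangent map of multiplication applied to the zero vector at `g`
  -- and `v` at `1`, a composition of smooth maps.
  let fg : G → TangentBundle 𝓘(ℝ, E) G := fun g => Bundle.TotalSpace.mk' E g 0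
  have sfg : ContMDiff 𝓘(ℝ, E) 𝓘(ℝ, E).tangent ∞ fg := Bundle.contMDiff_zeroSection _ _
  let fv : G → TangentBundle 𝓘(ℝ, E) G := fun _ => Bundle.TotalSpace.mk' E 1 v
  have sfv : ContMDiff 𝓘(ℝ, E) 𝓘(ℝ, E).tangent ∞ fv := contMDiff_const
  let F₁ : G → (TangentBundle 𝓘(ℝ, E) G × TangentBundle 𝓘(ℝ, E) G) := fun g => (fg g, fv g)
  have S₁ : ContMDiff 𝓘(ℝ, E) (𝓘(ℝ, E).tangent.prod 𝓘(ℝ, E).tangent) ∞ F₁ := sfg.prodMk sfv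
  let F₂ : (TangentBundle 𝓘(ℝ, E) G × TangentBundle 𝓘(ℝ, E) G) →
      TangentBundle (𝓘(ℝ, E).prod 𝓘(ℝ, E)) (G × G) :=
    (equivTangentBundleProd 𝓘(ℝ, E) G 𝓘(ℝ, E) G).symm
  have S₂ : ContMDiff (𝓘(ℝ, E).tangent.prod 𝓘(ℝ, E).tangent)
      (𝓘(ℝ, E).prod 𝓘(ℝ, E)).tangent ∞ F₂ := contMDiff_equivTangentBundleProd_symm
  let F₃ : TangentBundle (𝓘(ℝ, E).prod 𝓘(ℝ, E)) (G × G) → TangentBundle 𝓘(ℝ, E) G :=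
    tangentMap (𝓘(ℝ, E).prod 𝓘(ℝ, E)) 𝓘(ℝ, E) (fun p : G × G => p.1 * p.2)
  have S₃ : ContMDiff (𝓘(ℝ, E).prod 𝓘(ℝ, E)).tangent 𝓘(ℝ, E).tangent ∞ F₃ := by
    apply ContMDiff.contMDiff_tangentMap _ (m := ∞) le_rfl
    exact contMDiff_mul 𝓘(ℝ, E) ∞
  have S := (S₃.comp S₂).comp S₁
  convert! S with g
  · simp [F₁, F₂, F₃, fg, fv]
  · simp only [Function.comp_apply, tangentMap, F₃, F₂, F₁, fg, fv]
    have h := mfderiv_prod_eq_add_apply (I := 𝓘(ℝ, E)) (I' := 𝓘(ℝ, E)) (I'' := 𝓘(ℝ, E))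
      (f := fun p : G × G => p.1 * p.2) (p := (g, 1)) (v := ((0 : E), v))
      ((contMDiff_mul 𝓘(ℝ, E) ∞).mdifferentiable (by simp) _)
    refine Eq.trans ?_ h.symm
    have h1 : (mfderiv 𝓘(ℝ, E) 𝓘(ℝ, E) (fun z : G => z * 1) g : E →L[ℝ] E) 0 = 0 := map_zero _
    exact (zero_add _).symm.trans (congrArg (· + _) h1.symm)

lemma mdifferentiableAt_leftMul (g h : G) :
    MDifferentiableAt 𝓘(ℝ, E) 𝓘(ℝ, E) (fun x : G => g * x) h :=
  (contMDiff_mul_left (I := 𝓘(ℝ, E)) (n := ∞)).contMDiffAt.mdiff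

variable (E) in
/-- Left translation of tangent vectors at the identity. -/
def leftMap (g : G) : E →L[ℝ] E := tderiv E E (fun x : G => g * x) 1

lemma tderiv_mul_left_inv_comp (g h : G) :
    (tderiv E E (fun x : G => g⁻¹ * x) (g * h)).comp (tderiv E E (fun x : G => g * x) h) =
      ContinuousLinearMap.id ℝ E := by
  rw [← tderiv_comp (f := fun x : G => g * x) (p := h) (mdifferentiableAt_leftMul _ _)
    (mdifferentiableAt_leftMul _ _), ← tderiv_id h]
  refine tderiv_congr (Filter.Eventually.of_forall fun x => ?_)
  simp

lemma tderiv_inv_mul_left_comp (g : G) :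
    (leftMap E g).comp (tderiv E E (fun x : G => g⁻¹ * x) g) = ContinuousLinearMap.id ℝ E := by
  have := tderiv_mul_left_inv_comp (E := E) g⁻¹ g
  rwa [inv_inv, inv_mul_cancel] at this

lemma tderiv_inv_mul_left_comp' (g : G) :
    (tderiv E E (fun x : G => g⁻¹ * x) g).comp (leftMap E g) = ContinuousLinearMap.id ℝ E := by
  have := tderiv_mul_left_inv_comp (E := E) g 1
  rwa [mul_one] at this

variable (E G) in
/-- The bracket of the Lie algebra of `G`, on the model space. -/
def groupBracket (v w : E) : E :=
  Bracket.bracket (L := GroupLieAlgebra 𝓘(ℝ, E) G) (M := GroupLieAlgebra 𝓘(ℝ, E) G) v w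

/-- The left invariant frame, read in the preferred chart around `g`. -/
def leftMapInChart (g : G) (y : E) : E →L[ℝ] E :=
  (tderiv E E (extChartAt 𝓘(ℝ, E) g) ((extChartAt 𝓘(ℝ, E) g).symm y)).comp
    (leftMap E ((extChartAt 𝓘(ℝ, E) g).symm y))

/-- Finite dimension allows testing smoothness of the operator-valued map on each vector, where it
is a left invariant field in the chart. -/
lemma contDiffOn_leftMapInChart [FiniteDimensional ℝ E] (g : G) :
    ContDiffOn ℝ ∞ (leftMapInChart (E := E) g) (extChartAt 𝓘(ℝ, E) g).target := by
  rw [contDiffOn_clm_apply]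
  intro v y hy
  have hq := mem_chartAt_source_of_target hy
  have h1 := contMDiff_mulInvariantVectorField_infty (E := E) (G := G) v
    ((extChartAt 𝓘(ℝ, E) g).symm y)
  have h2 := (smooth_field_iff (M := G) (fun h => mulInvariantVectorField v h) hq).1 h1
  rw [(extChartAt 𝓘(ℝ, E) g).right_inv hy] at h2
  exact h2.contDiffWithinAt

lemma leftMapInChart_isInvertible (g : G) {y : E} (hy : y ∈ (extChartAt 𝓘(ℝ, E) g).target) :
    (leftMapInChart g y).IsInvertible := by
  have h1 : (tderiv E E (extChartAt 𝓘(ℝ, E) g)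
      ((extChartAt 𝓘(ℝ, E) g).symm y)).IsInvertible :=
    ContinuousLinearMap.IsInvertible.of_inverse (tderiv_chart_comp_symm hy)
      (tderiv_chart_symm_comp hy)
  have h2 : (leftMap E ((extChartAt 𝓘(ℝ, E) g).symm y)).IsInvertible :=
    ContinuousLinearMap.IsInvertible.of_inverse (tderiv_inv_mul_left_comp _)
      (tderiv_inv_mul_left_comp' _)
  exact h1.comp h2

/-- The bracket of the Lie algebra, in terms of the left invariant frame in a chart. -/
lemma leftMap_lie [CompleteSpace E] (g : G) (v w : E)
    {B' : E →L[ℝ] E →L[ℝ] E}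
    (hB : HasFDerivAt (leftMapInChart (E := E) g) B' (extChartAt 𝓘(ℝ, E) g g)) :
    leftMap E g (groupBracket E G v w) = B' (leftMap E g v) w - B' (leftMap E g w) v := by
  have h1 := (congrFun (mulInvariantVector_mlieBracket (G := G) (I := 𝓘(ℝ, E)) v w) g).trans
    (mlieBracket_eq_chart _ _ g)
  have h2 : ∀ x : E, HasFDerivAt (fieldInChart (fun h : G => leftMap E h x) g) (B'.flip x)
      (extChartAt 𝓘(ℝ, E) g g) := fun x => by
    simpa using! hB.clm_apply (hasFDerivAt_const x (extChartAt 𝓘(ℝ, E) g g))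
  refine Eq.trans h1 ?_
  exact congrArg₂ (· - ·) (congrArg (fun F : E →L[ℝ] E => F (leftMap E g v)) (h2 w).fderiv)
    (congrArg (fun F : E →L[ℝ] E => F (leftMap E g w)) (h2 v).fderiv)

variable {F : Type*} [NormedAddCommGroup F] [NormedSpace ℝ F]

variable (E) in
/-- The pullback of the left Maurer-Cartan form along a map `σ` into the group. -/
def maurerCartan (σ : F → G) (z : F) : F →L[ℝ] E := tderiv F E (fun z' => (σ z)⁻¹ * σ z') z

lemma tderiv_eq_leftMap_comp_maurerCartan {σ : F → G} {z : F}
    (hσ : MDifferentiableAt 𝓘(ℝ, F) 𝓘(ℝ, E) σ z) :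
    tderiv F E σ z = (leftMap E (σ z)).comp (maurerCartan E σ z) := by
  have h := tderiv_comp (f := σ) (g := fun x => (σ z)⁻¹ * x)
    (mdifferentiableAt_leftMul (E := E) (σ z)⁻¹ (σ z)) hσ
  have h' : maurerCartan E σ z = _ := h
  rw [h', ← ContinuousLinearMap.comp_assoc, tderiv_inv_mul_left_comp]
  rfl

/-- Writing `s` for `σ` in the chart and `B` for the left invariant frame, this is `ds = B(s) Θ`;
both smoothness of `Θ` and its structure equation come from it. -/
lemma fderiv_chart_comp {σ : F → G} {g : G} {z : F}
    (hσ : MDifferentiableAt 𝓘(ℝ, F) 𝓘(ℝ, E) σ z) (hz : σ z ∈ (chartAt E g).source) :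
    fderiv ℝ (fun z => extChartAt 𝓘(ℝ, E) g (σ z)) z =
      (leftMapInChart g (extChartAt 𝓘(ℝ, E) g (σ z))).comp (maurerCartan E σ z) := by
  have h := tderiv_comp (f := σ) (g := extChartAt 𝓘(ℝ, E) g) (contMDiffAt_chart hz).mdiff hσ
  rw [tderiv_eq_leftMap_comp_maurerCartan hσ] at h
  rw [← tderiv_eq_fderiv, leftMapInChart, chart_symm_chart hz]
  exact h

lemma contDiffAt_chart_comp {σ : F → G} {g : G} {z : F}
    (hσ : ContMDiffAt 𝓘(ℝ, F) 𝓘(ℝ, E) ∞ σ z) (hz : σ z ∈ (chartAt E g).source) :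
    ContDiffAt ℝ ∞ (fun z => extChartAt 𝓘(ℝ, E) g (σ z)) z := by
  rw [← contMDiffAt_iff_contDiffAt]
  exact (contMDiffAt_chart hz).comp z hσ

variable [FiniteDimensional ℝ E]

lemma contDiffAt_leftMapInChart_comp {σ : F → G} {g : G} {z : F}
    (hσ : ContMDiffAt 𝓘(ℝ, F) 𝓘(ℝ, E) ∞ σ z) (hz : σ z ∈ (chartAt E g).source) :
    ContDiffAt ℝ ∞ (fun z => leftMapInChart (E := E) g (extChartAt 𝓘(ℝ, E) g (σ z))) z := by
  have h1 := (contDiffOn_leftMapInChart (E := E) g).contDiffAt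
    ((isOpen_extChartAt_target (I := 𝓘(ℝ, E)) g).mem_nhds (chart_mem_target hz))
  exact h1.comp z (contDiffAt_chart_comp hσ hz)

/-- The pullback of the Maurer-Cartan form along a smooth map is smooth. -/
lemma contDiffAt_maurerCartan {σ : F → G} {U : Set F} (hU : IsOpen U)
    (hσ : ContMDiffOn 𝓘(ℝ, F) 𝓘(ℝ, E) ∞ σ U) {z₀ : F} (hz : z₀ ∈ U) :
    ContDiffAt ℝ ∞ (maurerCartan E σ) z₀ := by
  have : CompleteSpace E := FiniteDimensional.complete ℝ E
  have hs := mem_chart_source E (σ z₀)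
  have hσ₀ := hσ.contMDiffAt (hU.mem_nhds hz)
  have h1 := contDiffAt_leftMapInChart_comp hσ₀ hs
  have h2 := (leftMapInChart_isInvertible (σ z₀) (chart_mem_target hs)).contDiffAt_map_inverse
    (n := ∞)
  -- Inversion is smooth near an invertible operator, so `Θ = B(s)⁻¹ ds` is smooth.
  have h3 := ContDiffAt.comp z₀ h2 h1
  have h4 : ContDiffAt ℝ ∞ (fderiv ℝ (fun z => extChartAt 𝓘(ℝ, E) (σ z₀) (σ z))) z₀ :=
    (contDiffAt_chart_comp hσ₀ hs).fderiv_right (m := ∞) le_rfl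
  refine (h3.clm_comp h4).congr_of_eventuallyEq ?_
  filter_upwards [eventually_contMDiffAt hU hz hσ] with z hz
  rw [fderiv_chart_comp (hσ.contMDiffAt (hU.mem_nhds hz.1)).mdiff hz.2]
  have := (leftMapInChart_isInvertible (σ z₀) (chart_mem_target hz.2)).inverse_comp_self
  rw [Function.comp_apply, ← ContinuousLinearMap.comp_assoc, this]
  rfl

/-- The Maurer-Cartan equation. -/
lemma maurerCartan_equation {σ : F → G} {U : Set F} (hU : IsOpen U)
    (hσ : ContMDiffOn 𝓘(ℝ, F) 𝓘(ℝ, E) ∞ σ U) {z₀ : F} (hz : z₀ ∈ U) (u v : F) :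
    fderiv ℝ (maurerCartan E σ) z₀ u v - fderiv ℝ (maurerCartan E σ) z₀ v u =
      -groupBracket E G (maurerCartan E σ z₀ u) (maurerCartan E σ z₀ v) := by
  have : CompleteSpace E := FiniteDimensional.complete ℝ E
  have hs := mem_chart_source E (σ z₀)
  have hσ₀ := hσ.contMDiffAt (hU.mem_nhds hz)
  set g := σ z₀ with hg
  set s : F → E := fun z => extChartAt 𝓘(ℝ, E) g (σ z) with hsdef
  set Θ := maurerCartan E σ with hΘ
  have hsd : ContDiffAt ℝ ∞ s z₀ := contDiffAt_chart_comp hσ₀ hs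
  have hB : HasFDerivAt (leftMapInChart (E := E) g)
      (fderiv ℝ (leftMapInChart (E := E) g) (s z₀)) (s z₀) :=
    (((contDiffOn_leftMapInChart (E := E) g).contDiffAt
      ((isOpen_extChartAt_target (I := 𝓘(ℝ, E)) g).mem_nhds
        (chart_mem_target hs))).differentiableAt (by simp)).hasFDerivAt
  set B' := fderiv ℝ (leftMapInChart (E := E) g) (s z₀) with hB'
  have hB0 : leftMapInChart (E := E) g (s z₀) = leftMap E g := by
    rw [leftMapInChart, hsdef]
    simp only
    rw [← hg, chart_symm_chart hs, tderiv_chart_self]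
    rfl
  have hΘd : HasFDerivAt Θ (fderiv ℝ Θ z₀) z₀ :=
    ((contDiffAt_maurerCartan hU hσ hz).differentiableAt (by simp)).hasFDerivAt
  have hds : fderiv ℝ s z₀ = (leftMap E g).comp (Θ z₀) := by
    rw [← hB0]; exact fderiv_chart_comp hσ₀.mdiff hs
  have hev : fderiv ℝ s =ᶠ[𝓝 z₀] fun z => (leftMapInChart (E := E) g (s z)).comp (Θ z) := by
    filter_upwards [eventually_contMDiffAt hU hz hσ] with z hz
    exact fderiv_chart_comp (hσ.contMDiffAt (hU.mem_nhds hz.1)).mdiff hz.2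
  have hBs : HasFDerivAt (fun z => leftMapInChart (E := E) g (s z))
      (B'.comp (fderiv ℝ s z₀)) z₀ :=
    hB.comp z₀ (hsd.differentiableAt (by simp)).hasFDerivAt
  have h2 := (hBs.clm_comp hΘd).congr_of_eventuallyEq hev
  -- Symmetry of the second derivative of `s` makes the antisymmetrized derivative of `B(s) Θ`
  -- vanish. The part differentiating `B` is the bracket by `leftMap_lie`, and the remaining part is
  -- `B` applied to the antisymmetrized derivative of `Θ`.
  have hsymm : IsSymmSndFDerivAt ℝ s z₀ := hsd.isSymmSndFDerivAt (by
    rw [minSmoothness_of_isRCLikeNormedField]; exact ENat.LEInfty.out)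
  have h3 := hsymm u v
  rw [h2.fderiv] at h3
  have h4 := leftMap_lie g (Θ z₀ u) (Θ z₀ v) hB
  have hinj : Function.Injective (leftMap E g) := by
    intro x y hxy
    have := congrArg (tderiv E E (fun x : G => g⁻¹ * x) g) hxy
    have h5 := fun x => congrArg (fun F : E →L[ℝ] E => F x) (tderiv_inv_mul_left_comp' (E := E) g)
    simpa using (h5 x).symm.trans (this.trans (h5 y))
  apply hinj
  rw [hds] at h3
  simp only [add_apply, ContinuousLinearMap.comp_apply,
    ContinuousLinearMap.compL_apply, ContinuousLinearMap.flip_apply, hB0] at h3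
  rw [map_sub, map_neg, h4]
  rw [← sub_eq_zero] at h3 ⊢
  rw [← h3]
  abel

end MaurerCartan

/-! ### Local sections and local slices of submersions. -/

section SubmersionCharts

variable {E : Type*} [NormedAddCommGroup E] [NormedSpace ℝ E]
  {M : Type*} [TopologicalSpace M] [ChartedSpace E M] [IsManifold 𝓘(ℝ, E) ∞ M]
  {E' : Type*} [NormedAddCommGroup E'] [NormedSpace ℝ E']
  {N : Type*} [TopologicalSpace N] [ChartedSpace E' N] [IsManifold 𝓘(ℝ, E') ∞ N]
  {F : Type*} [NormedAddCommGroup F] [NormedSpace ℝ F]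

/-- A submersion in adapted charts. -/
lemma submersion_normalForm {f : M → N} {x : M}
    (h : Manifold.IsSubmersionAtOfComplement F 𝓘(ℝ, E) 𝓘(ℝ, E') ∞ f x) :
    ∃ (φ : OpenPartialHomeomorph M E) (ψ : OpenPartialHomeomorph N E') (e : E ≃L[ℝ] (E' × F)),
      x ∈ φ.source ∧ ContMDiffOn 𝓘(ℝ, E) 𝓘(ℝ, E) ∞ φ φ.source ∧
      ContMDiffOn 𝓘(ℝ, E) 𝓘(ℝ, E) ∞ φ.symm φ.target ∧
      ContMDiffOn 𝓘(ℝ, E') 𝓘(ℝ, E') ∞ ψ ψ.source ∧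
      (∀ y ∈ φ.source, f y ∈ ψ.source) ∧ ∀ y ∈ φ.source, ψ (f y) = (e (φ y)).1 := by
  refine ⟨h.domChart, h.codChart, h.equiv, h.mem_domChart_source,
    contMDiffOn_of_mem_maximalAtlas h.domChart_mem_maximalAtlas,
    contMDiffOn_symm_of_mem_maximalAtlas h.domChart_mem_maximalAtlas,
    contMDiffOn_of_mem_maximalAtlas h.codChart_mem_maximalAtlas,
    fun y hy => h.source_subset_preimage_source hy, fun y hy => ?_⟩
  have hy' : h.domChart y ∈ (h.domChart.extend 𝓘(ℝ, E)).target := by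
    simpa using h.domChart.map_source hy
  have h1 := h.writtenInCharts hy'
  simpa [h.domChart.left_inv hy] using h1

/-- In adapted charts `f` forgets the `F`-coordinate; freezing that coordinate at its value at `x`
gives a section. -/
lemma exists_local_section {f : M → N} {x : M}
    (h : Manifold.IsSubmersionAtOfComplement F 𝓘(ℝ, E) 𝓘(ℝ, E') ∞ f x) :
    ∃ (U : Set N) (τ : N → M), IsOpen U ∧ f x ∈ U ∧ ContMDiffOn 𝓘(ℝ, E') 𝓘(ℝ, E) ∞ τ U ∧
      τ (f x) = x ∧ ∀ q ∈ U, f (τ q) = q := by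
  obtain ⟨φ, ψ, e, hx, -, hφ', hψ, hs, hf⟩ := submersion_normalForm h
  set v₀ := (e (φ x)).2 with hv
  let g : E' → E := fun u => e.symm (u, v₀)
  have hg : ContDiff ℝ ∞ g := e.symm.contDiff.comp (contDiff_id.prodMk contDiff_const)
  have hU : IsOpen (ψ.source ∩ ψ ⁻¹' (g ⁻¹' φ.target)) :=
    ψ.isOpen_inter_preimage (hg.continuous.isOpen_preimage _ φ.open_target)
  have hgx : g (ψ (f x)) = φ x := by
    simp only [g, hf x hx, hv]
    exact e.symm_apply_apply _
  refine ⟨_, fun q => φ.symm (g (ψ q)), hU, ⟨hs x hx, ?_⟩, ?_, ?_, ?_⟩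
  · change g (ψ (f x)) ∈ φ.target
    rw [hgx]
    exact φ.map_source hx
  · refine hφ'.comp (t := φ.target) ((hg.contMDiff.comp_contMDiffOn (hψ.mono fun q hq => hq.1))) ?_
    exact fun q hq => hq.2
  · simp only
    rw [hgx, φ.left_inv hx]
  · rintro q ⟨hq, hq'⟩
    have h1 : φ.symm (g (ψ q)) ∈ φ.source := φ.map_target hq'
    have h2 := hf _ h1
    rw [φ.right_inv hq'] at h2
    simp only [g, ContinuousLinearEquiv.apply_symm_apply] at h2
    exact ψ.injOn (hs _ h1) hq h2

lemma surjective_tderiv_of_submersion {f : M → N} {x : M}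
    (h : Manifold.IsSubmersionAtOfComplement F 𝓘(ℝ, E) 𝓘(ℝ, E') ∞ f x) :
    Function.Surjective (tderiv E E' f x) := by
  obtain ⟨U, τ, hU, hx, hτ, hτx, hfτ⟩ := exists_local_section h
  have h1 := tderiv_comp (f := τ) (g := f) (p := f x)
    (by rw [hτx]; exact h.contMDiffAt.mdiff) (hτ.contMDiffAt (hU.mem_nhds hx)).mdiff
  have h2 : tderiv E' E' (f ∘ τ) (f x) = ContinuousLinearMap.id ℝ E' := by
    rw [← tderiv_id (f x)]
    refine tderiv_congr ?_
    filter_upwards [hU.mem_nhds hx] with q hq using hfτ q hq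
  rw [h2, hτx] at h1
  intro y
  exact ⟨tderiv E' E τ (f x) y, (congrArg (fun F : E' →L[ℝ] E' => F y) h1).symm⟩

/-- The fibre of a submersion is locally the image of a smooth map whose differential is onto the
kernel of the differential of the submersion. -/
lemma exists_local_slice {f : M → N} {x : M}
    (h : Manifold.IsSubmersionAtOfComplement F 𝓘(ℝ, E) 𝓘(ℝ, E') ∞ f x) :
    ∃ (V : Set F) (c : F → M) (v₀ : F), IsOpen V ∧ v₀ ∈ V ∧
      ContMDiffOn 𝓘(ℝ, F) 𝓘(ℝ, E) ∞ c V ∧ c v₀ = x ∧ (∀ v ∈ V, f (c v) = f x) ∧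
      (∀ X, tderiv E E' f x X = 0 → ∃ w, tderiv F E c v₀ w = X) ∧
      ∀ S ∈ 𝓝 v₀, ∀ᶠ y in 𝓝 x, f y = f x → ∃ v ∈ S, c v = y := by
  obtain ⟨φ, ψ, e, hx, hφ, hφ', hψ, hs, hf⟩ := submersion_normalForm h
  set u₀ := (e (φ x)).1 with hu
  -- The slice freezes the base coordinate instead and lets the fibre coordinate vary.
  let g : F → E := fun v => e.symm (u₀, v)
  have hg : ContDiff ℝ ∞ g := e.symm.contDiff.comp (contDiff_const.prodMk contDiff_id)
  have hV : IsOpen (g ⁻¹' φ.target) := hg.continuous.isOpen_preimage _ φ.open_target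
  have hgx : g (e (φ x)).2 = φ x := by
    simp only [g, hu]
    exact e.symm_apply_apply _
  have hv0 : (e (φ x)).2 ∈ g ⁻¹' φ.target := by
    change g (e (φ x)).2 ∈ φ.target
    rw [hgx]
    exact φ.map_source hx
  refine ⟨g ⁻¹' φ.target, fun v => φ.symm (g v), (e (φ x)).2, hV, hv0, ?_, ?_, ?_, ?_, ?_⟩
  · exact hφ'.comp (t := φ.target) hg.contMDiff.contMDiffOn fun v hv => hv
  · simp only
    rw [hgx, φ.left_inv hx]
  · intro v hv
    have h1 : φ.symm (g v) ∈ φ.source := φ.map_target hv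
    have h2 := hf _ h1
    rw [φ.right_inv hv] at h2
    simp only [g, ContinuousLinearEquiv.apply_symm_apply] at h2
    exact ψ.injOn (hs _ h1) (hs _ hx) (h2.trans (hf x hx).symm)
  · intro X hX
    have hφx := (hφ.contMDiffAt (φ.open_source.mem_nhds hx)).mdiff
    have hψx := (hψ.contMDiffAt (ψ.open_source.mem_nhds (hs x hx))).mdiff
    have hφx' := (hφ'.contMDiffAt (φ.open_target.mem_nhds (φ.map_source hx))).mdiff
    have h1 := tderiv_comp hψx h.contMDiffAt.mdiff
    let L : E →L[ℝ] E' := (ContinuousLinearMap.fst ℝ E' F).comp (e : E →L[ℝ] E' × F)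
    have h2 := tderiv_comp (g := L) (f := φ) (p := x)
      (L.differentiableAt.mdifferentiableAt) hφx
    have h3 : tderiv E E' (ψ ∘ f) x = tderiv E E' (L ∘ φ) x := by
      refine tderiv_congr ?_
      filter_upwards [φ.open_source.mem_nhds hx] with y hy using hf y hy
    rw [h1, h2, tderiv_eq_fderiv, L.fderiv] at h3
    have h4 := congrArg (fun F : E →L[ℝ] E' => F X) h3
    simp only [ContinuousLinearMap.comp_apply, hX, map_zero] at h4
    set A := tderiv E E φ x X with hA
    -- In adapted charts `df` is the first component, so a vector killed by `df` has only a fibre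
    -- component, and that component is the parameter direction sought.
    have h5 : (e A).1 = 0 := h4.symm
    refine ⟨(e A).2, ?_⟩
    let L' : F →L[ℝ] E := (e.symm : E' × F →L[ℝ] E).comp (ContinuousLinearMap.inr ℝ E' F)
    have hgd : HasFDerivAt g L' (e (φ x)).2 :=
      (e.symm : E' × F →L[ℝ] E).hasFDerivAt.comp _
        ((hasFDerivAt_const u₀ _).prodMk (hasFDerivAt_id (e (φ x)).2))
    have h6 := tderiv_comp (g := φ.symm) (f := g) (p := (e (φ x)).2) (by rw [hgx]; exact hφx')
      hgd.differentiableAt.mdifferentiableAt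
    rw [tderiv_eq_fderiv, hgd.fderiv, hgx] at h6
    refine (congrArg (fun T : F →L[ℝ] E => T (e A).2) h6).trans ?_
    have h7 : L' (e A).2 = A := by
      change e.symm (0, (e A).2) = A
      rw [← h5]
      exact e.symm_apply_apply _
    rw [ContinuousLinearMap.comp_apply, h7]
    have h8 := tderiv_comp (g := φ.symm) (f := φ) (p := x) hφx' hφx
    have h9 : tderiv E E (φ.symm ∘ φ) x = ContinuousLinearMap.id ℝ E := by
      rw [← tderiv_id x]
      refine tderiv_congr ?_
      filter_upwards [φ.open_source.mem_nhds hx] with y hy using φ.left_inv hy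
    rw [h9] at h8
    exact (congrArg (fun T : E →L[ℝ] E => T X) h8).symm
  · intro S hS
    have hc : ContinuousAt (fun y => (e (φ y)).2) x :=
      (continuous_snd.comp e.continuous).continuousAt.comp
        (φ.continuousOn.continuousAt (φ.open_source.mem_nhds hx))
    filter_upwards [hc hS, φ.open_source.mem_nhds hx] with y hy hy' hfy
    refine ⟨(e (φ y)).2, hy, ?_⟩
    have h1 : u₀ = (e (φ y)).1 := by rw [← hf y hy', hfy, hf x hx]
    simp only [g, h1]
    change φ.symm (e.symm (e (φ y))) = y
    rw [e.symm_apply_apply, φ.left_inv hy']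

end SubmersionCharts

/-- A curve in a manifold with vanishing velocity is constant. -/
lemma eq_of_tderiv_eq_zero {E : Type*} [NormedAddCommGroup E] [NormedSpace ℝ E]
    {M : Type*} [TopologicalSpace M] [ChartedSpace E M] [IsManifold 𝓘(ℝ, E) ∞ M] {γ : ℝ → M}
    (hγ : ∀ t, MDifferentiableAt 𝓘(ℝ, ℝ) 𝓘(ℝ, E) γ t) (h₀ : ∀ t, tderiv ℝ E γ t = 0) (s t : ℝ) :
    γ s = γ t := by
  have hloc : IsLocallyConstant γ := by
    rw [IsLocallyConstant.iff_eventually_eq]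
    intro t
    have hs : ∀ᶠ u in 𝓝 t, γ u ∈ (chartAt E (γ t)).source :=
      (hγ t).continuousAt.eventually
        ((chartAt E (γ t)).open_source.mem_nhds (mem_chart_source E (γ t)))
    obtain ⟨ε, hε, hball⟩ := Metric.eventually_nhds_iff_ball.1 hs
    have hd : ∀ u ∈ Metric.ball t ε, HasFDerivAt (fun u => extChartAt 𝓘(ℝ, E) (γ t) (γ u))
        (0 : ℝ →L[ℝ] E) u := by
      intro u hu
      have h1 := (contMDiffAt_chart (hball u hu)).mdiff
      have h2 := (h1.comp u (hγ u))
      have h3 := tderiv_comp h1 (hγ u)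
      rw [h₀ u, ContinuousLinearMap.comp_zero, tderiv_eq_fderiv] at h3
      have h4 := (mdifferentiableAt_iff_differentiableAt.1 h2).hasFDerivAt
      rwa [h3] at h4
    filter_upwards [Metric.ball_mem_nhds t hε] with u hu
    have h5 := Metric.isOpen_ball.is_const_of_fderiv_eq_zero
      (convex_ball t ε).isPreconnected
      (fun u hu => (hd u hu).differentiableAt.differentiableWithinAt)
      (fun u hu => (hd u hu).fderiv) hu (Metric.mem_ball_self hε)
    exact (extChartAt 𝓘(ℝ, E) (γ t)).injOn (by simpa using hball u hu)
      (by simp) h5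
  exact hloc.apply_eq_of_preconnectedSpace s t

/-! ### The projection onto the homogeneous space, the action, and the isotropy algebra. -/

section Homogeneous

variable {E : Type*} [NormedAddCommGroup E] [NormedSpace ℝ E]
  {G : Type*} [TopologicalSpace G] [ChartedSpace E G] [Group G] [LieGroup 𝓘(ℝ, E) ∞ G]
  {K : Subgroup G}
  {E' : Type*} [NormedAddCommGroup E'] [NormedSpace ℝ E'] [ChartedSpace E' (G ⧸ K)]

variable (E E' K) in
/-- The derivative at the identity of the projection onto the homogeneous space. -/
def projMap : E →L[ℝ] E' := tderiv E E' (QuotientGroup.mk : G → G ⧸ K) 1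

variable (E') in
/-- The derivative of the action of `g` on the homogeneous space. -/
def actMap (g : G) (p : G ⧸ K) : E' →L[ℝ] E' := tderiv E' E' (fun q : G ⧸ K => g • q) p

lemma actMap_one (p : G ⧸ K) : actMap E' (1 : G) p = ContinuousLinearMap.id ℝ E' := by
  rw [← tderiv_id p]
  exact tderiv_congr (Filter.Eventually.of_forall fun q => one_smul G q)

variable [IsManifold 𝓘(ℝ, E') ∞ (G ⧸ K)]
  (hπ : Manifold.IsSubmersion 𝓘(ℝ, E) 𝓘(ℝ, E') ∞ (QuotientGroup.mk : G → G ⧸ K))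

include hπ

lemma mdifferentiableAt_mk (g : G) :
    MDifferentiableAt 𝓘(ℝ, E) 𝓘(ℝ, E') (QuotientGroup.mk : G → G ⧸ K) g :=
  hπ.contMDiff.contMDiffAt.mdiff

/-- The projection onto a homogeneous space has local smooth sections. -/
lemma exists_section_mk (x : G) :
    ∃ (U : Set (G ⧸ K)) (τ : G ⧸ K → G), IsOpen U ∧ (x : G ⧸ K) ∈ U ∧
      ContMDiffOn 𝓘(ℝ, E') 𝓘(ℝ, E) ∞ τ U ∧ τ x = x ∧ ∀ q ∈ U, (τ q : G ⧸ K) = q :=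
  exists_local_section (hπ.isSubmersionOfComplement_complement x)

/-- Through a local section `τ` the action is `q ↦ π(g τ(q))`, a composition of differentiable maps;
smoothness of the action is not assumed separately. -/
lemma mdifferentiableAt_smul (g : G) (p : G ⧸ K) :
    MDifferentiableAt 𝓘(ℝ, E') 𝓘(ℝ, E') (fun q : G ⧸ K => g • q) p := by
  obtain ⟨x, rfl⟩ := QuotientGroup.mk_surjective p
  obtain ⟨U, τ, hU, hx, hτ, hτx, hmk⟩ := exists_section_mk hπ x
  have h1 : MDifferentiableAt 𝓘(ℝ, E') 𝓘(ℝ, E') (fun q => ((g * τ q : G) : G ⧸ K)) (x : G ⧸ K) :=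
    (mdifferentiableAt_mk hπ _).comp _ ((mdifferentiableAt_leftMul g _).comp _
      (hτ.contMDiffAt (hU.mem_nhds hx)).mdiff)
  refine h1.congr_of_eventuallyEq ?_
  filter_upwards [hU.mem_nhds hx] with q hq
  change g • q = g • ((τ q : G) : G ⧸ K)
  rw [hmk q hq]

lemma actMap_mul (g h : G) (p : G ⧸ K) :
    actMap E' (g * h) p = (actMap E' g (h • p)).comp (actMap E' h p) := by
  rw [actMap, actMap, actMap, ← tderiv_comp (f := fun q : G ⧸ K => h • q) (p := p)
    (mdifferentiableAt_smul hπ g _) (mdifferentiableAt_smul hπ h p)]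
  exact tderiv_congr (Filter.Eventually.of_forall fun q => mul_smul g h q)

lemma actMap_inv_comp (g : G) (p : G ⧸ K) :
    (actMap E' g⁻¹ (g • p)).comp (actMap E' g p) = ContinuousLinearMap.id ℝ E' := by
  rw [← actMap_mul hπ, inv_mul_cancel, actMap_one]

lemma actMap_comp_inv (g : G) (p : G ⧸ K) :
    (actMap E' g (g⁻¹ • p)).comp (actMap E' g⁻¹ p) = ContinuousLinearMap.id ℝ E' := by
  rw [← actMap_mul hπ, mul_inv_cancel, actMap_one]

lemma actMap_surjective (g : G) (p : G ⧸ K) : Function.Surjective (actMap E' g p) := by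
  intro y
  have h := actMap_comp_inv hπ g (g • p)
  rw [inv_smul_smul] at h
  exact ⟨_, congrArg (fun F : E' →L[ℝ] E' => F y) h⟩

lemma projMap_surjective : Function.Surjective (projMap E K E') :=
  surjective_tderiv_of_submersion (hπ.isSubmersionOfComplement_complement 1)

/-- Equivariance of the projection. -/
lemma tderiv_mk_comp_tderiv_mul (g x : G) :
    (tderiv E E' (QuotientGroup.mk : G → G ⧸ K) (g * x)).comp (tderiv E E (fun y => g * y) x) =
      (actMap E' g (x : G ⧸ K)).comp (tderiv E E' (QuotientGroup.mk : G → G ⧸ K) x) := by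
  rw [actMap, ← tderiv_comp (f := fun y => g * y) (p := x) (mdifferentiableAt_mk hπ _)
      (mdifferentiableAt_leftMul _ _),
    ← tderiv_comp (f := (QuotientGroup.mk : G → G ⧸ K)) (p := x) (mdifferentiableAt_smul hπ g _)
      (mdifferentiableAt_mk hπ _)]
  rfl

lemma tderiv_mk_comp_leftMap (g : G) :
    (tderiv E E' (QuotientGroup.mk : G → G ⧸ K) g).comp (leftMap E g) =
      (actMap E' g ((1 : G) : G ⧸ K)).comp (projMap E K E') := by
  have h := tderiv_mk_comp_tderiv_mul hπ g 1
  rw [mul_one] at h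
  exact h

/-- The Maurer-Cartan form of a map into the group, projected to the homogeneous space. -/
lemma projMap_comp_maurerCartan {F : Type*} [NormedAddCommGroup F] [NormedSpace ℝ F] {σ : F → G}
    {z : F} (hσ : MDifferentiableAt 𝓘(ℝ, F) 𝓘(ℝ, E) σ z) :
    (projMap E K E').comp (maurerCartan E σ z) =
      (actMap E' (σ z)⁻¹ (σ z : G ⧸ K)).comp (tderiv F E' (fun z' => (σ z' : G ⧸ K)) z) := by
  have h1 := tderiv_mk_comp_tderiv_mul hπ (σ z)⁻¹ (σ z)
  have h2 := tderiv_comp (f := σ) (g := fun x => (σ z)⁻¹ * x)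
    (mdifferentiableAt_leftMul (E := E) (σ z)⁻¹ (σ z)) hσ
  have h3 := tderiv_comp (f := σ) (mdifferentiableAt_mk hπ (σ z)) hσ
  have h2' : maurerCartan E σ z = _ := h2
  rw [inv_mul_cancel] at h1
  rw [h2', projMap, ← ContinuousLinearMap.comp_assoc, h1, ContinuousLinearMap.comp_assoc, ← h3]
  rfl

/-- The Lie algebra of the isotropy group is the kernel of the derivative of the projection. -/
lemma subgroupLieAlgebra_eq [CompleteSpace E] [T2Space G] :
    subgroupLieAlgebra E K = {X : E | projMap E K E' X = 0} := by
  have : IsManifold 𝓘(ℝ, E) 1 G := IsManifold.of_le (n := ∞) (by simp)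
  ext X
  constructor
  · rintro ⟨γ, hγ, hγ0, hK⟩
    have h1 : tderiv ℝ E' (fun t => (γ t : G ⧸ K)) 0 = 0 := by
      rw [← tderiv_const (0 : ℝ) ((1 : G) : G ⧸ K)]
      refine tderiv_congr (Filter.Eventually.of_forall fun t => ?_)
      rw [eq_comm, QuotientGroup.eq]
      simpa using hK t
    have h2 := tderiv_comp (f := γ) (mdifferentiableAt_mk hπ (γ 0)) (hγ 0).mdifferentiableAt
    have h3 : tderiv ℝ E γ 0 = (1 : ℝ →L[ℝ] ℝ).smulRight (leftMap E (γ 0) X) := (hγ 0).mfderiv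
    rw [h3] at h2
    have h4 := h2.symm.trans h1
    have h5 := congrArg (fun F : ℝ →L[ℝ] E' => F 1) h4
    simp only [ContinuousLinearMap.comp_apply, ContinuousLinearMap.smulRight_apply,
      one_apply_eq_self, one_smul, zero_apply] at h5
    have h6 := congrArg (fun F : E →L[ℝ] E' => F X) (tderiv_mk_comp_leftMap hπ (γ 0))
    have h7 := h6.symm.trans h5
    rw [hγ0, actMap_one] at h7
    exact h7
  · intro hX
    have hv := contMDiff_mulInvariantVectorField_infty (E := E) (G := G) X
    have hv1 := hv.of_le (m := 1) (by simp)
    obtain ⟨γ, hγ0, hγ⟩ := exists_isMIntegralCurveAt_of_contMDiffAt_boundaryless 0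
      (hv1.contMDiffAt (x := (1 : G)))
    obtain ⟨ε, hε, hγ⟩ := isMIntegralCurveAt_iff'.1 hγ
    rw [Real.ball_eq_Ioo, zero_sub, zero_add] at hγ
    -- Left translates of one integral curve are integral curves, so a single existence time `ε`
    -- serves every starting point. This uniformity makes the field complete.
    have key : ∀ x : G, ∃ γ : ℝ → G, γ 0 = x ∧
        IsMIntegralCurveOn γ (mulInvariantVectorField (I := 𝓘(ℝ, E)) X) (Set.Ioo (-ε) ε) := by
      intro x
      refine ⟨fun t => x * γ t, by simp [hγ0], fun t ht => ?_⟩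
      have h1 := (mdifferentiableAt_leftMul (E := E) x (γ t)).hasMFDerivAt.comp_hasMFDerivWithinAt t
        (hγ t ht)
      refine h1.congr_mfderiv ?_
      have h2 := tderiv_comp (f := fun y => γ t * y) (p := 1)
        (mdifferentiableAt_leftMul (E := E) x (γ t * 1)) (mdifferentiableAt_leftMul _ _)
      rw [mul_one] at h2
      have h3 : leftMap E (x * γ t) =
          (tderiv E E (fun y => x * y) (γ t)).comp (leftMap E (γ t)) := by
        refine Eq.trans ?_ h2
        exact tderiv_congr (Filter.Eventually.of_forall fun y => mul_assoc _ _ _)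
      have h4 : leftMap E (x * γ t) X = tderiv E E (fun y => x * y) (γ t) (leftMap E (γ t) X) :=
        congrArg (fun F : E →L[ℝ] E => F X) h3
      apply ContinuousLinearMap.ext
      intro (r : ℝ)
      have h5 : tderiv E E (fun y => x * y) (γ t) (r • leftMap E (γ t) X) =
          r • leftMap E (x * γ t) X := by rw [map_smul, h4]
      exact h5
    obtain ⟨γ, hγ0, hγ⟩ := exists_isMIntegralCurve_of_isMIntegralCurveOn hv1 hε key 1
    refine ⟨γ, hγ, hγ0, fun t => ?_⟩
    -- By equivariance the projected curve has velocity equal to a translate of `dπ X = 0`, hence it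
    -- is constant and the curve stays in `K`.
    have h1 : ((γ 0 : G) : G ⧸ K) = γ t := by
      refine eq_of_tderiv_eq_zero (E := E') (γ := fun t => (γ t : G ⧸ K))
        (fun t => (mdifferentiableAt_mk hπ (γ t)).comp t (hγ t).mdifferentiableAt)
        (fun t => ?_) 0 t
      have h2 := tderiv_comp (f := γ) (mdifferentiableAt_mk hπ (γ t)) (hγ t).mdifferentiableAt
      have h3 : tderiv ℝ E γ t = (1 : ℝ →L[ℝ] ℝ).smulRight (leftMap E (γ t) X) := (hγ t).mfderiv
      rw [h3] at h2
      refine Eq.trans h2 ?_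
      have h6 : tderiv E E' (QuotientGroup.mk : G → G ⧸ K) (γ t) (leftMap E (γ t) X) = 0 :=
        (congrArg (fun F : E →L[ℝ] E' => F X) (tderiv_mk_comp_leftMap hπ (γ t))).trans
          ((congrArg (actMap E' (γ t) ((1 : G) : G ⧸ K)) hX).trans (map_zero _))
      refine ContinuousLinearMap.ext fun (r : ℝ) => ?_
      exact (map_smul (tderiv E E' (QuotientGroup.mk : G → G ⧸ K) (γ t)) r
        (leftMap E (γ t) X)).trans ((congrArg (r • ·) h6).trans (smul_zero r))
    rw [hγ0, QuotientGroup.eq] at h1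
    simpa using h1

lemma complexSubgroupLieAlgebra_eq [CompleteSpace E] [T2Space G] :
    complexSubgroupLieAlgebra E K = LinearMap.ker (complexMap (projMap E K E')) := by
  rw [ker_complexMap, ← subgroupLieAlgebra_eq hπ]
  rfl

end Homogeneous

/-! ### The adjoint action and its derivative along a curve. -/

section Conjugation

variable {E : Type*} [NormedAddCommGroup E] [NormedSpace ℝ E]
  {G : Type*} [TopologicalSpace G] [ChartedSpace E G] [Group G] [LieGroup 𝓘(ℝ, E) ∞ G]

variable (E) in
/-- The adjoint action of `k⁻¹`. -/
def conjMap (k : G) : E →L[ℝ] E := tderiv E E (fun x : G => k⁻¹ * x * k) 1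

lemma contMDiff_conj (k : G) : ContMDiff 𝓘(ℝ, E) 𝓘(ℝ, E) ∞ (fun x : G => k⁻¹ * x * k) :=
  (contMDiff_mul_right (I := 𝓘(ℝ, E)) (n := ∞)).comp contMDiff_mul_left

/-- The order reverses because `conjMap E k` is `Ad(k⁻¹)`. -/
lemma conjMap_mul (k l : G) : conjMap E (k * l) = (conjMap E l).comp (conjMap E k) := by
  have h := tderiv_comp (f := fun x : G => k⁻¹ * x * k) (g := fun x : G => l⁻¹ * x * l) (p := 1)
    (contMDiff_conj (E := E) l).contMDiffAt.mdiff (contMDiff_conj (E := E) k).contMDiffAt.mdiff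
  rw [mul_one, inv_mul_cancel] at h
  refine Eq.trans ?_ h
  refine tderiv_congr (Filter.Eventually.of_forall fun x => ?_)
  simp [mul_assoc]

lemma conjMap_one : conjMap E (1 : G) = ContinuousLinearMap.id ℝ E := by
  rw [← tderiv_id (1 : G)]
  refine tderiv_congr (Filter.Eventually.of_forall fun x => ?_)
  simp

lemma conjMap_comp_inv (k : G) :
    (conjMap E k).comp (conjMap E k⁻¹) = ContinuousLinearMap.id ℝ E := by
  rw [← conjMap_mul, inv_mul_cancel, conjMap_one]

lemma conjMap_inv_comp (k : G) :
    (conjMap E k⁻¹).comp (conjMap E k) = ContinuousLinearMap.id ℝ E := by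
  rw [← conjMap_mul, mul_inv_cancel, conjMap_one]

section ComplexBracket

variable [CompleteSpace E]

variable (G) in
/-- The bracket of the complexified Lie algebra, on the complexified model space. -/
def complexBracket (v w : ℂ ⊗[ℝ] E) : ℂ ⊗[ℝ] E :=
  Bracket.bracket (L := ComplexLieAlgebra E G) (M := ComplexLieAlgebra E G) v w

lemma complexBracket_skew (v w : ℂ ⊗[ℝ] E) : -complexBracket G w v = complexBracket G v w :=
  lie_skew (L := ComplexLieAlgebra E G) v w

lemma complexBracket_tmul (c d : ℂ) (v w : E) :
    complexBracket G (c ⊗ₜ[ℝ] v) (d ⊗ₜ[ℝ] w) = (c * d) ⊗ₜ[ℝ] groupBracket E G v w :=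
  LieAlgebra.ExtendScalars.bracket_tmul ℝ ℂ (GroupLieAlgebra 𝓘(ℝ, E) G)
    (GroupLieAlgebra 𝓘(ℝ, E) G) c d v w

lemma complexBracket_zero_left (w : ℂ ⊗[ℝ] E) : complexBracket G 0 w = 0 :=
  zero_lie (L := ComplexLieAlgebra E G) (M := ComplexLieAlgebra E G) w

lemma complexBracket_add_left (v v' w : ℂ ⊗[ℝ] E) :
    complexBracket G (v + v') w = complexBracket G v w + complexBracket G v' w :=
  add_lie (L := ComplexLieAlgebra E G) (M := ComplexLieAlgebra E G) v v' w

end ComplexBracket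

variable [FiniteDimensional ℝ E]

variable (G) in
/-- The map `v ↦ [v, X]`. -/
def adRight (X : E) : E →L[ℝ] E :=
  LinearMap.toContinuousLinearMap
    { toFun := fun v => groupBracket E G v X
      map_add' := fun v w => add_lie (L := GroupLieAlgebra 𝓘(ℝ, E) G)
        (M := GroupLieAlgebra 𝓘(ℝ, E) G) v w X
      map_smul' := fun r v => smul_lie (L := GroupLieAlgebra 𝓘(ℝ, E) G)
        (M := GroupLieAlgebra 𝓘(ℝ, E) G) r v X }

lemma complexMap_adRight (X : E) (v : ℂ ⊗[ℝ] E) :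
    complexMap (adRight G X) v = complexBracket G v ((1 : ℂ) ⊗ₜ[ℝ] X) := by
  induction v using TensorProduct.induction_on with
  | zero => rw [map_zero, complexBracket_zero_left]
  | tmul c v =>
    rw [complexBracket_tmul, mul_one]
    rfl
  | add v w hv hw => rw [map_add, hv, hw, complexBracket_add_left]

/-- The derivative of the adjoint action along a curve in the group. -/
lemma hasDerivAt_conjMap {k : ℝ → G} {s : Set ℝ} (hs : IsOpen s)
    (hk : ContMDiffOn 𝓘(ℝ, ℝ) 𝓘(ℝ, E) ∞ k s) {t : ℝ} (ht : t ∈ s) :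
    HasDerivAt (fun t => conjMap E (k t))
      ((adRight G (maurerCartan E k t 1)).comp (conjMap E (k t))) t := by
  let φ := extChartAt 𝓘(ℝ, E) (1 : G)
  have h1s : (1 : G) ∈ (chartAt E (1 : G)).source := mem_chart_source E 1
  set y₀ : E := φ 1 with hy₀
  have hy1 : φ.symm y₀ = 1 := chart_symm_chart h1s
  have hy₀t : y₀ ∈ φ.target := chart_mem_target h1s
  -- The derivative of `Ad(k⁻¹)` is read off the Maurer-Cartan equation of this two-variable map.
  -- Its form is `Ad(k(t)⁻¹)` in the first variable at `y₀`, and the form of `k` in the second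
  -- variable.
  let σ : E × ℝ → G := fun z => φ.symm z.1 * k z.2
  have hU : IsOpen (φ.target ×ˢ s) := (isOpen_extChartAt_target (1 : G)).prod hs
  have hσ : ContMDiffOn 𝓘(ℝ, E × ℝ) 𝓘(ℝ, E) ∞ σ (φ.target ×ˢ s) := by
    refine ContMDiffOn.mul (I := 𝓘(ℝ, E)) (n := ∞) ?_ ?_
    · exact (contMDiffOn_extChartAt_symm (I := 𝓘(ℝ, E)) (1 : G)).comp
        contDiff_fst.contMDiff.contMDiffOn fun z hz => hz.1
    · exact hk.comp contDiff_snd.contMDiff.contMDiffOn fun z hz => hz.2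
  have hmd : ∀ z ∈ φ.target ×ˢ s, MDifferentiableAt 𝓘(ℝ, E × ℝ) 𝓘(ℝ, E)
      (fun z' => (σ z)⁻¹ * σ z') z := fun z hz =>
    (mdifferentiableAt_leftMul _ _).comp z (hσ.contMDiffAt (hU.mem_nhds hz)).mdiff
  have hsnd : ∀ a ∈ φ.target, ∀ b ∈ s, ∀ r : ℝ,
      maurerCartan E σ (a, b) (0, r) = maurerCartan E k b r := by
    intro a ha b hb r
    have hd : HasFDerivAt (fun b' : ℝ => (a, b')) (ContinuousLinearMap.inr ℝ E ℝ) b :=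
      hasFDerivAt_prodMk_right a b
    have h1 := tderiv_comp (f := fun b' : ℝ => (a, b')) (p := b) (hmd (a, b) ⟨ha, hb⟩)
      hd.differentiableAt.mdifferentiableAt
    rw [tderiv_eq_fderiv, hd.fderiv] at h1
    refine Eq.trans (congrArg (fun T : ℝ →L[ℝ] E => T r) h1).symm ?_
    refine congrArg (fun T : ℝ →L[ℝ] E => T r) ?_
    refine tderiv_congr (Filter.Eventually.of_forall fun b' => ?_)
    simp [σ, mul_assoc]
  have hfst : ∀ b ∈ s, ∀ u : E, maurerCartan E σ (y₀, b) (u, 0) = conjMap E (k b) u := by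
    intro b hb u
    have hd : HasFDerivAt (fun a : E => (a, b)) (ContinuousLinearMap.inl ℝ E ℝ) y₀ :=
      hasFDerivAt_prodMk_left y₀ b
    have h1 := tderiv_comp (f := fun a : E => (a, b)) (p := y₀) (hmd (y₀, b) ⟨hy₀t, hb⟩)
      hd.differentiableAt.mdifferentiableAt
    rw [tderiv_eq_fderiv, hd.fderiv] at h1
    have h2 := tderiv_comp (f := φ.symm) (g := fun x : G => (k b)⁻¹ * x * k b) (p := y₀)
      (contMDiff_conj (E := E) (k b)).contMDiffAt.mdiff (contMDiffAt_chart_symm hy₀t).mdiff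
    have h3 : tderiv E E φ.symm y₀ = ContinuousLinearMap.id ℝ E := tderiv_chart_symm_self (1 : G)
    rw [h3, hy1, ContinuousLinearMap.comp_id] at h2
    refine Eq.trans (congrArg (fun T : E →L[ℝ] E => T u) h1).symm ?_
    refine Eq.trans ?_ (congrArg (fun T : E →L[ℝ] E => T u) h2)
    refine congrArg (fun T : E →L[ℝ] E => T u) ?_
    refine tderiv_congr (Filter.Eventually.of_forall fun a => ?_)
    simp [σ, hy1, mul_assoc]
  have hΘ := ((contDiffAt_maurerCartan hU hσ (z₀ := (y₀, t)) ⟨hy₀t, ht⟩).differentiableAt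
    (by simp)).hasFDerivAt
  set Θ' := fderiv ℝ (maurerCartan E σ) (y₀, t) with hΘ'
  have hA : HasFDerivAt (fun b : ℝ => (maurerCartan E σ (y₀, b)).comp
      (ContinuousLinearMap.inl ℝ E ℝ)) (((ContinuousLinearMap.compL ℝ E (E × ℝ) E).flip
        (ContinuousLinearMap.inl ℝ E ℝ)).comp (Θ'.comp (ContinuousLinearMap.inr ℝ E ℝ))) t :=
    ((ContinuousLinearMap.compL ℝ E (E × ℝ) E).flip
        (ContinuousLinearMap.inl ℝ E ℝ)).hasFDerivAt.comp t
      (hΘ.comp t (hasFDerivAt_prodMk_right y₀ t))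
  have hev : (fun b => conjMap E (k b)) =ᶠ[𝓝 t] fun b : ℝ =>
      (maurerCartan E σ (y₀, b)).comp (ContinuousLinearMap.inl ℝ E ℝ) := by
    filter_upwards [hs.mem_nhds ht] with b hb
    ext u
    exact (hfst b hb u).symm
  have hA2 := hA.congr_of_eventuallyEq hev
  refine hA2.hasDerivAt.congr_deriv ?_
  ext u
  -- The factor `φ.symm a` cancels in `σ(a, b)⁻¹ σ(a, b')`, so the second component of the form does
  -- not depend on `a`. One of the two terms of the Maurer-Cartan equation therefore drops out.
  have hconst : Θ' (u, 0) (0, 1) = 0 := by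
    have h1 : HasFDerivAt (fun a : E => maurerCartan E σ (a, t) (0, 1))
        ((ContinuousLinearMap.apply ℝ E ((0 : E), (1 : ℝ))).comp
          (Θ'.comp (ContinuousLinearMap.inl ℝ E ℝ))) y₀ :=
      by
      have h0 : HasFDerivAt (fun a : E => maurerCartan E σ (a, t))
          (Θ'.comp (ContinuousLinearMap.inl ℝ E ℝ)) y₀ :=
        HasFDerivAt.comp (f := fun a : E => (a, t)) y₀ hΘ (hasFDerivAt_prodMk_left y₀ t)
      exact (ContinuousLinearMap.apply ℝ E ((0 : E), (1 : ℝ))).hasFDerivAt.comp y₀ h0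
    have h2 : HasFDerivAt (fun a : E => maurerCartan E σ (a, t) (0, 1)) (0 : E →L[ℝ] E) y₀ := by
      refine (hasFDerivAt_const (maurerCartan E k t 1) y₀).congr_of_eventuallyEq ?_
      filter_upwards [(isOpen_extChartAt_target (I := 𝓘(ℝ, E)) (1 : G)).mem_nhds hy₀t] with a ha
      exact hsnd a ha t ht 1
    have h3 := congrArg (fun T : E →L[ℝ] E => T u) (h1.unique h2)
    exact h3
  have hmc := maurerCartan_equation hU hσ (z₀ := (y₀, t)) ⟨hy₀t, ht⟩ (u, 0) (0, 1)
  rw [← hΘ', hconst, zero_sub, neg_inj, hsnd y₀ hy₀t t ht, hfst t ht] at hmc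
  exact hmc

/-- Applying the previous derivative to the inverse curve is used only for differentiability; the
value follows by differentiating `conjMap E k ∘ conjMap E k⁻¹ = id`. -/
lemma hasDerivAt_conjMap_inv {k : ℝ → G} {s : Set ℝ} (hs : IsOpen s)
    (hk : ContMDiffOn 𝓘(ℝ, ℝ) 𝓘(ℝ, E) ∞ k s) {t : ℝ} (ht : t ∈ s) :
    HasDerivAt (fun t => conjMap E (k t)⁻¹)
      (-(conjMap E (k t)⁻¹).comp (adRight G (maurerCartan E k t 1))) t := by
  have hA := hasDerivAt_conjMap hs hk ht
  have hB := (hasDerivAt_conjMap hs (hk.inv (n := ∞)) ht).differentiableAt.hasDerivAt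
  have hB' : HasDerivAt (fun t => conjMap E (k t)⁻¹) _ t := hB
  have hAB := hA.clm_comp hB'
  have h1 : (fun t => (conjMap E (k t)).comp (conjMap E (k t)⁻¹)) =
      fun _ => ContinuousLinearMap.id ℝ E := funext fun t => conjMap_comp_inv (k t)
  rw [h1] at hAB
  have h2 := hAB.unique (hasDerivAt_const t _)
  rw [ContinuousLinearMap.comp_assoc, conjMap_comp_inv, ContinuousLinearMap.comp_id] at h2
  have h3 := congrArg (fun T => (conjMap E (k t)⁻¹).comp T) h2
  simp only [ContinuousLinearMap.comp_add, ContinuousLinearMap.comp_zero] at h3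
  rw [← ContinuousLinearMap.comp_assoc, conjMap_inv_comp, ContinuousLinearMap.id_comp] at h3
  refine hB'.congr_deriv ?_
  rw [eq_neg_iff_add_eq_zero, add_comm]
  exact h3

end Conjugation

/-- A solution of a homogeneous linear differential equation that vanishes initially vanishes. -/
lemma eq_zero_of_linear_ode {ι : Type*} [Fintype ι] {f : ℝ → ι → ℂ} {C : ℝ → ι → ι → ℂ}
    (hf : ∀ t ∈ Set.Icc (0 : ℝ) 1, ∀ j, HasDerivAt (fun t => f t j) (∑ i, C t j i * f t i) t)
    (hC : ∀ j i, ContinuousOn (fun t => C t j i) (Set.Icc 0 1)) (h₀ : f 0 = 0) :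
    ∀ t ∈ Set.Icc (0 : ℝ) 1, f t = 0 := by
  -- Compactness bounds the coefficients by a constant `B`, giving `‖f'‖ ≤ B ‖f‖`, which is the
  -- hypothesis of a Grönwall argument.
  have hcont : ContinuousOn (fun t => ∑ j, ∑ i, ‖C t j i‖) (Set.Icc 0 1) :=
    continuousOn_finsetSum _ fun j _ => continuousOn_finsetSum _ fun i _ => (hC j i).norm
  obtain ⟨B, hB⟩ := isCompact_Icc.exists_bound_of_continuousOn hcont
  have hd : ∀ t ∈ Set.Icc (0 : ℝ) 1, HasDerivAt f (fun j => ∑ i, C t j i * f t i) t :=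
    fun t ht => hasDerivAt_pi.2 (hf t ht)
  refine eq_zero_of_abs_deriv_le_mul_abs_self_of_eq_zero_right (K := B)
    (fun t ht => (hd t ht).continuousAt.continuousWithinAt)
    (fun t ht => (hd t (Set.Ico_subset_Icc_self ht)).hasDerivWithinAt) h₀ fun t ht => ?_
  have hBt := hB t (Set.Ico_subset_Icc_self ht)
  have hpos : 0 ≤ ∑ j, ∑ i, ‖C t j i‖ :=
    Finset.sum_nonneg fun j _ => Finset.sum_nonneg fun i _ => norm_nonneg _
  rw [Real.norm_of_nonneg hpos] at hBt
  have hle : ‖fun j => ∑ i, C t j i * f t i‖ ≤ (∑ j, ∑ i, ‖C t j i‖) * ‖f t‖ := by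
    refine (pi_norm_le_iff_of_nonneg (mul_nonneg hpos (norm_nonneg _))).2 fun j => ?_
    calc ‖∑ i, C t j i * f t i‖ ≤ ∑ i, ‖C t j i‖ * ‖f t‖ :=
          norm_sum_le_of_le _ fun i _ => by
            rw [norm_mul]
            exact mul_le_mul_of_nonneg_left (norm_le_pi_norm _ i) (norm_nonneg _)
      _ = (∑ i, ‖C t j i‖) * ‖f t‖ := (Finset.sum_mul _ _ _).symm
      _ ≤ (∑ j, ∑ i, ‖C t j i‖) * ‖f t‖ :=
          mul_le_mul_of_nonneg_right
            (Finset.single_le_sum (f := fun j => ∑ i, ‖C t j i‖)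
              (fun j _ => Finset.sum_nonneg fun i _ => norm_nonneg _) (Finset.mem_univ j))
            (norm_nonneg _)
  exact hle.trans (mul_le_mul_of_nonneg_right hBt (norm_nonneg _))

/-- For fixed `μ` and `x`, evaluation of the complexified operator is real linear on a
finite-dimensional space of operators, hence continuous, and the chain rule applies. -/
lemma hasFDerivAt_dual_complexMap {V V' F : Type*} [NormedAddCommGroup V] [NormedSpace ℝ V]
    [FiniteDimensional ℝ V] [NormedAddCommGroup V'] [NormedSpace ℝ V'] [FiniteDimensional ℝ V']
    [NormedAddCommGroup F] [NormedSpace ℝ F] {T : F → V →L[ℝ] V'} {T' : F →L[ℝ] V →L[ℝ] V'} {z : F}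
    (hT : HasFDerivAt T T' z) (μ : Module.Dual ℂ (ℂ ⊗[ℝ] V')) (x : ℂ ⊗[ℝ] V) :
    ∃ A : F →L[ℝ] ℂ, (∀ u, A u = μ (complexMap (T' u) x)) ∧
      HasFDerivAt (fun z => μ (complexMap (T z) x)) A z := by
  let ev : (V →L[ℝ] V') →ₗ[ℝ] ℂ :=
    { toFun := fun T => μ (complexMap T x)
      map_add' := fun S T => by
        simp [complexMap, LinearMap.baseChange_add]
      map_smul' := fun r T => by
        simp [complexMap, LinearMap.baseChange_smul] }
  exact ⟨ev.toContinuousLinearMap.comp T', fun u => rfl,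
    ev.toContinuousLinearMap.hasFDerivAt.comp z hT⟩

lemma hasDerivAt_dual_complexMap {V V' : Type*} [NormedAddCommGroup V] [NormedSpace ℝ V]
    [FiniteDimensional ℝ V] [NormedAddCommGroup V'] [NormedSpace ℝ V'] [FiniteDimensional ℝ V']
    {T : ℝ → V →L[ℝ] V'} {T' : V →L[ℝ] V'} {t : ℝ} (hT : HasDerivAt T T' t)
    (μ : Module.Dual ℂ (ℂ ⊗[ℝ] V')) (x : ℂ ⊗[ℝ] V) :
    HasDerivAt (fun t => μ (complexMap (T t) x)) (μ (complexMap T' x)) t := by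
  obtain ⟨A, hA, h⟩ := hasFDerivAt_dual_complexMap hT.hasFDerivAt μ x
  refine h.hasDerivAt.congr_deriv ?_
  rw [hA]
  simp

/-! ### Invariance under the isotropy group versus stability under its Lie algebra. -/

section Isotropy

variable {E : Type*} [NormedAddCommGroup E] [NormedSpace ℝ E]
  {G : Type*} [TopologicalSpace G] [ChartedSpace E G] [Group G] [LieGroup 𝓘(ℝ, E) ∞ G]

variable (G) in
/-- The bracket on the complexification of `𝔤^* ⋊ 𝔤`, on the model space. -/
def lieGenBracket [CompleteSpace E] (a b : GenSpace (ℂ ⊗[ℝ] E)) : GenSpace (ℂ ⊗[ℝ] E) :=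
  genBracket (𝔩 := ComplexLieAlgebra E G) a b

variable (G) in
/-- The trilinear form `⟨[a, b], c⟩` on the complexification of `𝔤^* ⋊ 𝔤`. -/
def lieForm [CompleteSpace E] (a b c : GenSpace (ℂ ⊗[ℝ] E)) : ℂ :=
  bracketForm (𝔩 := ComplexLieAlgebra E G) a b c

/-- The coadjoint action of `k⁻¹` on the complexification of `𝔤 ⊕ 𝔤^*`. -/
def conjGen (k : G) (a : GenSpace (ℂ ⊗[ℝ] E)) : GenSpace (ℂ ⊗[ℝ] E) :=
  (complexMap (conjMap E k) a.1, a.2 ∘ₗ complexMap (conjMap E k⁻¹))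

lemma conjGen_one (a : GenSpace (ℂ ⊗[ℝ] E)) : conjGen (1 : G) a = a := by
  rw [conjGen, inv_one, conjMap_one, complexMap_id]
  rfl

lemma conjGen_mul (k l : G) (a : GenSpace (ℂ ⊗[ℝ] E)) :
    conjGen (k * l) a = conjGen l (conjGen k a) := by
  rw [conjGen, mul_inv_rev, conjMap_mul, conjMap_mul, complexMap_comp, complexMap_comp]
  rfl

lemma genPairing_conjGen_inv (k : G) (a b : GenSpace (ℂ ⊗[ℝ] E)) :
    genPairing (conjGen k⁻¹ a) b = genPairing a (conjGen k b) := by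
  simp only [genPairing, conjGen, inv_inv, LinearMap.comp_apply]

variable [CompleteSpace E]

lemma lieForm_apply (a b c : GenSpace (ℂ ⊗[ℝ] E)) :
    lieForm G a b c = c.2 (complexBracket G a.1 b.1) + a.2 (complexBracket G b.1 c.1) +
      b.2 (complexBracket G c.1 a.1) := rfl

lemma genPairing_lieGenBracket (a b c : GenSpace (ℂ ⊗[ℝ] E)) :
    genPairing (lieGenBracket G a b) c = lieForm G a b c :=
  genPairing_genBracket (𝔩 := ComplexLieAlgebra E G) a b c

lemma lieGenBracket_add_left (X Y : ℂ ⊗[ℝ] E) (b : GenSpace (ℂ ⊗[ℝ] E)) :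
    lieGenBracket G (X, 0) b + lieGenBracket G (Y, 0) b = lieGenBracket G (X + Y, 0) b :=
  genBracket_add_left (𝔩 := ComplexLieAlgebra E G) X Y b

lemma lieGenBracket_smul_left (r : ℝ) (X : ℂ ⊗[ℝ] E) (b : GenSpace (ℂ ⊗[ℝ] E)) :
    (r : ℂ) • lieGenBracket G (X, 0) b = lieGenBracket G (r • X, 0) b :=
  genBracket_smul_left (𝔩 := ComplexLieAlgebra E G) (r : ℂ) X b

lemma lieForm_add_left (a a' b c : GenSpace (ℂ ⊗[ℝ] E)) :
    lieForm G (a + a') b c = lieForm G a b c + lieForm G a' b c :=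
  bracketForm_add_left (𝔩 := ComplexLieAlgebra E G) a a' b c

lemma lieForm_add_middle (a b b' c : GenSpace (ℂ ⊗[ℝ] E)) :
    lieForm G a (b + b') c = lieForm G a b c + lieForm G a b' c :=
  bracketForm_add_middle (𝔩 := ComplexLieAlgebra E G) a b b' c

lemma lieForm_add_right (a b c c' : GenSpace (ℂ ⊗[ℝ] E)) :
    lieForm G a b (c + c') = lieForm G a b c + lieForm G a b c' :=
  bracketForm_add_right (𝔩 := ComplexLieAlgebra E G) a b c c'

lemma lieForm_smul_left (r : ℂ) (a b c : GenSpace (ℂ ⊗[ℝ] E)) :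
    lieForm G (r • a) b c = r * lieForm G a b c :=
  bracketForm_smul_left (𝔩 := ComplexLieAlgebra E G) r a b c

lemma lieForm_smul_middle (r : ℂ) (a b c : GenSpace (ℂ ⊗[ℝ] E)) :
    lieForm G a (r • b) c = r * lieForm G a b c :=
  bracketForm_smul_middle (𝔩 := ComplexLieAlgebra E G) r a b c

lemma lieForm_smul_right (r : ℂ) (a b c : GenSpace (ℂ ⊗[ℝ] E)) :
    lieForm G a b (r • c) = r * lieForm G a b c :=
  bracketForm_smul_right (𝔩 := ComplexLieAlgebra E G) r a b c

lemma lieForm_cyclic (a b c : GenSpace (ℂ ⊗[ℝ] E)) : lieForm G a b c = lieForm G b c a :=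
  bracketForm_cyclic (𝔩 := ComplexLieAlgebra E G) a b c

variable [FiniteDimensional ℝ E]

lemma lieForm_tmul_left (X : E) (b c : GenSpace (ℂ ⊗[ℝ] E)) :
    lieForm G ((1 : ℂ) ⊗ₜ[ℝ] X, 0) b c =
      b.2 (complexMap (adRight G X) c.1) - c.2 (complexMap (adRight G X) b.1) := by
  rw [complexMap_adRight, complexMap_adRight, ← complexBracket_skew b.1, map_neg, sub_neg_eq_add]
  rw [lieForm_apply]
  simp only [LinearMap.zero_apply, add_zero]
  exact add_comm _ _

/-- This links group and algebra: moving `a` by the coadjoint action changes its pairings at the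
rate given by the trilinear form with `k⁻¹ k'` inserted. -/
lemma hasDerivAt_genPairing_conjGen {k : ℝ → G} {s : Set ℝ} (hs : IsOpen s)
    (hk : ContMDiffOn 𝓘(ℝ, ℝ) 𝓘(ℝ, E) ∞ k s) {t : ℝ} (ht : t ∈ s) (a b : GenSpace (ℂ ⊗[ℝ] E)) :
    HasDerivAt (fun t => genPairing (conjGen (k t) a) b)
      (lieForm G ((1 : ℂ) ⊗ₜ[ℝ] maurerCartan E k t 1, 0) b (conjGen (k t) a)) t := by
  have h1 := hasDerivAt_dual_complexMap (hasDerivAt_conjMap hs hk ht) b.2 a.1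
  have h2 := hasDerivAt_dual_complexMap (hasDerivAt_conjMap_inv hs hk ht) a.2 b.1
  refine (h1.add h2).congr_deriv ?_
  rw [lieForm_tmul_left, complexMap_comp, sub_eq_add_neg, ← map_neg]
  simp only [conjGen, LinearMap.comp_apply, map_neg]
  congr 1
  rw [← map_neg, ← LinearMap.comp_apply (complexMap (conjMap E (k t)⁻¹)), ← complexMap_comp]
  simp [complexMap, LinearMap.baseChange_neg]

variable {K : Subgroup G}
  {E' : Type*} [NormedAddCommGroup E'] [NormedSpace ℝ E'] [ChartedSpace E' (G ⧸ K)]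
  [IsManifold 𝓘(ℝ, E') ∞ (G ⧸ K)]
  (hπ : Manifold.IsSubmersion 𝓘(ℝ, E) 𝓘(ℝ, E') ∞ (QuotientGroup.mk : G → G ⧸ K))

include hπ

/-- The Maurer-Cartan form of a curve in the isotropy group takes values in its Lie algebra. -/
lemma projMap_maurerCartan_curve {k : ℝ → G} {s : Set ℝ} (hs : IsOpen s)
    (hk : ContMDiffOn 𝓘(ℝ, ℝ) 𝓘(ℝ, E) ∞ k s) (hK : ∀ t ∈ s, k t ∈ K) {t : ℝ} (ht : t ∈ s) :
    projMap E K E' (maurerCartan E k t 1) = 0 := by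
  have h1 := projMap_comp_maurerCartan hπ (hk.contMDiffAt (hs.mem_nhds ht)).mdiff
  have h2 : tderiv ℝ E' (fun t => (k t : G ⧸ K)) t = 0 := by
    rw [← tderiv_const t ((1 : G) : G ⧸ K)]
    refine tderiv_congr ?_
    filter_upwards [hs.mem_nhds ht] with t ht
    rw [eq_comm, QuotientGroup.eq]
    simpa using hK t ht
  rw [h2, ContinuousLinearMap.comp_zero] at h1
  exact congrArg (fun T : ℝ →L[ℝ] E' => T 1) h1

/-- A line in the local slice through `1` gives a curve in `K` with velocity `X`. Along it the
pairing of the moved `b` with `a` is identically zero, and its derivative at `0` is the form. -/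
lemma lieForm_eq_zero_of_conjGen {L : Submodule ℂ (GenSpace (ℂ ⊗[ℝ] E))} (hL : IsIsotropic L)
    (hinv : ∀ k ∈ K, ∀ a ∈ L, conjGen k a ∈ L) {X : E} (hX : projMap E K E' X = 0)
    {a b : GenSpace (ℂ ⊗[ℝ] E)} (ha : a ∈ L) (hb : b ∈ L) :
    lieForm G ((1 : ℂ) ⊗ₜ[ℝ] X, 0) a b = 0 := by
  obtain ⟨V, c, v₀, hV, hv₀, hc, hc0, hcK, hcX, -⟩ :=
    exists_local_slice (hπ.isSubmersionOfComplement_complement 1)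
  obtain ⟨w, hw⟩ := hcX X hX
  let ℓ : ℝ → hπ.complement := fun t => v₀ + t • w
  have hℓ : ContDiff ℝ ∞ ℓ := contDiff_const.add (contDiff_id.smul contDiff_const)
  have hs : IsOpen (ℓ ⁻¹' V) := hV.preimage hℓ.continuous
  have h0 : ℓ 0 = v₀ := by simp [ℓ]
  have h0s : (0 : ℝ) ∈ ℓ ⁻¹' V := by rwa [Set.mem_preimage, h0]
  have hk : ContMDiffOn 𝓘(ℝ, ℝ) 𝓘(ℝ, E) ∞ (fun t => c (ℓ t)) (ℓ ⁻¹' V) :=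
    hc.comp hℓ.contMDiff.contMDiffOn fun t ht => ht
  have hkK : ∀ t ∈ ℓ ⁻¹' V, c (ℓ t) ∈ K := by
    intro t ht
    have := hcK (ℓ t) ht
    rw [eq_comm, QuotientGroup.eq] at this
    simpa using this
  have hd := hasDerivAt_genPairing_conjGen hs hk h0s b a
  have hz : HasDerivAt (fun t => genPairing (conjGen (c (ℓ t)) b) a) 0 0 := by
    refine (hasDerivAt_const (0 : ℝ) (0 : ℂ)).congr_of_eventuallyEq ?_
    filter_upwards [hs.mem_nhds h0s] with t ht
    exact hL _ (hinv _ (hkK t ht) b hb) _ ha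
  have hu := hd.unique hz
  have hmc : maurerCartan E (fun t => c (ℓ t)) 0 1 = X := by
    have h1 := tderiv_eq_leftMap_comp_maurerCartan (hk.contMDiffAt (hs.mem_nhds h0s)).mdiff
    have hd : HasDerivAt ℓ w 0 := by
      exact (((hasDerivAt_id (0 : ℝ)).smul_const w).const_add v₀).congr_deriv (one_smul ℝ w)
    have h2 := tderiv_comp (f := ℓ) (p := (0 : ℝ))
      (by rw [h0]; exact (hc.contMDiffAt (hV.mem_nhds hv₀)).mdiff)
      hd.differentiableAt.mdifferentiableAt
    have h3 : leftMap E (1 : G) = ContinuousLinearMap.id ℝ E := by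
      rw [← tderiv_id (1 : G)]
      exact tderiv_congr (Filter.Eventually.of_forall fun x => one_mul x)
    rw [h0, hc0, h3, ContinuousLinearMap.id_comp] at h1
    rw [tderiv_eq_fderiv, hd.hasFDerivAt.fderiv, h0] at h2
    have h4 := congrArg (fun T : ℝ →L[ℝ] E => T 1) (h1.symm.trans h2)
    simp only [ContinuousLinearMap.comp_apply] at h4
    rw [h4]
    simpa using hw
  rwa [hmc, h0, hc0, conjGen_one] at hu

/-- By stability, bracketing a basis of `L` with `k⁻¹ k' ∈ 𝔨` stays in `L`. The pairings of the
moved element with the basis thus solve a homogeneous linear system. They vanish at time `0`, hence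
at time `1`, and `L` is its own orthogonal. -/
lemma conjGen_mem_of_curve {L : Submodule ℂ (GenSpace (ℂ ⊗[ℝ] E))} (hL : IsMaxIsotropic L)
    (hstab : ∀ X : E, projMap E K E' X = 0 → ∀ a ∈ L, ∀ b ∈ L,
      lieForm G ((1 : ℂ) ⊗ₜ[ℝ] X, 0) a b = 0)
    {k : ℝ → G} {s : Set ℝ} (hs : IsOpen s) (hs01 : Set.Icc 0 1 ⊆ s)
    (hk : ContMDiffOn 𝓘(ℝ, ℝ) 𝓘(ℝ, E) ∞ k s) (hkK : ∀ t ∈ s, k t ∈ K) (hk0 : k 0 = 1)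
    {a : GenSpace (ℂ ⊗[ℝ] E)} (ha : a ∈ L) : conjGen (k 1) a ∈ L := by
  have hL' := isMaxIsotropic_iff.1 hL
  let B := Module.finBasis ℂ L
  -- A projection onto `L` makes the coefficients `C j i` linear on all of `E`, including `X`
  -- outside the isotropy algebra. Their continuity in `t` then follows from that of the
  -- Maurer-Cartan form.
  obtain ⟨p, hp⟩ := L.subtype.exists_leftInverse_of_injective L.ker_subtype
  have hp' : ∀ m (hm : m ∈ L), p m = ⟨m, hm⟩ := fun m hm =>
    congrArg (fun T : L →ₗ[ℂ] L => T ⟨m, hm⟩) hp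
  let C : ∀ _ _ : Fin (Module.finrank ℂ L), E →ₗ[ℝ] ℂ := fun j i =>
    { toFun := fun X => B.repr (p (lieGenBracket G ((1 : ℂ) ⊗ₜ[ℝ] X, 0) (B j))) i
      map_add' := fun X Y => by
        rw [TensorProduct.tmul_add, ← lieGenBracket_add_left, map_add, map_add, Finsupp.add_apply]
      map_smul' := fun r X => by
        rw [TensorProduct.tmul_smul, ← lieGenBracket_smul_left, map_smul, map_smul,
          Finsupp.smul_apply]
        rfl }
  let f : ℝ → Fin (Module.finrank ℂ L) → ℂ := fun t j => genPairing (conjGen (k t) a) (B j)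
  have hpair : ∀ X : E, projMap E K E' X = 0 → ∀ j c,
      lieForm G ((1 : ℂ) ⊗ₜ[ℝ] X, 0) (B j) c = ∑ i, C j i X * genPairing c (B i) := by
    intro X hX j c
    have hm : lieGenBracket G ((1 : ℂ) ⊗ₜ[ℝ] X, 0) (B j) ∈ L := (hL' _).2 fun b hb => by
      rw [genPairing_lieGenBracket]
      exact hstab X hX _ (B j).2 b hb
    have h1 := B.sum_repr ⟨_, hm⟩
    rw [← hp' _ hm] at h1
    have h2 := congrArg (fun m : L => genPairing c (m : GenSpace (ℂ ⊗[ℝ] E))) h1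
    rw [hp' _ hm] at h2
    rw [← genPairing_lieGenBracket, genPairing_comm]
    refine h2.symm.trans ?_
    rw [← hp' _ hm, AddSubmonoidClass.coe_finsetSum, genPairing_sum_right]
    refine Finset.sum_congr rfl fun i _ => ?_
    rw [Submodule.coe_smul, genPairing_smul_right]
    rfl
  have hf := eq_zero_of_linear_ode (f := f) (C := fun t j i => C j i (maurerCartan E k t 1))
    (fun t ht j => by
      rw [← hpair _ (projMap_maurerCartan_curve hπ hs hk hkK (hs01 ht))]
      exact hasDerivAt_genPairing_conjGen hs hk (hs01 ht) a (B j))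
    (fun j i t ht => by
      have h1 : ContinuousAt (fun t => maurerCartan E k t 1) t :=
        (contDiffAt_maurerCartan hs hk (hs01 ht)).continuousAt.clm_apply continuousAt_const
      exact ((C j i).continuous_of_finiteDimensional.continuousAt.comp h1).continuousWithinAt)
    (funext fun j => by
      simp only [f, hk0, conjGen_one]
      exact hL.prop _ ha _ (B j).2)
    1 (by simp)
  refine (hL' _).2 fun b hb => ?_
  have hsum : ((∑ i, B.repr ⟨b, hb⟩ i • B i : L) : GenSpace (ℂ ⊗[ℝ] E)) = b :=
    congrArg Subtype.val (B.sum_repr ⟨b, hb⟩)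
  rw [← hsum, AddSubmonoidClass.coe_finsetSum, genPairing_sum_right]
  refine Finset.sum_eq_zero fun i _ => ?_
  rw [Submodule.coe_smul, genPairing_smul_right]
  have := congrFun hf i
  simp only [f, Pi.zero_apply] at this
  rw [this, mul_zero]

/-- Elements of `K` near `1` lie on the slice, and a segment in a ball of parameters joins each to
`1` by a smooth curve in `K`. So the stabilizer of `L` is an open subgroup of the connected group
`K`. -/
lemma conjGen_mem (hK : IsConnected (K : Set G)) {L : Submodule ℂ (GenSpace (ℂ ⊗[ℝ] E))}
    (hL : IsMaxIsotropic L)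
    (hstab : ∀ X : E, projMap E K E' X = 0 → ∀ a ∈ L, ∀ b ∈ L,
      lieForm G ((1 : ℂ) ⊗ₜ[ℝ] X, 0) a b = 0) {k : G} (hk : k ∈ K) {a : GenSpace (ℂ ⊗[ℝ] E)}
    (ha : a ∈ L) : conjGen k a ∈ L := by
  have : IsTopologicalGroup G := topologicalGroup_of_lieGroup 𝓘(ℝ, E) ∞
  obtain ⟨V, c, v₀, hV, hv₀, hc, hc0, hcK, -, hnear⟩ :=
    exists_local_slice (hπ.isSubmersionOfComplement_complement 1)
  obtain ⟨ε, hε, hball⟩ := Metric.isOpen_iff.1 hV v₀ hv₀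
  have hloc : ∀ v ∈ Metric.ball v₀ ε, ∀ a ∈ L, conjGen (c v) a ∈ L := by
    intro v hv a ha
    let ℓ : ℝ → hπ.complement := fun t => v₀ + t • (v - v₀)
    have hℓ : ContDiff ℝ ∞ ℓ := contDiff_const.add (contDiff_id.smul contDiff_const)
    have h1 : ℓ 1 = v := by simp [ℓ]
    have h2 := conjGen_mem_of_curve hπ hL hstab (k := fun t => c (ℓ t)) (s := ℓ ⁻¹' V)
      (hV.preimage hℓ.continuous) (fun t ht => hball ?_)
      (hc.comp hℓ.contMDiff.contMDiffOn fun t ht => ht) ?_ (by simp [ℓ, hc0]) ha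
    · simpa only [h1] using h2
    · rw [Metric.mem_ball, dist_eq_norm]
      rw [Metric.mem_ball, dist_eq_norm] at hv
      simp only [ℓ, add_sub_cancel_left, norm_smul, Real.norm_of_nonneg ht.1]
      nlinarith [norm_nonneg (v - v₀), ht.2]
    · intro t ht
      have := hcK (ℓ t) ht
      rw [eq_comm, QuotientGroup.eq] at this
      simpa using this
  -- Invariance of the pairing and self-orthogonality of `L` yield inverses without comparing
  -- dimensions.
  have hinvmem : ∀ k : G, (∀ a ∈ L, conjGen k a ∈ L) → ∀ a ∈ L, conjGen k⁻¹ a ∈ L := by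
    intro k hk a ha
    refine (isMaxIsotropic_iff.1 hL _).2 fun b hb => ?_
    rw [genPairing_conjGen_inv]
    exact hL.prop _ ha _ (hk b hb)
  let S : Subgroup K :=
    { carrier := {k | ∀ a ∈ L, conjGen (k : G) a ∈ L}
      one_mem' := fun a ha => by rwa [OneMemClass.coe_one, conjGen_one]
      mul_mem' := fun {k l} hk hl a ha => by
        rw [MulMemClass.coe_mul, conjGen_mul]
        exact hl _ (hk _ ha)
      inv_mem' := fun {k} hk => hinvmem k hk }
  have hS : (S : Set K) ∈ 𝓝 (1 : K) := by
    have h1 := hnear _ (Metric.ball_mem_nhds v₀ hε)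
    have h2 : ContinuousAt (fun k : K => (k : G)) 1 := continuous_subtype_val.continuousAt
    filter_upwards [h2.eventually h1] with k hk
    obtain ⟨v, hv, hvk⟩ := hk (by rw [eq_comm, QuotientGroup.eq]; simp)
    intro a ha
    rw [← hvk]
    exact hloc v hv a ha
  have hopen : IsOpen (S : Set K) := S.isOpen_of_mem_nhds hS
  have : ConnectedSpace K := isConnected_iff_connectedSpace.1 hK
  have huniv : (S : Set K) = Set.univ :=
    IsClopen.eq_univ ⟨S.isClosed_of_isOpen hopen, hopen⟩ ⟨1, S.one_mem⟩
  have hmem : (⟨k, hk⟩ : K) ∈ (S : Set K) := huniv ▸ Set.mem_univ _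
  exact hmem a ha

end Isotropy

/-! ### Transport of generalized vectors by an isomorphism. -/

section GenTransport

variable {W W' : Type*} [AddCommGroup W] [Module ℂ W] [AddCommGroup W'] [Module ℂ W']

/-- The map `X + ξ ↦ F X + F'^* ξ`. -/
def genTransport (F : W →ₗ[ℂ] W') (F' : W' →ₗ[ℂ] W) : GenSpace W →ₗ[ℂ] GenSpace W' :=
  F.prodMap F'.dualMap

lemma genTransport_apply (F : W →ₗ[ℂ] W') (F' : W' →ₗ[ℂ] W) (a : GenSpace W) :
    genTransport F F' a = (F a.1, a.2 ∘ₗ F') := rfl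

lemma genTransport_genTransport {F : W →ₗ[ℂ] W'} {F' : W' →ₗ[ℂ] W} (h : F' ∘ₗ F = LinearMap.id)
    (a : GenSpace W) : genTransport F' F (genTransport F F' a) = a := by
  refine Prod.ext ?_ ?_
  · exact congrArg (fun T : W →ₗ[ℂ] W => T a.1) h
  · change (a.2 ∘ₗ F') ∘ₗ F = a.2
    rw [LinearMap.comp_assoc, h, LinearMap.comp_id]

lemma genTransport_injective {F : W →ₗ[ℂ] W'} {F' : W' →ₗ[ℂ] W} (h : F' ∘ₗ F = LinearMap.id) :
    Function.Injective (genTransport F F') :=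
  Function.LeftInverse.injective (genTransport_genTransport h)

lemma mem_genPullback_of_inverse {F : W →ₗ[ℂ] W'} {F' : W' →ₗ[ℂ] W} (h : F ∘ₗ F' = LinearMap.id)
    (h' : F' ∘ₗ F = LinearMap.id) {D : Submodule ℂ (GenSpace W')} {a : GenSpace W} :
    a ∈ genPullback F D ↔ genTransport F F' a ∈ D := by
  rw [mem_genPullback, genTransport_apply]
  constructor
  · rintro ⟨ξ, hξ, ha⟩
    rwa [ha, LinearMap.comp_assoc, h, LinearMap.comp_id]
  · intro ha
    exact ⟨_, ha, by rw [LinearMap.comp_assoc, h', LinearMap.comp_id]⟩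

lemma genPullback_eq_map {F : W →ₗ[ℂ] W'} {F' : W' →ₗ[ℂ] W} (h : F ∘ₗ F' = LinearMap.id)
    (h' : F' ∘ₗ F = LinearMap.id) (D : Submodule ℂ (GenSpace W')) :
    genPullback F D = D.map (genTransport F' F) := by
  ext a
  rw [mem_genPullback_of_inverse h h']
  constructor
  · exact fun ha => ⟨_, ha, genTransport_genTransport h' a⟩
  · rintro ⟨b, hb, rfl⟩
    rwa [genTransport_genTransport h]

end GenTransport

lemma complexMap_comp_eq_id {V V' : Type*} [NormedAddCommGroup V] [NormedSpace ℝ V]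
    [NormedAddCommGroup V'] [NormedSpace ℝ V'] {F : V →L[ℝ] V'} {F' : V' →L[ℝ] V}
    (h : F'.comp F = ContinuousLinearMap.id ℝ V) :
    complexMap F' ∘ₗ complexMap F = LinearMap.id := by
  rw [← complexMap_comp, h, complexMap_id]

/-! ### Invariant families and their fibre at the base point. -/

section InvariantFamilies

variable {E : Type*} [NormedAddCommGroup E] [NormedSpace ℝ E]
  {G : Type*} [TopologicalSpace G] [ChartedSpace E G] [Group G] [LieGroup 𝓘(ℝ, E) ∞ G]
  {K : Subgroup G}
  {E' : Type*} [NormedAddCommGroup E'] [NormedSpace ℝ E'] [ChartedSpace E' (G ⧸ K)]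
  [IsManifold 𝓘(ℝ, E') ∞ (G ⧸ K)]
  (hπ : Manifold.IsSubmersion 𝓘(ℝ, E) 𝓘(ℝ, E') ∞ (QuotientGroup.mk : G → G ⧸ K))

variable (K) in
/-- The family obtained by translating a subspace at the base point. -/
def translateFamily (D : Submodule ℂ (GenSpace (ℂ ⊗[ℝ] E'))) (p : G ⧸ K) :
    Submodule ℂ (GenSpace (ℂ ⊗[ℝ] E')) :=
  genPullback (complexMap (actMap E' (Quotient.out p)⁻¹ p)) D

lemma smul_mk_one_of_mem {k : G} (hk : k ∈ K) :
    k • ((1 : G) : G ⧸ K) = ((1 : G) : G ⧸ K) := by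
  change ((k * 1 : G) : G ⧸ K) = _
  rw [mul_one, eq_comm, QuotientGroup.eq]
  simpa using hk

lemma inv_smul_mk (x : G) : x⁻¹ • (x : G ⧸ K) = ((1 : G) : G ⧸ K) := by
  change ((x⁻¹ * x : G) : G ⧸ K) = _
  rw [inv_mul_cancel]

lemma genPullback_conjMap_eq_iff {L : Submodule ℂ (GenSpace (ℂ ⊗[ℝ] E))} :
    (∀ k ∈ K, ∀ a ∈ L, conjGen k a ∈ L) ↔
      ∀ k ∈ K, genPullback (complexMap (conjMap E k)) L = L := by
  have key : ∀ (k : G) a, a ∈ genPullback (complexMap (conjMap E k)) L ↔ conjGen k a ∈ L :=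
    fun k a => mem_genPullback_of_inverse (complexMap_comp_eq_id (conjMap_comp_inv k))
      (complexMap_comp_eq_id (conjMap_inv_comp k))
  constructor
  · intro h k hk
    ext a
    rw [key]
    refine ⟨fun ha => ?_, h k hk a⟩
    have := h _ (K.inv_mem hk) _ ha
    rwa [← conjGen_mul, mul_inv_cancel, conjGen_one] at this
  · intro h k hk a ha
    rw [← key, h k hk]
    exact ha

include hπ

/-- For `k ∈ K` one has `k⁻¹ x K = (k⁻¹ x k) K`; differentiating at `x = 1` intertwines the isotropy
representation with the adjoint action. -/
lemma actMap_comp_projMap {k : G} (hk : k ∈ K) :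
    (actMap E' k⁻¹ ((1 : G) : G ⧸ K)).comp (projMap E K E') =
      (projMap E K E').comp (conjMap E k) := by
  have h1 := tderiv_comp (f := (QuotientGroup.mk : G → G ⧸ K)) (p := (1 : G))
    (mdifferentiableAt_smul hπ k⁻¹ _) (mdifferentiableAt_mk hπ 1)
  have h2 := tderiv_comp (f := fun x : G => k⁻¹ * x * k) (p := (1 : G))
    (mdifferentiableAt_mk hπ (k⁻¹ * 1 * k)) (contMDiff_conj (E := E) k).contMDiffAt.mdiff
  rw [mul_one, inv_mul_cancel] at h2
  refine (h1.symm.trans ?_).trans h2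
  refine tderiv_congr (Filter.Eventually.of_forall fun x => ?_)
  change ((k⁻¹ * x : G) : G ⧸ K) = ((k⁻¹ * x * k : G) : G ⧸ K)
  rw [QuotientGroup.eq]
  simpa [mul_assoc] using hk

/-- Invariance under the adjoint action of the isotropy group, in terms of the isotropy
representation. -/
lemma conjGen_mem_iff {D : Submodule ℂ (GenSpace (ℂ ⊗[ℝ] E'))} :
    (∀ k ∈ K, ∀ a ∈ genPullback (complexMap (projMap E K E')) D,
        conjGen k a ∈ genPullback (complexMap (projMap E K E')) D) ↔
      ∀ k ∈ K, genPullback (complexMap (actMap E' k ((1 : G) : G ⧸ K))) D = D := by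
  have hinj := genPullback_injective (complexMap_surjective (projMap_surjective hπ))
  rw [genPullback_conjMap_eq_iff]
  have key : ∀ k ∈ K, genPullback (complexMap (conjMap E k))
      (genPullback (complexMap (projMap E K E')) D) = genPullback (complexMap (projMap E K E'))
        (genPullback (complexMap (actMap E' k⁻¹ ((1 : G) : G ⧸ K))) D) := by
    intro k hk
    rw [← genPullback_comp, ← genPullback_comp, ← complexMap_comp, ← complexMap_comp,
      actMap_comp_projMap hπ hk]
  constructor
  · intro h k hk
    have h1 := key _ (K.inv_mem hk)
    rw [h _ (K.inv_mem hk), inv_inv] at h1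
    exact (hinj h1).symm
  · intro h k hk
    rw [key k hk, h _ (K.inv_mem hk)]

/-- An invariant family is determined by its value at the base point. -/
lemma eq_genPullback_of_invariant {D : G ⧸ K → Submodule ℂ (GenSpace (ℂ ⊗[ℝ] E'))}
    (hD : ∀ (g : G) (p : G ⧸ K), genPullback (complexMap (actMap E' g p)) (D (g • p)) = D p)
    (x : G) :
    D (x : G ⧸ K) = genPullback (complexMap (actMap E' x⁻¹ (x : G ⧸ K))) (D ((1 : G) : G ⧸ K)) := by
  rw [← hD x⁻¹ (x : G ⧸ K), inv_smul_mk]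

/-- The chosen representative of a coset differs from `x` by an element of `K`, which fixes `D`, so
the translate is independent of the choice. -/
lemma translateFamily_mk {D : Submodule ℂ (GenSpace (ℂ ⊗[ℝ] E'))}
    (hD : ∀ k ∈ K, genPullback (complexMap (actMap E' k ((1 : G) : G ⧸ K))) D = D) (x : G) :
    translateFamily K D (x : G ⧸ K) =
      genPullback (complexMap (actMap E' x⁻¹ (x : G ⧸ K))) D := by
  obtain ⟨k, hk⟩ := QuotientGroup.mk_out_eq_mul K x
  have h1 : Quotient.out (x : G ⧸ K) = x * k := hk
  have h2 := actMap_mul hπ (E' := E') (k : G)⁻¹ x⁻¹ (x : G ⧸ K)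
  rw [inv_smul_mk] at h2
  rw [translateFamily, h1, mul_inv_rev, h2, complexMap_comp, genPullback_comp,
    hD _ (K.inv_mem k.2)]

lemma translateFamily_one {D : Submodule ℂ (GenSpace (ℂ ⊗[ℝ] E'))}
    (hD : ∀ k ∈ K, genPullback (complexMap (actMap E' k ((1 : G) : G ⧸ K))) D = D) :
    translateFamily K D ((1 : G) : G ⧸ K) = D := by
  rw [translateFamily_mk hπ hD, inv_one, actMap_one, complexMap_id, genPullback_id]

lemma translateFamily_invariant {D : Submodule ℂ (GenSpace (ℂ ⊗[ℝ] E'))}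
    (hD : ∀ k ∈ K, genPullback (complexMap (actMap E' k ((1 : G) : G ⧸ K))) D = D)
    (g : G) (p : G ⧸ K) :
    genPullback (complexMap (actMap E' g p)) (translateFamily K D (g • p)) =
      translateFamily K D p := by
  obtain ⟨x, rfl⟩ := QuotientGroup.mk_surjective p
  have h1 : g • (x : G ⧸ K) = ((g * x : G) : G ⧸ K) := rfl
  rw [h1, translateFamily_mk hπ hD, translateFamily_mk hπ hD, ← genPullback_comp,
    ← complexMap_comp, ← h1, ← actMap_mul hπ]
  simp

end InvariantFamilies

/-! ### Local sections of the projection in a chart and the frames they induce. -/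

section LocalLift

variable {E : Type*} [NormedAddCommGroup E] [NormedSpace ℝ E]
  {G : Type*} [TopologicalSpace G] [ChartedSpace E G] [Group G]
  {K : Subgroup G}
  {E' : Type*} [NormedAddCommGroup E'] [NormedSpace ℝ E'] [ChartedSpace E' (G ⧸ K)]

variable (E E') in
/-- A smooth local section of the projection, in the preferred chart around `p`. -/
structure IsLocalLift (p : G ⧸ K) (U : Set E') (σ : E' → G) : Prop where
  isOpen : IsOpen U
  mem : extChartAt 𝓘(ℝ, E') p p ∈ U
  subset : U ⊆ (extChartAt 𝓘(ℝ, E') p).target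
  smooth : ContMDiffOn 𝓘(ℝ, E') 𝓘(ℝ, E) ∞ σ U
  mk_eq : ∀ z ∈ U, (σ z : G ⧸ K) = (extChartAt 𝓘(ℝ, E') p).symm z

variable (E K) in
/-- The identification of the tangent space at a point near `p`, in the chart around `p`, with the
tangent space at the base point. -/
def liftFrame (σ : E' → G) (z : E') : E' →L[ℝ] E' :=
  (projMap E K E').comp (maurerCartan E σ z)

/-- The inverse of `liftFrame`. -/
def liftFrameInv (p : G ⧸ K) (σ : E' → G) (z : E') : E' →L[ℝ] E' :=
  (tderiv E' E' (extChartAt 𝓘(ℝ, E') p) ((extChartAt 𝓘(ℝ, E') p).symm z)).comp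
    (actMap E' (σ z) ((1 : G) : G ⧸ K))

/-- The section of `TM ⊕ T^*M` obtained by translating an element of the fibre at the base point. -/
def frameSection (p : G ⧸ K) (σ : E' → G) (a : E' × (E' →L[ℝ] ℝ)) (q : G ⧸ K) :
    E' × (E' →L[ℝ] ℝ) :=
  transport (actMap E' (σ (extChartAt 𝓘(ℝ, E') p q)) ((1 : G) : G ⧸ K))
    (actMap E' (σ (extChartAt 𝓘(ℝ, E') p q))⁻¹ q) a

lemma complexGen_frameSection {p : G ⧸ K} {σ : E' → G} (a b : E' × (E' →L[ℝ] ℝ)) {q : G ⧸ K}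
    (hq : q ∈ (extChartAt 𝓘(ℝ, E') p).source) :
    complexGen (frameSection p σ a q) (frameSection p σ b q) =
      genTransport (complexMap (actMap E' (σ (extChartAt 𝓘(ℝ, E') p q)) ((1 : G) : G ⧸ K)))
        (complexMap (actMap E' (σ (extChartAt 𝓘(ℝ, E') p q))⁻¹
          ((extChartAt 𝓘(ℝ, E') p).symm (extChartAt 𝓘(ℝ, E') p q)))) (complexGen a b) := by
  rw [(extChartAt 𝓘(ℝ, E') p).left_inv hq]
  exact complexGen_transport _ _ a b

variable [LieGroup 𝓘(ℝ, E) ∞ G] [IsManifold 𝓘(ℝ, E') ∞ (G ⧸ K)]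
  (hπ : Manifold.IsSubmersion 𝓘(ℝ, E) 𝓘(ℝ, E') ∞ (QuotientGroup.mk : G → G ⧸ K))

lemma IsLocalLift.isOpen_preimage {p : G ⧸ K} {U : Set E'} {σ : E' → G}
    (h : IsLocalLift E E' p U σ) :
    IsOpen ((extChartAt 𝓘(ℝ, E') p).source ∩ extChartAt 𝓘(ℝ, E') p ⁻¹' U) :=
  (continuousOn_extChartAt p).isOpen_inter_preimage (isOpen_extChartAt_source p) h.isOpen

include hπ

lemma exists_isLocalLift (p : G ⧸ K) : ∃ U σ, IsLocalLift E E' p U σ := by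
  obtain ⟨x, rfl⟩ := QuotientGroup.mk_surjective p
  obtain ⟨U, τ, hU, hx, hτ, -, hmk⟩ := exists_section_mk hπ x
  let φ := extChartAt 𝓘(ℝ, E') (x : G ⧸ K)
  have hcont : ContMDiffOn 𝓘(ℝ, E') 𝓘(ℝ, E') ∞ φ.symm φ.target :=
    contMDiffOn_extChartAt_symm (x : G ⧸ K)
  refine ⟨φ.target ∩ φ.symm ⁻¹' U, fun z => τ (φ.symm z), ?_, ⟨?_, ?_⟩, Set.inter_subset_left, ?_,
    fun z hz => hmk _ hz.2⟩
  · exact hcont.continuousOn.isOpen_inter_preimage (isOpen_extChartAt_target _) hU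
  · exact chart_mem_target (mem_chart_source E' (x : G ⧸ K))
  · rw [Set.mem_preimage]
    have : φ.symm (φ (x : G ⧸ K)) = (x : G ⧸ K) := chart_symm_chart (mem_chart_source E' _)
    rwa [this]
  · exact hτ.comp (hcont.mono Set.inter_subset_left) fun z hz => hz.2

variable {p : G ⧸ K} {U : Set E'} {σ : E' → G} (h : IsLocalLift E E' p U σ)

include h

/-- Since `π ∘ σ` is the inverse chart, projecting the Maurer-Cartan form leaves the derivative of
the inverse chart followed by translation to the base point. Both factors are invertible. -/
lemma liftFrame_eq {z : E'} (hz : z ∈ U) :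
    liftFrame E K σ z = (actMap E' (σ z)⁻¹ ((extChartAt 𝓘(ℝ, E') p).symm z)).comp
      (tderiv E' E' (extChartAt 𝓘(ℝ, E') p).symm z) := by
  rw [liftFrame, projMap_comp_maurerCartan hπ (h.smooth.contMDiffAt (h.isOpen.mem_nhds hz)).mdiff,
    h.mk_eq z hz]
  congr 1
  refine tderiv_congr ?_
  filter_upwards [h.isOpen.mem_nhds hz] with z hz using h.mk_eq z hz

lemma actMap_lift_comp_inv {z : E'} (hz : z ∈ U) :
    (actMap E' (σ z) ((1 : G) : G ⧸ K)).comp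
      (actMap E' (σ z)⁻¹ ((extChartAt 𝓘(ℝ, E') p).symm z)) = ContinuousLinearMap.id ℝ E' := by
  have := actMap_comp_inv hπ (E' := E') (σ z) (σ z : G ⧸ K)
  rwa [inv_smul_mk, h.mk_eq z hz] at this

lemma actMap_lift_inv_comp {z : E'} (hz : z ∈ U) :
    (actMap E' (σ z)⁻¹ ((extChartAt 𝓘(ℝ, E') p).symm z)).comp
      (actMap E' (σ z) ((1 : G) : G ⧸ K)) = ContinuousLinearMap.id ℝ E' := by
  have h1 := actMap_inv_comp hπ (E' := E') (σ z) ((1 : G) : G ⧸ K)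
  have h2 : σ z • ((1 : G) : G ⧸ K) = (extChartAt 𝓘(ℝ, E') p).symm z := by
    rw [← h.mk_eq z hz]
    change ((σ z * 1 : G) : G ⧸ K) = _
    rw [mul_one]
  rwa [h2] at h1

lemma liftFrame_comp_inv {z : E'} (hz : z ∈ U) :
    (liftFrame E K σ z).comp (liftFrameInv p σ z) = ContinuousLinearMap.id ℝ E' := by
  rw [liftFrame_eq hπ h hz, liftFrameInv, ContinuousLinearMap.comp_assoc,
    ← ContinuousLinearMap.comp_assoc (tderiv E' E' (extChartAt 𝓘(ℝ, E') p).symm z),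
    tderiv_chart_symm_comp (h.subset hz), ContinuousLinearMap.id_comp,
    actMap_lift_inv_comp hπ h hz]

lemma liftFrameInv_comp {z : E'} (hz : z ∈ U) :
    (liftFrameInv p σ z).comp (liftFrame E K σ z) = ContinuousLinearMap.id ℝ E' := by
  rw [liftFrame_eq hπ h hz, liftFrameInv, ContinuousLinearMap.comp_assoc,
    ← ContinuousLinearMap.comp_assoc (actMap E' (σ z) ((1 : G) : G ⧸ K)),
    actMap_lift_comp_inv hπ h hz, ContinuousLinearMap.id_comp, tderiv_chart_comp_symm (h.subset hz)]

/-- Together with the covector version, this reduces smoothness of translated sections to that of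
the lift frame and its inverse, hence of the Maurer-Cartan form. -/
lemma fieldInChart_frameSection (a : E' × (E' →L[ℝ] ℝ)) {z : E'} (hz : z ∈ U) :
    fieldInChart (fun q => (frameSection p σ a q).1) p z = liftFrameInv p σ z a.1 := by
  have h1 : extChartAt 𝓘(ℝ, E') p ((extChartAt 𝓘(ℝ, E') p).symm z) = z :=
    (extChartAt 𝓘(ℝ, E') p).right_inv (h.subset hz)
  simp only [fieldInChart, frameSection, transport, h1]
  rfl

lemma coFieldInChart_frameSection (a : E' × (E' →L[ℝ] ℝ)) {z : E'} (hz : z ∈ U) :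
    coFieldInChart (fun q => (frameSection p σ a q).2) p z = a.2.comp (liftFrame E K σ z) := by
  have h1 : extChartAt 𝓘(ℝ, E') p ((extChartAt 𝓘(ℝ, E') p).symm z) = z :=
    (extChartAt 𝓘(ℝ, E') p).right_inv (h.subset hz)
  simp only [coFieldInChart, frameSection, transport, h1]
  rw [liftFrame_eq hπ h hz, ContinuousLinearMap.comp_assoc]

variable [FiniteDimensional ℝ E]

lemma contDiffAt_liftFrame {z : E'} (hz : z ∈ U) : ContDiffAt ℝ ∞ (liftFrame E K σ) z :=
  contDiffAt_const.clm_comp (contDiffAt_maurerCartan h.isOpen h.smooth hz)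

lemma contDiffAt_liftFrameInv [CompleteSpace E'] {z : E'} (hz : z ∈ U) :
    ContDiffAt ℝ ∞ (liftFrameInv p σ) z := by
  have hinv : (liftFrame E K σ z).IsInvertible :=
    ContinuousLinearMap.IsInvertible.of_inverse (liftFrame_comp_inv hπ h hz)
      (liftFrameInv_comp hπ h hz)
  have h1 := hinv.contDiffAt_map_inverse (n := ∞)
  refine (h1.comp z (contDiffAt_liftFrame hπ h hz)).congr_of_eventuallyEq ?_
  filter_upwards [h.isOpen.mem_nhds hz] with z hz
  exact (ContinuousLinearMap.inverse_eq (liftFrame_comp_inv hπ h hz)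
    (liftFrameInv_comp hπ h hz)).symm

/-- The frame sections are smooth. -/
lemma smoothOn_frameSection [CompleteSpace E'] (a : E' × (E' →L[ℝ] ℝ)) :
    RealSection.SmoothOn (E := E') (M := G ⧸ K) (frameSection p σ a)
      ((extChartAt 𝓘(ℝ, E') p).source ∩ extChartAt 𝓘(ℝ, E') p ⁻¹' U) := by
  have hsrc : ∀ q ∈ (extChartAt 𝓘(ℝ, E') p).source, q ∈ (chartAt E' p).source :=
    fun q hq => by simpa using hq
  constructor
  · intro q hq
    refine ((smooth_field_iff (M := G ⧸ K) (fun q => (frameSection p σ a q).1)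
      (hsrc q hq.1)).2 ?_).contMDiffWithinAt
    have h1 : ContDiffAt ℝ ∞ (fun z => liftFrameInv p σ z a.1) (extChartAt 𝓘(ℝ, E') p q) :=
      (contDiffAt_liftFrameInv hπ h hq.2).clm_apply contDiffAt_const
    refine h1.congr_of_eventuallyEq ?_
    filter_upwards [h.isOpen.mem_nhds hq.2] with z hz
    exact fieldInChart_frameSection hπ h a hz
  · intro q hq
    refine ((smooth_coField_iff (M := G ⧸ K) (fun q => (frameSection p σ a q).2)
      (hsrc q hq.1)).2 ?_).contMDiffWithinAt
    have h1 : ContDiffAt ℝ ∞ (fun z => a.2.comp (liftFrame E K σ z)) (extChartAt 𝓘(ℝ, E') p q) :=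
      contDiffAt_const.clm_comp (contDiffAt_liftFrame hπ h hq.2)
    refine h1.congr_of_eventuallyEq ?_
    filter_upwards [h.isOpen.mem_nhds hq.2] with z hz
    exact coFieldInChart_frameSection hπ h a hz

lemma invariant_eq_map {D : G ⧸ K → Submodule ℂ (GenSpace (ℂ ⊗[ℝ] E'))}
    (hD : ∀ (g : G) (p : G ⧸ K), genPullback (complexMap (actMap E' g p)) (D (g • p)) = D p)
    {z : E'} (hz : z ∈ U) :
    D ((extChartAt 𝓘(ℝ, E') p).symm z) = (D ((1 : G) : G ⧸ K)).map
      (genTransport (complexMap (actMap E' (σ z) ((1 : G) : G ⧸ K)))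
        (complexMap (actMap E' (σ z)⁻¹ ((extChartAt 𝓘(ℝ, E') p).symm z)))) := by
  have h1 := eq_genPullback_of_invariant hπ hD (σ z)
  rw [h.mk_eq z hz] at h1
  rw [h1]
  exact genPullback_eq_map (complexMap_comp_eq_id (actMap_lift_inv_comp hπ h hz))
    (complexMap_comp_eq_id (actMap_lift_comp_inv hπ h hz)) _

lemma frameSection_mem {D : G ⧸ K → Submodule ℂ (GenSpace (ℂ ⊗[ℝ] E'))}
    (hD : ∀ (g : G) (p : G ⧸ K), genPullback (complexMap (actMap E' g p)) (D (g • p)) = D p)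
    {a b : E' × (E' →L[ℝ] ℝ)} (hab : complexGen a b ∈ D ((1 : G) : G ⧸ K)) {q : G ⧸ K}
    (hq : q ∈ (extChartAt 𝓘(ℝ, E') p).source ∩ extChartAt 𝓘(ℝ, E') p ⁻¹' U) :
    complexGen (frameSection p σ a q) (frameSection p σ b q) ∈ D q := by
  have h1 := invariant_eq_map hπ h hD hq.2
  rw [complexGen_frameSection a b hq.1]
  rw [(extChartAt 𝓘(ℝ, E') p).left_inv hq.1] at h1 ⊢
  rw [h1]
  exact ⟨_, hab, rfl⟩

end LocalLift

/-! ### Smoothness of invariant families. -/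

section Subbundle

variable {E : Type*} [NormedAddCommGroup E] [NormedSpace ℝ E] [FiniteDimensional ℝ E]
  {G : Type*} [TopologicalSpace G] [ChartedSpace E G] [Group G] [LieGroup 𝓘(ℝ, E) ∞ G]
  {K : Subgroup G}
  {E' : Type*} [NormedAddCommGroup E'] [NormedSpace ℝ E'] [FiniteDimensional ℝ E']
  [ChartedSpace E' (G ⧸ K)] [IsManifold 𝓘(ℝ, E') ∞ (G ⧸ K)]
  (hπ : Manifold.IsSubmersion 𝓘(ℝ, E) 𝓘(ℝ, E') ∞ (QuotientGroup.mk : G → G ⧸ K))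

include hπ

/-- An invariant family of subspaces is a smooth subbundle. -/
lemma isSubbundle_of_invariant {D : SubspaceFamily E' (G ⧸ K)} (hD : D.IsInvariant G) :
    D.IsSubbundle := by
  have : CompleteSpace E' := FiniteDimensional.complete ℝ E'
  intro p
  obtain ⟨U, σ, h⟩ := exists_isLocalLift hπ p
  let D₀ : Submodule ℂ (GenSpace (ℂ ⊗[ℝ] E')) := D ((1 : G) : G ⧸ K)
  -- The local frame is a basis of the base fibre, split into real and imaginary parts and
  -- translated by `σ`. Transport is an isomorphism between fibres, so independence and span are
  -- preserved.
  let B := Module.finBasis ℂ D₀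
  have hB : ∀ i, ∃ ab : (E' × (E' →L[ℝ] ℝ)) × (E' × (E' →L[ℝ] ℝ)),
      (B i : GenSpace (ℂ ⊗[ℝ] E')) = complexGen ab.1 ab.2 := fun i => by
    obtain ⟨a, b, hab⟩ := exists_eq_complexGen (B i : GenSpace (ℂ ⊗[ℝ] E'))
    exact ⟨(a, b), hab⟩
  choose ab hab using hB
  refine ⟨_, h.isOpen_preimage, ⟨mem_extChartAt_source p, h.mem⟩, _,
    fun i => ⟨frameSection p σ (ab i).1, frameSection p σ (ab i).2⟩,
    fun i => ⟨smoothOn_frameSection hπ h _, smoothOn_frameSection hπ h _⟩, fun q hq => ?_⟩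
  have hval : ∀ i, complexGen (frameSection p σ (ab i).1 q) (frameSection p σ (ab i).2 q) = _ :=
    fun i => (complexGen_frameSection (ab i).1 (ab i).2 hq.1).trans
      (congrArg _ (hab i).symm)
  have hmap := invariant_eq_map (D := D) hπ h hD hq.2
  have hinj := genTransport_injective
    (complexMap_comp_eq_id (actMap_lift_inv_comp hπ h hq.2))
  have hfun := funext hval
  have hli : LinearIndependent ℂ (fun i => (B i : GenSpace (ℂ ⊗[ℝ] E'))) :=
    B.linearIndependent.map' D₀.subtype D₀.ker_subtype
  have hspan : Submodule.span ℂ (Set.range fun i => (B i : GenSpace (ℂ ⊗[ℝ] E'))) = D₀ := by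
    have h1 := congrArg (Submodule.map D₀.subtype) B.span_eq
    rw [Submodule.map_span, Submodule.map_top, Submodule.range_subtype, ← Set.range_comp] at h1
    exact h1
  constructor
  · have h1 := hli.map' _ (LinearMap.ker_eq_bot.2 hinj)
    have h2 : LinearIndependent ℂ (fun i =>
        complexGen (frameSection p σ (ab i).1 q) (frameSection p σ (ab i).2 q)) := by
      rw [hfun]
      exact h1
    exact h2
  · rw [(extChartAt 𝓘(ℝ, E') p).left_inv hq.1] at hmap
    refine hmap.trans ?_
    refine Eq.trans ?_ (congrArg (fun f => Submodule.span ℂ (Set.range f)) hfun).symm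
    rw [(extChartAt 𝓘(ℝ, E') p).left_inv hq.1]
    refine Eq.trans (congrArg (Submodule.map _) hspan).symm ?_
    rw [Submodule.map_span, ← Set.range_comp]
    rfl

end Subbundle

/-! ### Real and imaginary parts of the pairing. -/

section RealForms

variable {V V' : Type*} [NormedAddCommGroup V] [NormedSpace ℝ V] [NormedAddCommGroup V']
  [NormedSpace ℝ V']

/-- The natural pairing on `V ⊕ V^*`. -/
def realPairing (a b : V × (V →L[ℝ] ℝ)) : ℝ := b.2 a.1 + a.2 b.1

lemma realPairing_add_left (a b c : V × (V →L[ℝ] ℝ)) :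
    realPairing (a + b) c = realPairing a c + realPairing b c := by
  simp [realPairing]; ring

lemma realPairing_sub_left (a b c : V × (V →L[ℝ] ℝ)) :
    realPairing (a - b) c = realPairing a c - realPairing b c := by
  simp [realPairing]; ring

lemma genPairing_complexGen (a a' b b' : V × (V →L[ℝ] ℝ)) :
    genPairing (complexGen a a') (complexGen b b') =
      ⟨realPairing a b - realPairing a' b', realPairing a b' + realPairing a' b⟩ := by
  have h : ∀ a b : V × (V →L[ℝ] ℝ), genPairing (realToGen a) (realToGen b) = (realPairing a b : ℂ) :=
    genPairing_realToGen
  simp only [complexGen, genPairing_add_left, genPairing_add_right, genPairing_smul_left,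
    genPairing_smul_right, h]
  apply Complex.ext <;> simp <;> ring

lemma complexGen_add (a a' b b' : V × (V →L[ℝ] ℝ)) :
    complexGen (a + b) (a' + b') = complexGen a a' + complexGen b b' := by
  simp only [complexGen, realToGen_add, smul_add]
  abel

lemma complexGen_smul (r : ℝ) (a a' : V × (V →L[ℝ] ℝ)) :
    complexGen (r • a) (r • a') = (r : ℂ) • complexGen a a' := by
  simp only [complexGen, realToGen_smul, smul_add, smul_smul, mul_comm]

/-- The derivative of a function with values in a maximal isotropic subspace takes values in it. -/
lemma hasFDerivAt_complexGen_mem [FiniteDimensional ℝ V] {F : Type*} [NormedAddCommGroup F]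
    [NormedSpace ℝ F] {L : Submodule ℂ (GenSpace (ℂ ⊗[ℝ] V))} (hL : IsMaxIsotropic L)
    {f g : F → V × (V →L[ℝ] ℝ)} {f' g' : F →L[ℝ] V × (V →L[ℝ] ℝ)} {z : F}
    (hf : HasFDerivAt f f' z) (hg : HasFDerivAt g g' z)
    (hmem : ∀ᶠ y in 𝓝 z, complexGen (f y) (g y) ∈ L) (u : F) : complexGen (f' u) (g' u) ∈ L := by
  refine (isMaxIsotropic_iff.1 hL _).2 fun m hm => ?_
  -- Pairing with a fixed `m ∈ L` is linear and vanishes along the function, so it vanishes on the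
  -- derivative; self-orthogonality of `L` concludes.
  let Λ : (V × (V →L[ℝ] ℝ)) × (V × (V →L[ℝ] ℝ)) →ₗ[ℝ] ℂ :=
    { toFun := fun a => genPairing (complexGen a.1 a.2) m
      map_add' := fun a b => by
        rw [← genPairing_add_left, ← complexGen_add]; rfl
      map_smul' := fun r a => by
        rw [Prod.smul_fst, Prod.smul_snd, complexGen_smul, genPairing_smul_left]; simp }
  have h1 := Λ.toContinuousLinearMap.hasFDerivAt.comp z (hf.prodMk hg)
  have h2 : HasFDerivAt (Λ.toContinuousLinearMap ∘ fun y => (f y, g y)) (0 : F →L[ℝ] ℂ) z := by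
    refine (hasFDerivAt_const (0 : ℂ) z).congr_of_eventuallyEq ?_
    filter_upwards [hmem] with y hy
    exact hL.prop _ hy m hm
  exact congrArg (fun T : F →L[ℝ] ℂ => T u) (h1.unique h2)

lemma complexGen_mem_genPullback {T : V →L[ℝ] V'} {D : Submodule ℂ (GenSpace (ℂ ⊗[ℝ] V'))}
    {a b : V × (V →L[ℝ] ℝ)} {c d : V' × (V' →L[ℝ] ℝ)} (hc : T a.1 = c.1) (hd : T b.1 = d.1)
    (hc' : a.2 = c.2.comp T) (hd' : b.2 = d.2.comp T) (h : complexGen c d ∈ D) :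
    complexGen a b ∈ genPullback (complexMap T) D := by
  refine mem_genPullback.2 ⟨(complexGen c d).2, ?_, ?_⟩
  · rw [complexGen_fst, complexMap_tmul_add, hc, hd]
    exact h
  · refine LinearMap.ext fun x => ?_
    obtain ⟨u, v, rfl⟩ := exists_eq_tmul_add x
    simp [complexGen, realToGen, hc', hd']

end RealForms

/-! ### The pointwise identity between the Courant bracket and the bracket of lifts. -/

section CourantPairing

variable {E : Type*} [NormedAddCommGroup E] [NormedSpace ℝ E]
  {G : Type*} [TopologicalSpace G] [ChartedSpace E G] [Group G] [LieGroup 𝓘(ℝ, E) ∞ G]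

variable (G) in
/-- The trilinear form `⟨[a, b], c⟩` on `𝔤^* ⋊ 𝔤`. -/
def realForm (a b c : E × (E →L[ℝ] ℝ)) : ℝ :=
  c.2 (groupBracket E G a.1 b.1) + a.2 (groupBracket E G b.1 c.1) + b.2 (groupBracket E G c.1 a.1)

lemma lieForm_realToGen [CompleteSpace E] (a b c : E × (E →L[ℝ] ℝ)) :
    lieForm G (realToGen a) (realToGen b) (realToGen c) = (realForm G a b c : ℂ) := by
  rw [lieForm_apply]
  simp only [realToGen_fst, complexBracket_tmul, realToGen_snd_tmul, realForm]
  push_cast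
  ring

lemma lieForm_complexGen [CompleteSpace E] (a a' b b' c c' : E × (E →L[ℝ] ℝ)) :
    lieForm G (complexGen a a') (complexGen b b') (complexGen c c') =
      ⟨realForm G a b c - realForm G a b' c' - realForm G a' b c' - realForm G a' b' c,
        realForm G a' b c + realForm G a b' c + realForm G a b c' - realForm G a' b' c'⟩ := by
  simp only [complexGen, lieForm_add_left, lieForm_add_middle, lieForm_add_right,
    lieForm_smul_left, lieForm_smul_middle, lieForm_smul_right, lieForm_realToGen]
  apply Complex.ext <;> simp <;> ring

variable {E' : Type*} [NormedAddCommGroup E'] [NormedSpace ℝ E']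

/-- A section `(V, ξ)` lifts to `(Θ V, ξ ∘ N)` with `N Θ = id`. Differentiating this relation
eliminates the derivative of `N`, and the Maurer-Cartan equation converts the antisymmetric part of
`Θ'` into the bracket of the Lie algebra. The rest is bookkeeping of derivatives of the lifts. -/
lemma realPairing_courant_aux {Θ : E' →L[ℝ] E} {N : E →L[ℝ] E'} {Θ' : E' →L[ℝ] E' →L[ℝ] E}
    {N' : E' →L[ℝ] E →L[ℝ] E'} (hN : ∀ v, N (Θ v) = v) (hN' : ∀ u v, N' u (Θ v) = -N (Θ' u v))
    (hmc : ∀ u v, Θ' u v - Θ' v u = -groupBracket E G (Θ u) (Θ v))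
    (V W X : E') (V' W' : E' →L[ℝ] E') (ξ η α : E' →L[ℝ] ℝ) (ξ' η' : E' →L[ℝ] E' →L[ℝ] ℝ)
    {dℓ dm : E' → E × (E →L[ℝ] ℝ)}
    (hdℓ : ∀ u, dℓ u = (Θ' u V + Θ (V' u), (ξ' u).comp N + ξ.comp (N' u)))
    (hdm : ∀ u, dm u = (Θ' u W + Θ (W' u), (η' u).comp N + η.comp (N' u))) :
    α (W' V - V' W) + ((η' V X - η' X V) + (1 / 2 : ℝ) * (η' X V + η (V' X))
        - (ξ' W X - ξ' X W) - (1 / 2 : ℝ) * (ξ' X W + ξ (W' X))) =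
      realForm G (transport Θ N (V, ξ)) (transport Θ N (W, η)) (transport Θ N (X, α))
        + realPairing (dm V) (transport Θ N (X, α)) - realPairing (dℓ W) (transport Θ N (X, α))
        + (1 / 2 : ℝ) * realPairing (dℓ X) (transport Θ N (W, η))
        - (1 / 2 : ℝ) * realPairing (transport Θ N (V, ξ)) (dm X) := by
  have hb : ∀ u v, groupBracket E G (Θ u) (Θ v) = Θ' v u - Θ' u v := fun u v => by
    rw [← neg_inj, ← hmc]; abel
  simp only [realForm, realPairing, transport, hdℓ, hdm, hb, ContinuousLinearMap.comp_apply,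
    add_apply, map_add, map_sub, map_neg, hN, hN']
  ring

end CourantPairing

/-! ### Lifting sections to functions with values in the pullback. -/

section Integrability

variable {E : Type*} [NormedAddCommGroup E] [NormedSpace ℝ E] [FiniteDimensional ℝ E]
  [CompleteSpace E]
  {G : Type*} [TopologicalSpace G] [ChartedSpace E G] [Group G] [LieGroup 𝓘(ℝ, E) ∞ G]
  {K : Subgroup G}
  {E' : Type*} [NormedAddCommGroup E'] [NormedSpace ℝ E'] [FiniteDimensional ℝ E']
  [ChartedSpace E' (G ⧸ K)] [IsManifold 𝓘(ℝ, E') ∞ (G ⧸ K)]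

variable (E K) in
/-- An element of `TM ⊕ T^*M` in the chart around `p`, transported to `𝔤 ⊕ 𝔤^*` by a local lift. -/
def liftTransport (p : G ⧸ K) (σ : E' → G) (z : E') :
    E' × (E' →L[ℝ] ℝ) → E × (E →L[ℝ] ℝ) :=
  transport (maurerCartan E σ z) ((liftFrameInv p σ z).comp (projMap E K E'))

/-- A section of `TM ⊕ T^*M` in the chart around `p`. -/
def sectionInChart (s : G ⧸ K → E' × (E' →L[ℝ] ℝ)) (p : G ⧸ K) (z : E') : E' × (E' →L[ℝ] ℝ) :=
  (fieldInChart (fun q => (s q).1) p z, coFieldInChart (fun q => (s q).2) p z)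

lemma sectionInChart_self (s : G ⧸ K → E' × (E' →L[ℝ] ℝ)) (p : G ⧸ K) :
    sectionInChart s p (extChartAt 𝓘(ℝ, E') p p) = s p :=
  Prod.ext (fieldInChart_self (fun q => (s q).1) p) (coFieldInChart_self (fun q => (s q).2) p)

lemma RealSection.SmoothOn.contDiffAt_sectionInChart {s : RealSection E' (G ⧸ K)}
    {S : Set (G ⧸ K)} (hs : s.SmoothOn S) (hS : IsOpen S) {p : G ⧸ K} (hp : p ∈ S) :
    ContDiffAt ℝ ∞ (fieldInChart (M := G ⧸ K) (fun q => (s q).1) p) (extChartAt 𝓘(ℝ, E') p p) ∧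
    ContDiffAt ℝ ∞ (coFieldInChart (M := G ⧸ K) (fun q => (s q).2) p)
      (extChartAt 𝓘(ℝ, E') p p) :=
  ⟨(smooth_field_iff (fun q => (s q).1) (mem_chart_source E' p)).1
      (hs.1.contMDiffAt (hS.mem_nhds hp)),
    (smooth_coField_iff (fun q => (s q).2) (mem_chart_source E' p)).1
      (hs.2.contMDiffAt (hS.mem_nhds hp))⟩

variable (hπ : Manifold.IsSubmersion 𝓘(ℝ, E) 𝓘(ℝ, E') ∞ (QuotientGroup.mk : G → G ⧸ K))
  {p : G ⧸ K} {U : Set E'} {σ : E' → G} (h : IsLocalLift E E' p U σ)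

include hπ h

/-- Sections of an invariant family correspond to functions with values in the pullback. -/
lemma liftTransport_mem {D : G ⧸ K → Submodule ℂ (GenSpace (ℂ ⊗[ℝ] E'))}
    (hD : ∀ (g : G) (p : G ⧸ K), genPullback (complexMap (actMap E' g p)) (D (g • p)) = D p)
    {z : E'} (hz : z ∈ U) {s t : G ⧸ K → E' × (E' →L[ℝ] ℝ)}
    (hst : complexGen (s ((extChartAt 𝓘(ℝ, E') p).symm z)) (t ((extChartAt 𝓘(ℝ, E') p).symm z)) ∈
      D ((extChartAt 𝓘(ℝ, E') p).symm z)) :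
    complexGen (liftTransport E K p σ z (sectionInChart s p z))
        (liftTransport E K p σ z (sectionInChart t p z)) ∈
      genPullback (complexMap (projMap E K E')) (D ((1 : G) : G ⧸ K)) := by
  set q := (extChartAt 𝓘(ℝ, E') p).symm z with hq
  let A := actMap E' (σ z) ((1 : G) : G ⧸ K)
  let B := actMap E' (σ z)⁻¹ q
  have hAB : A.comp B = ContinuousLinearMap.id ℝ E' := actMap_lift_comp_inv hπ h hz
  have hBA : B.comp A = ContinuousLinearMap.id ℝ E' := actMap_lift_inv_comp hπ h hz
  have hmem : complexGen (transport B A (s q)) (transport B A (t q)) ∈ D ((1 : G) : G ⧸ K) := by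
    have h1 := eq_genPullback_of_invariant hπ hD (σ z)
    rw [h.mk_eq z hz] at h1
    rw [h1] at hst
    have h2 := (mem_genPullback_of_inverse (complexMap_comp_eq_id hBA)
      (complexMap_comp_eq_id hAB)).1 hst
    rw [genTransport_apply, ← complexGen_transport] at h2
    exact h2
  have hsymm := tderiv_chart_symm_comp (E := E') (M := G ⧸ K) (h.subset hz)
  have hfst : ∀ s : G ⧸ K → E' × (E' →L[ℝ] ℝ), projMap E K E'
      (liftTransport E K p σ z (sectionInChart s p z)).1 = (transport B A (s q)).1 := by
    intro s
    have h1 := liftFrame_eq hπ h hz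
    have h2 := congrArg (fun T : E' →L[ℝ] E' => T (fieldInChart (fun q => (s q).1) p z)) h1
    refine Eq.trans h2 ?_
    have h3 := congrArg (fun T : E' →L[ℝ] E' => B (T (s q).1)) hsymm
    exact h3
  have hsnd : ∀ s : G ⧸ K → E' × (E' →L[ℝ] ℝ),
      (liftTransport E K p σ z (sectionInChart s p z)).2 =
        (transport B A (s q)).2.comp (projMap E K E') := by
    intro s
    ext v
    have h3 := congrArg (fun T : E' →L[ℝ] E' => (s q).2 (T (A (projMap E K E' v)))) hsymm
    exact h3
  exact complexGen_mem_genPullback (hfst s) (hfst t) (hsnd s) (hsnd t) hmem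

lemma liftTransport_frameSection (a : E' × (E' →L[ℝ] ℝ)) {z : E'} (hz : z ∈ U) :
    liftTransport E K p σ z (sectionInChart (frameSection p σ a) p z) =
      (maurerCartan E σ z (liftFrameInv p σ z a.1), a.2.comp (projMap E K E')) := by
  rw [sectionInChart, fieldInChart_frameSection hπ h a hz, coFieldInChart_frameSection hπ h a hz]
  refine Prod.ext rfl ?_
  change (a.2.comp (liftFrame E K σ z)).comp ((liftFrameInv p σ z).comp (projMap E K E')) = _
  rw [ContinuousLinearMap.comp_assoc, ← ContinuousLinearMap.comp_assoc (liftFrame E K σ z),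
    liftFrame_comp_inv hπ h hz, ContinuousLinearMap.id_comp]

/-- The derivative of the lift of a smooth section. -/
lemma exists_hasFDerivAt_liftTransport {s : RealSection E' (G ⧸ K)}
    {S : Set (G ⧸ K)} (hs : s.SmoothOn S) (hS : IsOpen S) (hp : p ∈ S)
    {N' : E' →L[ℝ] E →L[ℝ] E'}
    (hN' : HasFDerivAt (fun z => (liftFrameInv p σ z).comp (projMap E K E')) N'
      (extChartAt 𝓘(ℝ, E') p p)) :
    ∃ (V' : E' →L[ℝ] E') (ξ' : E' →L[ℝ] E' →L[ℝ] ℝ) (ℓ' : E' →L[ℝ] E × (E →L[ℝ] ℝ)),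
      HasFDerivAt (fieldInChart (M := G ⧸ K) (fun q => (s q).1) p) V'
        (extChartAt 𝓘(ℝ, E') p p) ∧
      HasFDerivAt (coFieldInChart (M := G ⧸ K) (fun q => (s q).2) p) ξ'
        (extChartAt 𝓘(ℝ, E') p p) ∧
      HasFDerivAt (fun z => liftTransport E K p σ z (sectionInChart (K := K) (E' := E') s p z)) ℓ'
        (extChartAt 𝓘(ℝ, E') p p) ∧
      ∀ u, ℓ' u = (fderiv ℝ (maurerCartan E σ) (extChartAt 𝓘(ℝ, E') p p) u (s p).1 +
          maurerCartan E σ (extChartAt 𝓘(ℝ, E') p p) (V' u),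
        (ξ' u).comp ((liftFrameInv p σ (extChartAt 𝓘(ℝ, E') p p)).comp (projMap E K E')) +
          ContinuousLinearMap.comp (s p).2 (N' u)) := by
  obtain ⟨h1, h2⟩ := hs.contDiffAt_sectionInChart hS hp
  have hV := (h1.differentiableAt (by simp)).hasFDerivAt
  have hξ := (h2.differentiableAt (by simp)).hasFDerivAt
  have hΘ := ((contDiffAt_maurerCartan h.isOpen h.smooth h.mem).differentiableAt
    (by simp)).hasFDerivAt
  have hx := hΘ.clm_apply hV
  have hl := hξ.clm_comp hN'
  refine ⟨_, _, _, hV, hξ, hx.prodMk hl, fun u => Prod.ext ?_ ?_⟩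
  · have h3 := fieldInChart_self (M := G ⧸ K) (E := E') (fun q => (s q).1) p
    refine Eq.trans (add_comm _ _) ?_
    exact congrArg (fun v => fderiv ℝ (maurerCartan E σ) (extChartAt 𝓘(ℝ, E') p p) u v + _) h3
  · have h3 := coFieldInChart_self (M := G ⧸ K) (E := E') (fun q => (s q).2) p
    refine Eq.trans (add_comm _ _) ?_
    exact congrArg (fun v : E' →L[ℝ] ℝ => _ + v.comp (N' u)) h3

end Integrability

/-! ### Assembling the complex bracket from its real components. -/

section CourantAux

variable {E : Type*} [NormedAddCommGroup E] [NormedSpace ℝ E] [CompleteSpace E]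
  {G : Type*} [TopologicalSpace G] [ChartedSpace E G] [Group G] [LieGroup 𝓘(ℝ, E) ∞ G]
  {E' : Type*} [NormedAddCommGroup E'] [NormedSpace ℝ E']

/-- The derivative terms of the four real brackets recombine into the complex pairings `e₁` to `e₈`,
all zero; only the trilinear form survives. A direction of differentiation is real, so each complex
direction contributes two such pairings. -/
lemma genPairing_courant_aux {B₁₁ B₁₂ B₂₁ B₂₂ a b : E' × (E' →L[ℝ] ℝ)} {S₁ S₂ T₁ T₂ : E × (E →L[ℝ] ℝ)}
    {lt : E' × (E' →L[ℝ] ℝ) → E × (E →L[ℝ] ℝ)} {ℓ₁ ℓ₂ m₁ m₂ : E' → E × (E →L[ℝ] ℝ)} {v₁ v₂ w₁ w₂ : E'}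
    (r₁₁ : ∀ c, realPairing B₁₁ c = realForm G S₁ T₁ (lt c) + realPairing (m₁ v₁) (lt c)
      - realPairing (ℓ₁ w₁) (lt c) + (1 / 2 : ℝ) * realPairing (ℓ₁ c.1) T₁
      - (1 / 2 : ℝ) * realPairing S₁ (m₁ c.1))
    (r₁₂ : ∀ c, realPairing B₁₂ c = realForm G S₁ T₂ (lt c) + realPairing (m₂ v₁) (lt c)
      - realPairing (ℓ₁ w₂) (lt c) + (1 / 2 : ℝ) * realPairing (ℓ₁ c.1) T₂
      - (1 / 2 : ℝ) * realPairing S₁ (m₂ c.1))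
    (r₂₁ : ∀ c, realPairing B₂₁ c = realForm G S₂ T₁ (lt c) + realPairing (m₁ v₂) (lt c)
      - realPairing (ℓ₂ w₁) (lt c) + (1 / 2 : ℝ) * realPairing (ℓ₂ c.1) T₁
      - (1 / 2 : ℝ) * realPairing S₂ (m₁ c.1))
    (r₂₂ : ∀ c, realPairing B₂₂ c = realForm G S₂ T₂ (lt c) + realPairing (m₂ v₂) (lt c)
      - realPairing (ℓ₂ w₂) (lt c) + (1 / 2 : ℝ) * realPairing (ℓ₂ c.1) T₂
      - (1 / 2 : ℝ) * realPairing S₂ (m₂ c.1))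
    (e₁ : genPairing (complexGen (m₁ v₁) (m₂ v₁)) (complexGen (lt a) (lt b)) = 0)
    (e₂ : genPairing (complexGen (m₁ v₂) (m₂ v₂)) (complexGen (lt a) (lt b)) = 0)
    (e₃ : genPairing (complexGen (ℓ₁ w₁) (ℓ₂ w₁)) (complexGen (lt a) (lt b)) = 0)
    (e₄ : genPairing (complexGen (ℓ₁ w₂) (ℓ₂ w₂)) (complexGen (lt a) (lt b)) = 0)
    (e₅ : genPairing (complexGen (ℓ₁ a.1) (ℓ₂ a.1)) (complexGen T₁ T₂) = 0)
    (e₆ : genPairing (complexGen (ℓ₁ b.1) (ℓ₂ b.1)) (complexGen T₁ T₂) = 0)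
    (e₇ : genPairing (complexGen S₁ S₂) (complexGen (m₁ a.1) (m₂ a.1)) = 0)
    (e₈ : genPairing (complexGen S₁ S₂) (complexGen (m₁ b.1) (m₂ b.1)) = 0) :
    genPairing (complexGen (B₁₁ - B₂₂) (B₁₂ + B₂₁)) (complexGen a b) =
      lieForm G (complexGen S₁ S₂) (complexGen T₁ T₂) (complexGen (lt a) (lt b)) := by
  rw [genPairing_complexGen, Complex.ext_iff] at e₁ e₂ e₃ e₄ e₅ e₆ e₇ e₈
  simp only [Complex.zero_re, Complex.zero_im] at e₁ e₂ e₃ e₄ e₅ e₆ e₇ e₈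
  rw [genPairing_complexGen, lieForm_complexGen]
  simp only [realPairing_sub_left, realPairing_add_left, r₁₁, r₁₂, r₂₁, r₂₂]
  apply Complex.ext
  · simp only
    linarith [e₁.1, e₂.2, e₃.1, e₄.2, e₅.1, e₆.2, e₇.1, e₈.2]
  · simp only
    linarith [e₁.2, e₂.1, e₃.2, e₄.1, e₅.2, e₆.1, e₇.2, e₈.1]

end CourantAux

/-! ### The Courant bracket of sections of an invariant family. -/

section CourantOfInvariant

variable {E : Type*} [NormedAddCommGroup E] [NormedSpace ℝ E] [FiniteDimensional ℝ E]
  [CompleteSpace E]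
  {G : Type*} [TopologicalSpace G] [ChartedSpace E G] [Group G] [LieGroup 𝓘(ℝ, E) ∞ G]
  {K : Subgroup G}
  {E' : Type*} [NormedAddCommGroup E'] [NormedSpace ℝ E'] [FiniteDimensional ℝ E']
  [ChartedSpace E' (G ⧸ K)] [IsManifold 𝓘(ℝ, E') ∞ (G ⧸ K)]
  (hπ : Manifold.IsSubmersion 𝓘(ℝ, E) 𝓘(ℝ, E') ∞ (QuotientGroup.mk : G → G ⧸ K))
  {p : G ⧸ K} {U : Set E'} {σ : E' → G} (h : IsLocalLift E E' p U σ)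

include hπ h

/-- The Courant bracket of real sections, in terms of their lifts. -/
lemma realPairing_courantBracket {N' : E' →L[ℝ] E →L[ℝ] E'}
    (hN' : HasFDerivAt (fun z => (liftFrameInv p σ z).comp (projMap E K E')) N'
      (extChartAt 𝓘(ℝ, E') p p))
    {s t : RealSection E' (G ⧸ K)} {V' W' : E' →L[ℝ] E'} {ξ' η' : E' →L[ℝ] E' →L[ℝ] ℝ}
    {ℓ' m' : E' → E × (E →L[ℝ] ℝ)}
    (hV : HasFDerivAt (fieldInChart (M := G ⧸ K) (fun q => (s q).1) p) V'
      (extChartAt 𝓘(ℝ, E') p p))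
    (hξ : HasFDerivAt (coFieldInChart (M := G ⧸ K) (fun q => (s q).2) p) ξ'
      (extChartAt 𝓘(ℝ, E') p p))
    (hℓ : ∀ u, ℓ' u = (fderiv ℝ (maurerCartan E σ) (extChartAt 𝓘(ℝ, E') p p) u (s p).1 +
        maurerCartan E σ (extChartAt 𝓘(ℝ, E') p p) (V' u),
      (ξ' u).comp ((liftFrameInv p σ (extChartAt 𝓘(ℝ, E') p p)).comp (projMap E K E')) +
        ContinuousLinearMap.comp (s p).2 (N' u)))
    (hW : HasFDerivAt (fieldInChart (M := G ⧸ K) (fun q => (t q).1) p) W'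
      (extChartAt 𝓘(ℝ, E') p p))
    (hη : HasFDerivAt (coFieldInChart (M := G ⧸ K) (fun q => (t q).2) p) η'
      (extChartAt 𝓘(ℝ, E') p p))
    (hm : ∀ u, m' u = (fderiv ℝ (maurerCartan E σ) (extChartAt 𝓘(ℝ, E') p p) u (t p).1 +
        maurerCartan E σ (extChartAt 𝓘(ℝ, E') p p) (W' u),
      (η' u).comp ((liftFrameInv p σ (extChartAt 𝓘(ℝ, E') p p)).comp (projMap E K E')) +
        ContinuousLinearMap.comp (t p).2 (N' u)))
    (a : E' × (E' →L[ℝ] ℝ)) :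
    realPairing (V := E') (courantBracket s t p) a =
      realForm G (liftTransport E K p σ (extChartAt 𝓘(ℝ, E') p p) (s p))
          (liftTransport E K p σ (extChartAt 𝓘(ℝ, E') p p) (t p))
          (liftTransport E K p σ (extChartAt 𝓘(ℝ, E') p p) a)
        + realPairing (m' (s p).1) (liftTransport E K p σ (extChartAt 𝓘(ℝ, E') p p) a)
        - realPairing (ℓ' (t p).1) (liftTransport E K p σ (extChartAt 𝓘(ℝ, E') p p) a)
        + (1 / 2 : ℝ) * realPairing (ℓ' a.1)
            (liftTransport E K p σ (extChartAt 𝓘(ℝ, E') p p) (t p))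
        - (1 / 2 : ℝ) * realPairing (liftTransport E K p σ (extChartAt 𝓘(ℝ, E') p p) (s p))
            (m' a.1) := by
  set z₀ := extChartAt 𝓘(ℝ, E') p p with hz₀
  have hΘ := ((contDiffAt_maurerCartan h.isOpen h.smooth h.mem).differentiableAt
    (by simp)).hasFDerivAt
  have hNΘ : ∀ z ∈ U, ∀ v,
      (liftFrameInv p σ z).comp (projMap E K E') (maurerCartan E σ z v) = v := fun z hz v =>
    congrArg (fun T : E' →L[ℝ] E' => T v) (liftFrameInv_comp hπ h hz)
  -- This is the derivative at `z₀` of the identity `N Θ v = v`, valid on all of `U`.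
  have hN'Θ : ∀ u v, N' u (maurerCartan E σ z₀ v) =
      -(liftFrameInv p σ z₀).comp (projMap E K E') (fderiv ℝ (maurerCartan E σ) z₀ u v) := by
    intro u v
    have h1 : HasFDerivAt (fun z =>
        (liftFrameInv p σ z).comp (projMap E K E') (maurerCartan E σ z v)) (0 : E' →L[ℝ] E') z₀ := by
      refine (hasFDerivAt_const v z₀).congr_of_eventuallyEq ?_
      filter_upwards [h.isOpen.mem_nhds h.mem] with z hz using hNΘ z hz v
    have h2 := hN'.clm_apply (hΘ.clm_apply (hasFDerivAt_const v z₀))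
    have h3 := congrArg (fun T : E' →L[ℝ] E' => T u) (h2.unique h1)
    rw [eq_neg_iff_add_eq_zero, add_comm]
    simpa [hz₀] using h3
  have key := realPairing_courant_aux (G := G) (hNΘ z₀ h.mem) hN'Θ
    (maurerCartan_equation h.isOpen h.smooth h.mem) (s p).1 (t p).1 a.1 V' W' (s p).2 (t p).2 a.2
    ξ' η' hℓ hm
  refine Eq.trans ?_ key
  have h1 := courantBracket_fst_eq_chart s t p hV hW
  have h2 := courantBracket_snd_eq_chart s t p hV hW hξ hη a.1
  exact congrArg₂ (· + ·) (congrArg a.2 h1) h2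

lemma liftTransport_mem_self {D : G ⧸ K → Submodule ℂ (GenSpace (ℂ ⊗[ℝ] E'))}
    (hD : ∀ (g : G) (p : G ⧸ K), genPullback (complexMap (actMap E' g p)) (D (g • p)) = D p)
    {c d : E' × (E' →L[ℝ] ℝ)} (hcd : complexGen c d ∈ D p) :
    complexGen (liftTransport E K p σ (extChartAt 𝓘(ℝ, E') p p) c)
        (liftTransport E K p σ (extChartAt 𝓘(ℝ, E') p p) d) ∈
      genPullback (complexMap (projMap E K E')) (D ((1 : G) : G ⧸ K)) := by
  -- Only the values at `p` enter, so constant families serve and need not be sections of `D`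
  -- elsewhere.
  have h1 := liftTransport_mem hπ h hD h.mem (s := fun _ => c) (t := fun _ => d)
  rw [sectionInChart_self, sectionInChart_self, chart_symm_chart (mem_chart_source E' p)] at h1
  exact h1 hcd

/-- The Courant bracket of sections of an invariant family, paired with an element of it. -/
lemma genPairing_courant {D : SubspaceFamily E' (G ⧸ K)} (hD : D.IsInvariant G)
    (hmax : IsMaxIsotropic (D ((1 : G) : G ⧸ K))) {S : Set (G ⧸ K)} (hS : IsOpen S) (hp : p ∈ S)
    {s t : ComplexSection E' (G ⧸ K)} (hs : s.SmoothOn S) (ht : t.SmoothOn S)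
    (hsD : ∀ q ∈ S, s.val q ∈ D q) (htD : ∀ q ∈ S, t.val q ∈ D q)
    {a b : E' × (E' →L[ℝ] ℝ)} (hab : complexGen a b ∈ D p) :
    genPairing (complexGen (V := E') ((s.courant t).re p) ((s.courant t).im p)) (complexGen a b) =
      lieForm G
        (complexGen (liftTransport E K p σ (extChartAt 𝓘(ℝ, E') p p) (s.re p))
          (liftTransport E K p σ (extChartAt 𝓘(ℝ, E') p p) (s.im p)))
        (complexGen (liftTransport E K p σ (extChartAt 𝓘(ℝ, E') p p) (t.re p))
          (liftTransport E K p σ (extChartAt 𝓘(ℝ, E') p p) (t.im p)))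
        (complexGen (liftTransport E K p σ (extChartAt 𝓘(ℝ, E') p p) a)
          (liftTransport E K p σ (extChartAt 𝓘(ℝ, E') p p) b)) := by
  have : CompleteSpace E' := FiniteDimensional.complete ℝ E'
  set z₀ := extChartAt 𝓘(ℝ, E') p p with hz₀
  set L : Submodule ℂ (GenSpace (ℂ ⊗[ℝ] E)) :=
    genPullback (complexMap (projMap E K E')) (D ((1 : G) : G ⧸ K)) with hLdef
  have hL : IsMaxIsotropic L :=
    isMaxIsotropic_genPullback (complexMap_surjective (projMap_surjective hπ)) hmax
  have hN := (((contDiffAt_liftFrameInv hπ h h.mem).clm_comp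
    (contDiffAt_const (c := projMap E K E'))).differentiableAt (by simp)).hasFDerivAt
  obtain ⟨V₁, ξ₁, ℓ₁, hV₁, hξ₁, hℓ₁, hℓ₁'⟩ := exists_hasFDerivAt_liftTransport hπ h hs.1 hS hp hN
  obtain ⟨V₂, ξ₂, ℓ₂, hV₂, hξ₂, hℓ₂, hℓ₂'⟩ := exists_hasFDerivAt_liftTransport hπ h hs.2 hS hp hN
  obtain ⟨W₁, η₁, m₁, hW₁, hη₁, hm₁, hm₁'⟩ := exists_hasFDerivAt_liftTransport hπ h ht.1 hS hp hN
  obtain ⟨W₂, η₂, m₂, hW₂, hη₂, hm₂, hm₂'⟩ := exists_hasFDerivAt_liftTransport hπ h ht.2 hS hp hN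
  have hsymm : (extChartAt 𝓘(ℝ, E') p).symm z₀ = p := chart_symm_chart (mem_chart_source E' p)
  have hev : ∀ᶠ z in 𝓝 z₀, z ∈ U ∧ (extChartAt 𝓘(ℝ, E') p).symm z ∈ S := by
    have hc : ContinuousAt (extChartAt 𝓘(ℝ, E') p).symm z₀ :=
      (contMDiffAt_chart_symm (chart_mem_target (mem_chart_source E' p))).continuousAt
    have h1 : ∀ᶠ z in 𝓝 z₀, z ∈ U := h.isOpen.mem_nhds h.mem
    exact h1.and (hc.eventually (hS.mem_nhds (hsymm.symm ▸ hp)))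
  -- The lifts take values in the fixed space `L` near `z₀`, hence so do their derivatives. This is
  -- what makes the non-tensorial terms disappear.
  have hℓmem : ∀ u, complexGen (ℓ₁ u) (ℓ₂ u) ∈ L :=
    hasFDerivAt_complexGen_mem hL hℓ₁ hℓ₂
      (hev.mono fun z hz => liftTransport_mem hπ h hD hz.1 (hsD _ hz.2))
  have hmmem : ∀ u, complexGen (m₁ u) (m₂ u) ∈ L :=
    hasFDerivAt_complexGen_mem hL hm₁ hm₂
      (hev.mono fun z hz => liftTransport_mem hπ h hD hz.1 (htD _ hz.2))
  have hpt := fun c d => liftTransport_mem_self hπ h hD (c := c) (d := d)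
  have hab' := hpt a b hab
  have hs' := hpt (s.re p) (s.im p) (hsD p hp)
  have ht' := hpt (t.re p) (t.im p) (htD p hp)
  have zero : ∀ {x y}, x ∈ L → y ∈ L → genPairing x y = 0 := fun hx hy => hL.prop _ hx _ hy
  have r₁₁ := realPairing_courantBracket hπ h hN hV₁ hξ₁ hℓ₁' hW₁ hη₁ hm₁'
  have r₁₂ := realPairing_courantBracket hπ h hN hV₁ hξ₁ hℓ₁' hW₂ hη₂ hm₂'
  have r₂₁ := realPairing_courantBracket hπ h hN hV₂ hξ₂ hℓ₂' hW₁ hη₁ hm₁'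
  have r₂₂ := realPairing_courantBracket hπ h hN hV₂ hξ₂ hℓ₂' hW₂ hη₂ hm₂'
  exact genPairing_courant_aux r₁₁ r₁₂ r₂₁ r₂₂ (zero (hmmem (s.re p).1) hab')
    (zero (hmmem (s.im p).1) hab') (zero (hℓmem (t.re p).1) hab') (zero (hℓmem (t.im p).1) hab')
    (zero (hℓmem a.1) ht') (zero (hℓmem b.1) ht') (zero hs' (hmmem a.1)) (zero hs' (hmmem b.1))

end CourantOfInvariant

/-! ### Integrability and the trilinear form on the pullback. -/

section Correspondence

variable {E : Type*} [NormedAddCommGroup E] [NormedSpace ℝ E] [FiniteDimensional ℝ E]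
  [CompleteSpace E]
  {G : Type*} [TopologicalSpace G] [ChartedSpace E G] [Group G] [LieGroup 𝓘(ℝ, E) ∞ G]
  {K : Subgroup G}
  {E' : Type*} [NormedAddCommGroup E'] [NormedSpace ℝ E'] [FiniteDimensional ℝ E']
  [ChartedSpace E' (G ⧸ K)] [IsManifold 𝓘(ℝ, E') ∞ (G ⧸ K)]
  (hπ : Manifold.IsSubmersion 𝓘(ℝ, E) 𝓘(ℝ, E') ∞ (QuotientGroup.mk : G → G ⧸ K))

include hπ

lemma isIntegrable_of_lieForm {D : SubspaceFamily E' (G ⧸ K)} (hD : D.IsInvariant G)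
    (hmax : ∀ p, IsMaxIsotropic (D p))
    (hform : ∀ a ∈ genPullback (complexMap (projMap E K E')) (D ((1 : G) : G ⧸ K)),
      ∀ b ∈ genPullback (complexMap (projMap E K E')) (D ((1 : G) : G ⧸ K)),
      ∀ c ∈ genPullback (complexMap (projMap E K E')) (D ((1 : G) : G ⧸ K)),
        lieForm G a b c = 0) : D.IsIntegrable := by
  intro S hS s t hs ht hsD htD p hp
  obtain ⟨U, σ, h⟩ := exists_isLocalLift hπ p
  refine (isMaxIsotropic_iff.1 (hmax p) _).2 fun m hm => ?_
  obtain ⟨a, b, rfl⟩ := exists_eq_complexGen (V := E') m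
  exact (genPairing_courant hπ h hD (hmax _) hS hp hs ht hsD htD hm).trans
    (hform _ (liftTransport_mem_self hπ h hD (hsD p hp))
      _ (liftTransport_mem_self hπ h hD (htD p hp)) _ (liftTransport_mem_self hπ h hD hm))

/-- Every element of the pullback is, up to the Lie algebra of the isotropy group, the lift of the
value of a section at the base point. -/
lemma exists_section_lift {U : Set E'} {σ : E' → G}
    (h : IsLocalLift E E' ((1 : G) : G ⧸ K) U σ)
    {D : SubspaceFamily E' (G ⧸ K)} (hD : D.IsInvariant G) {x : GenSpace (ℂ ⊗[ℝ] E)}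
    (hx : x ∈ genPullback (complexMap (projMap E K E')) (D ((1 : G) : G ⧸ K))) :
    ∃ (s : ComplexSection E' (G ⧸ K)) (κ : ℂ ⊗[ℝ] E),
      s.SmoothOn ((extChartAt 𝓘(ℝ, E') ((1 : G) : G ⧸ K)).source ∩
        extChartAt 𝓘(ℝ, E') ((1 : G) : G ⧸ K) ⁻¹' U) ∧
      (∀ q ∈ (extChartAt 𝓘(ℝ, E') ((1 : G) : G ⧸ K)).source ∩
        extChartAt 𝓘(ℝ, E') ((1 : G) : G ⧸ K) ⁻¹' U, s.val q ∈ D q) ∧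
      complexMap (projMap E K E') κ = 0 ∧
      x = complexGen
        (liftTransport E K ((1 : G) : G ⧸ K) σ
          (extChartAt 𝓘(ℝ, E') ((1 : G) : G ⧸ K) ((1 : G) : G ⧸ K)) (s.re ((1 : G) : G ⧸ K)))
        (liftTransport E K ((1 : G) : G ⧸ K) σ
          (extChartAt 𝓘(ℝ, E') ((1 : G) : G ⧸ K) ((1 : G) : G ⧸ K)) (s.im ((1 : G) : G ⧸ K)))
        + (κ, 0) := by
  have : CompleteSpace E' := FiniteDimensional.complete ℝ E'
  set o : G ⧸ K := ((1 : G) : G ⧸ K) with ho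
  set z₀ := extChartAt 𝓘(ℝ, E') o o with hz₀
  obtain ⟨ξ, hξ, hx2⟩ := mem_genPullback.1 hx
  obtain ⟨a, b, hab⟩ := exists_eq_complexGen (V := E') (complexMap (projMap E K E') x.1, ξ)
  -- `T` is a right inverse of the projected derivative. The lift at the base point only reaches
  -- vectors in its range, and the isotropy part `κ` accounts for the difference.
  let T : E' →L[ℝ] E := (maurerCartan E σ z₀).comp (liftFrameInv o σ z₀)
  have hT : (projMap E K E').comp T = ContinuousLinearMap.id ℝ E' := liftFrame_comp_inv hπ h h.mem
  refine ⟨⟨frameSection o σ a, frameSection o σ b⟩,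
    x.1 - complexMap T (complexMap (projMap E K E') x.1),
    ⟨smoothOn_frameSection hπ h a, smoothOn_frameSection hπ h b⟩,
    fun q hq => frameSection_mem hπ h hD ?_ hq, ?_, ?_⟩
  · rw [← hab]
    exact hξ
  · have h1 := complexMap_comp_eq_id hT
    rw [map_sub, ← LinearMap.comp_apply (complexMap (projMap E K E')) (complexMap T), h1,
      LinearMap.id_apply, sub_self]
  · have h1 : ∀ c : E' × (E' →L[ℝ] ℝ), liftTransport E K o σ z₀ (frameSection o σ c o) =
        transport T (projMap E K E') c := by
      intro c
      have h2 := liftTransport_frameSection hπ h c h.mem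
      rw [sectionInChart_self] at h2
      exact h2
    have h3 : x = complexGen (transport T (projMap E K E') a) (transport T (projMap E K E') b) +
        (x.1 - complexMap T (complexMap (projMap E K E') x.1), 0) := by
      rw [complexGen_transport, ← hab]
      refine Prod.ext ?_ ?_
      · simp
      · rw [hx2]; simp
    rw [← h1, ← h1] at h3
    exact h3

/-- On lifts of values of sections the form is the Courant bracket paired with an element of `D`,
hence zero. Isotropy components are disposed of by stability. -/
lemma lieForm_eq_zero_of_isIntegrable {D : SubspaceFamily E' (G ⧸ K)} (hD : D.IsInvariant G)
    (hmax : ∀ p, IsMaxIsotropic (D p)) (hint : D.IsIntegrable)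
    (hstab : ∀ κ, complexMap (projMap E K E') κ = 0 →
      ∀ a ∈ genPullback (complexMap (projMap E K E')) (D ((1 : G) : G ⧸ K)),
      ∀ b ∈ genPullback (complexMap (projMap E K E')) (D ((1 : G) : G ⧸ K)),
        lieForm G (κ, 0) a b = 0)
    {x y w : GenSpace (ℂ ⊗[ℝ] E)}
    (hx : x ∈ genPullback (complexMap (projMap E K E')) (D ((1 : G) : G ⧸ K)))
    (hy : y ∈ genPullback (complexMap (projMap E K E')) (D ((1 : G) : G ⧸ K)))
    (hw : w ∈ genPullback (complexMap (projMap E K E')) (D ((1 : G) : G ⧸ K))) :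
    lieForm G x y w = 0 := by
  obtain ⟨U, σ, h⟩ := exists_isLocalLift hπ ((1 : G) : G ⧸ K)
  obtain ⟨s, κ, hs, hsD, hκ, hxs⟩ := exists_section_lift hπ h hD hx
  obtain ⟨t, κ', ht, htD, hκ', hyt⟩ := exists_section_lift hπ h hD hy
  obtain ⟨r, κ'', -, hrD, hκ'', hwr⟩ := exists_section_lift hπ h hD hw
  have hmem : ((1 : G) : G ⧸ K) ∈ (extChartAt 𝓘(ℝ, E') ((1 : G) : G ⧸ K)).source ∩
      extChartAt 𝓘(ℝ, E') ((1 : G) : G ⧸ K) ⁻¹' U := ⟨mem_extChartAt_source _, h.mem⟩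
  have hs' := liftTransport_mem_self hπ h hD (hsD _ hmem)
  have ht' := liftTransport_mem_self hπ h hD (htD _ hmem)
  have key := genPairing_courant hπ h hD (hmax _) h.isOpen_preimage hmem hs ht hsD htD
    (hrD _ hmem)
  have hzero := (hmax _).prop _ (hint _ h.isOpen_preimage s t hs ht hsD htD _ hmem) _ (hrD _ hmem)
  have hbase := key.symm.trans hzero
  -- Cyclicity brings each isotropy component to the first slot, where stability kills it.
  rw [hxs, lieForm_add_left, hstab κ hκ y hy w hw, add_zero, hyt, lieForm_add_middle,
    lieForm_cyclic _ (κ', 0), hstab κ' hκ' w hw _ hs', add_zero, hwr, lieForm_add_right, hbase,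
    ← lieForm_cyclic (κ'', 0), hstab κ'' hκ'' _ hs' _ ht', add_zero]

lemma isMaxIsotropic_pullback {D : Submodule ℂ (GenSpace (ℂ ⊗[ℝ] E'))} (hD : IsMaxIsotropic D) :
    IsMaxIsotropic (genPullback (complexMap (projMap E K E')) D) :=
  isMaxIsotropic_genPullback (complexMap_surjective (projMap_surjective hπ)) hD

end Correspondence

/-! ### The correspondence between invariant families and subspaces at the identity. -/

section MainCorrespondence

variable {E : Type*} [NormedAddCommGroup E] [NormedSpace ℝ E] [FiniteDimensional ℝ E]
  [CompleteSpace E]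
  {G : Type*} [TopologicalSpace G] [T2Space G] [ChartedSpace E G] [Group G] [LieGroup 𝓘(ℝ, E) ∞ G]
  {K : Subgroup G}
  {E' : Type*} [NormedAddCommGroup E'] [NormedSpace ℝ E'] [FiniteDimensional ℝ E']
  [ChartedSpace E' (G ⧸ K)]

lemma genImage_pullbackAtOne (D : SubspaceFamily E' (G ⧸ K)) :
    genImage (pullbackAtOne E K D) =
      genPullback (complexMap (projMap E K E')) (D ((1 : G) : G ⧸ K)) :=
  genImage_comap _

/-- The kernel of the complexified projection is the complex span of the real kernel, and the form
is complex linear in its first argument. -/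
lemma lieForm_stable_of_real {L : Submodule ℂ (GenSpace (ℂ ⊗[ℝ] E))}
    (hreal : ∀ X : E, projMap E K E' X = 0 → ∀ a ∈ L, ∀ b ∈ L,
      lieForm G ((1 : ℂ) ⊗ₜ[ℝ] X, 0) a b = 0) {κ : ℂ ⊗[ℝ] E}
    (hκ : complexMap (projMap E K E') κ = 0) : ∀ a ∈ L, ∀ b ∈ L, lieForm G (κ, 0) a b = 0 := by
  intro a ha b hb
  rw [← LinearMap.mem_ker, ker_complexMap] at hκ
  induction hκ using Submodule.span_induction with
  | mem x hx =>
    obtain ⟨X, hX, rfl⟩ := hx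
    exact hreal X hX a ha b hb
  | zero =>
    have := lieForm_smul_left (G := G) 0 0 a b
    rwa [zero_smul, zero_mul] at this
  | add x y _ _ hx hy =>
    have := lieForm_add_left (G := G) (x, 0) (y, 0) a b
    rw [hx, hy, Prod.mk_add_mk, add_zero, add_zero] at this
    exact this
  | smul c x _ hx =>
    have := lieForm_smul_left (G := G) c (x, 0) a b
    rw [hx, Prod.smul_mk, smul_zero, mul_zero] at this
    exact this

variable [IsManifold 𝓘(ℝ, E') ∞ (G ⧸ K)]
  (hπ : Manifold.IsSubmersion 𝓘(ℝ, E) 𝓘(ℝ, E') ∞ (QuotientGroup.mk : G → G ⧸ K))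

include hπ

lemma isStableUnder_iff_lieForm {L : Submodule ℂ (DualSemidirect (ComplexLieAlgebra E G))}
    (hL : IsLinearAlmostDirac L) {L' : Submodule ℂ (GenSpace (ℂ ⊗[ℝ] E))} (h : genImage L = L') :
    IsStableUnder (complexSubgroupLieAlgebra E K) L ↔
      ∀ κ, complexMap (projMap E K E') κ = 0 → ∀ a ∈ L', ∀ b ∈ L', lieForm G (κ, 0) a b = 0 := by
  rw [isStableUnder_iff hL, complexSubgroupLieAlgebra_eq hπ, h]
  rfl

lemma containsSubalgebra_iff_mem {L : Submodule ℂ (DualSemidirect (ComplexLieAlgebra E G))}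
    {L' : Submodule ℂ (GenSpace (ℂ ⊗[ℝ] E))} (h : genImage L = L') :
    ContainsSubalgebra (complexSubgroupLieAlgebra E K) L ↔
      ∀ κ, complexMap (projMap E K E') κ = 0 → (κ, 0) ∈ L' := by
  rw [containsSubalgebra_iff, complexSubgroupLieAlgebra_eq hπ, h]
  rfl

lemma pullbackAtOne_mem {D : SubspaceFamily E' (G ⧸ K)} (hmax : ∀ p, IsMaxIsotropic (D p))
    (hD : D.IsInvariant G) :
    IsLinearAlmostDirac (pullbackAtOne E K D) ∧
      ContainsSubalgebra (complexSubgroupLieAlgebra E K) (pullbackAtOne E K D) ∧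
      IsStableUnder (complexSubgroupLieAlgebra E K) (pullbackAtOne E K D) := by
  have hL := isMaxIsotropic_pullback hπ (hmax ((1 : G) : G ⧸ K))
  have himg := genImage_pullbackAtOne (E := E) D
  have hLA : IsLinearAlmostDirac (pullbackAtOne E K D) := by
    have h : IsMaxIsotropic (genImage (pullbackAtOne E K D)) := by
      rw [himg]
      exact hL
    exact h
  refine ⟨hLA, (containsSubalgebra_iff_mem hπ himg).2 fun κ hκ => ?_,
    (isStableUnder_iff_lieForm hπ hLA himg).2 fun κ hκ => ?_⟩
  · refine mem_genPullback.2 ⟨0, ?_, (LinearMap.zero_comp _).symm⟩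
    rw [hκ]
    exact Submodule.zero_mem _
  · refine lieForm_stable_of_real (fun X hX a ha b hb => ?_) hκ
    refine lieForm_eq_zero_of_conjGen hπ hL.prop ((conjGen_mem_iff hπ).2 fun k hk => ?_) hX ha hb
    have h1 := hD k ((1 : G) : G ⧸ K)
    rw [smul_mk_one_of_mem hk] at h1
    exact h1

lemma pullbackAtOne_injective {D D' : SubspaceFamily E' (G ⧸ K)} (hD : D.IsInvariant G)
    (hD' : D'.IsInvariant G) (h : pullbackAtOne E K D = pullbackAtOne E K D') : D = D' := by
  have h1 := congrArg genImage h
  rw [genImage_pullbackAtOne, genImage_pullbackAtOne] at h1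
  have h2 := genPullback_injective (complexMap_surjective (projMap_surjective hπ)) h1
  funext p
  obtain ⟨x, rfl⟩ := QuotientGroup.mk_surjective p
  refine (eq_genPullback_of_invariant (D := D) hπ hD x).trans ?_
  refine Eq.trans ?_ (eq_genPullback_of_invariant (D := D') hπ hD' x).symm
  rw [h2]

/-- Containing `𝔨_ℂ` lets `L` descend to the base fibre. Stability integrates to invariance under
the connected group `K`, so the translates of that fibre are well defined and form an invariant
smooth family. -/
lemma exists_pullbackAtOne_eq (hK : IsConnected (K : Set G))
    {L : Submodule ℂ (DualSemidirect (ComplexLieAlgebra E G))} (hL : IsLinearAlmostDirac L)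
    (hc : ContainsSubalgebra (complexSubgroupLieAlgebra E K) L)
    (hs : IsStableUnder (complexSubgroupLieAlgebra E K) L) :
    ∃ D : SubspaceFamily E' (G ⧸ K), D.IsAlmostDirac ∧ D.IsInvariant G ∧
      pullbackAtOne E K D = L := by
  have hc' := (containsSubalgebra_iff_mem hπ rfl).1 hc
  have hs' := (isStableUnder_iff_lieForm hπ hL rfl).1 hs
  obtain ⟨D₀, hD₀, hD₀L⟩ := exists_genPullback_eq
    (complexMap_surjective (projMap_surjective hπ)) hL hc'
  have hmax : IsMaxIsotropic (genPullback (complexMap (projMap E K E')) D₀) := hD₀L ▸ hL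
  have hconj : ∀ k ∈ K, ∀ a ∈ genPullback (complexMap (projMap E K E')) D₀,
      conjGen k a ∈ genPullback (complexMap (projMap E K E')) D₀ := by
    intro k hk a ha
    refine conjGen_mem hπ hK hmax (fun X hX a ha b hb => ?_) hk ha
    rw [hD₀L] at ha hb
    refine hs' _ ?_ a ha b hb
    have : complexMap (projMap E K E') ((1 : ℂ) ⊗ₜ[ℝ] X) = (1 : ℂ) ⊗ₜ[ℝ] projMap E K E' X := rfl
    rw [this, hX, TensorProduct.tmul_zero]
  have hiso := (conjGen_mem_iff hπ).1 hconj
  have hinv : SubspaceFamily.IsInvariant (E := E') G (translateFamily K D₀) :=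
    translateFamily_invariant hπ hiso
  have hmaxp : ∀ p, IsMaxIsotropic (translateFamily K D₀ p) := fun p =>
    isMaxIsotropic_genPullback (complexMap_surjective (actMap_surjective hπ _ p)) hD₀
  refine ⟨translateFamily K D₀, ⟨isSubbundle_of_invariant hπ hinv, hmaxp⟩, hinv, ?_⟩
  have h := ((genImage_pullbackAtOne (translateFamily K D₀)).trans
    (congrArg (genPullback (complexMap (projMap E K E'))) (translateFamily_one hπ hiso))).trans hD₀L
  exact (comap_genImage _).symm.trans ((congrArg _ h).trans (comap_genImage L))

lemma isIntegrable_iff {D : SubspaceFamily E' (G ⧸ K)} (hmax : ∀ p, IsMaxIsotropic (D p))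
    (hD : D.IsInvariant G) : D.IsIntegrable ↔ IsLinearDirac (pullbackAtOne E K D) := by
  have himg := genImage_pullbackAtOne (E := E) D
  obtain ⟨hLA, -, hst⟩ := pullbackAtOne_mem hπ hmax hD
  rw [isLinearDirac_iff, himg]
  constructor
  · intro hint
    refine ⟨isMaxIsotropic_pullback hπ (hmax _), fun a ha b hb c hc => ?_⟩
    exact lieForm_eq_zero_of_isIntegrable hπ hD hmax hint
      ((isStableUnder_iff_lieForm hπ hLA himg).1 hst) ha hb hc
  · rintro ⟨-, h⟩
    exact isIntegrable_of_lieForm hπ hD hmax h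

end MainCorrespondence

theorem theorem3p8
    {E : Type*} [NormedAddCommGroup E] [NormedSpace ℝ E] [FiniteDimensional ℝ E] [CompleteSpace E]
    {G : Type*} [TopologicalSpace G] [T2Space G] [ChartedSpace E G] [Group G]
    [LieGroup 𝓘(ℝ, E) ∞ G]
    (K : Subgroup G) (hclosed : IsClosed (K : Set G)) (hconn : IsConnected (K : Set G))
    {E' : Type*} [NormedAddCommGroup E'] [NormedSpace ℝ E'] [FiniteDimensional ℝ E']
    [ChartedSpace E' (G ⧸ K)] [IsManifold 𝓘(ℝ, E') ∞ (G ⧸ K)]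
    -- the smooth structure of the homogeneous space is the unique one making the projection a
    -- smooth submersion
    (hπ : Manifold.IsSubmersion 𝓘(ℝ, E) 𝓘(ℝ, E') ∞ (QuotientGroup.mk : G → G ⧸ K)) :
    -- almost Dirac structures on the quotient
    Set.BijOn (pullbackAtOne E K)
      {D : SubspaceFamily E' (G ⧸ K) | D.IsAlmostDirac ∧ D.IsInvariant G}
      {L | IsLinearAlmostDirac L ∧ ContainsSubalgebra (complexSubgroupLieAlgebra E K) L ∧
        IsStableUnder (complexSubgroupLieAlgebra E K) L} ∧
    -- Dirac structures on the quotient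
    Set.BijOn (pullbackAtOne E K)
      {D : SubspaceFamily E' (G ⧸ K) | D.IsAlmostDirac ∧ D.IsIntegrable ∧ D.IsInvariant G}
      {L | IsLinearDirac L ∧ ContainsSubalgebra (complexSubgroupLieAlgebra E K) L} ∧
    -- every Dirac Lie subalgebra is of the form `L(E, ε)`
    (∀ L : Submodule ℂ (DualSemidirect (ComplexLieAlgebra E G)), IsLinearDirac L →
      ∃ (P : LieSubalgebra ℂ (ComplexLieAlgebra E G))
        (ε : P.toSubmodule [⋀^Fin 2]→ₗ[ℂ] ℂ), L = linearGraph P.toSubmodule ε) ∧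
    -- Dirac subalgebras and pairs
    Set.BijOn (fun q : PrePair (ComplexLieAlgebra E G) => linearGraph q.1.toSubmodule q.2)
      {q | IsDiracPair (complexSubgroupLieAlgebra E K) q}
      {L | IsLinearDirac L ∧ ContainsSubalgebra (complexSubgroupLieAlgebra E K) L} ∧
    -- Dirac structures on the quotient and pairs
    ∃ Φ : SubspaceFamily E' (G ⧸ K) → PrePair (ComplexLieAlgebra E G),
      Set.BijOn Φ
        {D : SubspaceFamily E' (G ⧸ K) | D.IsAlmostDirac ∧ D.IsIntegrable ∧ D.IsInvariant G}
        {q | IsDiracPair (complexSubgroupLieAlgebra E K) q} ∧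
      ∀ D : SubspaceFamily E' (G ⧸ K), D.IsAlmostDirac → D.IsIntegrable → D.IsInvariant G →
        pullbackAtOne E K D = linearGraph (Φ D).1.toSubmodule (Φ D).2 := by
  have hdirac : Set.BijOn (pullbackAtOne E K)
      {D : SubspaceFamily E' (G ⧸ K) | D.IsAlmostDirac ∧ D.IsIntegrable ∧ D.IsInvariant G}
      {L | IsLinearDirac L ∧ ContainsSubalgebra (complexSubgroupLieAlgebra E K) L} := by
    refine ⟨?_, ?_, ?_⟩
    · rintro D ⟨hD, hint, hinv⟩
      exact ⟨(isIntegrable_iff hπ hD.2 hinv).1 hint, (pullbackAtOne_mem hπ hD.2 hinv).2.1⟩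
    · rintro D ⟨-, -, hinv⟩ D' ⟨-, -, hinv'⟩ h
      exact pullbackAtOne_injective hπ hinv hinv' h
    · rintro L ⟨hL, hc⟩
      -- For a subalgebra containing `𝔨_ℂ`, stability under `𝔨_ℂ` is a special case of closure under
      -- brackets.
      obtain ⟨D, hD, hinv, rfl⟩ := exists_pullbackAtOne_eq (E' := E') hπ hconn hL.1 hc
        (hL.isStableUnder hc)
      exact ⟨D, ⟨hD, (isIntegrable_iff hπ hD.2 hinv).2 hL, hinv⟩, rfl⟩
  have hpairs := bijOn_linearGraph (complexSubgroupLieAlgebra E K)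
  refine ⟨⟨?_, ?_, ?_⟩, hdirac, fun L hL => hL.exists_eq_linearGraph, hpairs, ?_⟩
  · rintro D ⟨hD, hinv⟩
    exact pullbackAtOne_mem hπ hD.2 hinv
  · rintro D ⟨-, hinv⟩ D' ⟨-, hinv'⟩ h
    exact pullbackAtOne_injective hπ hinv hinv' h
  · rintro L ⟨hL, hc, hs⟩
    obtain ⟨D, hD, hinv, rfl⟩ := exists_pullbackAtOne_eq (E' := E') hπ hconn hL hc hs
    exact ⟨D, ⟨hD, hinv⟩, rfl⟩
  -- The pair `⟨⊤, 0⟩` only witnesses nonemptiness for `Function.invFunOn`. The map to pairs is the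
  -- inverse of the graph bijection after the pullback.
  · have : Nonempty (PrePair (ComplexLieAlgebra E G)) := ⟨⟨⊤, 0⟩⟩
    have hinv := hpairs.invOn_invFunOn
    refine ⟨fun D => Function.invFunOn (fun q : PrePair (ComplexLieAlgebra E G) =>
      linearGraph q.1.toSubmodule q.2) {q | IsDiracPair (complexSubgroupLieAlgebra E K) q}
        (pullbackAtOne E K D), ?_, fun D hD hint hD' => ?_⟩
    · exact (hinv.symm.bijOn hpairs.surjOn.mapsTo_invFunOn hpairs.mapsTo).comp hdirac
    · exact (hinv.2 (hdirac.mapsTo ⟨hD, hint, hD'⟩)).symm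

end
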